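/- Let $(M,g)$ be a smooth two-dimensional Riemannian manifold (without boundary), with area measure $\mu$ and one-dimensional (Hausdorff) measure $s$. Let $\theta\in(0,1]$ and $\kappa\in\mathbb{R}$, and assume that $(M,g)$ satisfies the $(\theta,\kappa)$-isoperimetric inequality, that is, $$4\pi\theta\,\mu(E)-\kappa\,\mu(E)^2\le s(\partial E)^2$$ for every compact connected domain $E\subset M$ with smooth (possibly empty) boundary. Let $\Omega\subset M$ be a nonempty open set with compact closure, $\lambda\in\mathbb{R}$, and let $u\in C^\infty(\overline\Omega)$ (that is, $u$ is smooth in $\Omega$ and $u$ and all its derivatives extend continuously to $\overline\Omega$) and $f:\Omega\to\mathbb{R}$ satisfy $$-\Delta_g u+\kappa=\lambda e^{2u}+f\ \text{ in }\Omega,\qquad u=0\ \text{ on }\partial\Omega,\qquad u>0\ \text{ in }\Omega,$$ where $\Delta_g$ is the Laplace--Beltrami operator. Set $\Theta=\frac{1}{2\pi}\int_\Omega f^+\,d\mu$, where $f^+=\max(f,0)$. Then $$4\pi(\theta-\Theta)\int_\Omega e^{2u}\,d\mu-\lambda\Big(\int_\Omega e^{2u}\,d\mu\Big)^2\le 4\pi\theta\,\mu(\Omega)-\kappa\,\mu(\Omega)^2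 .$$ In particular, if $\Theta=0$ and $0<\lambda\le\kappa$, then $$\int_\Omega e^{2u}\,d\mu+\mu(\Omega)\ge\frac{4\pi\theta}{\lambda}.$$ -/

import Mathlib

open MeasureTheory Set Filter Manifold Bundle
open scoped Topology ContDiff ENNReal MeasureTheory

noncomputable section

namespace SphereCovering

-- Vector spaces are charted by the identity, through `chartedSpaceSelf`.
attribute [-instance] TopCat.of.chartedSpace

/-- The Euclidean plane, model space of surfaces. -/
abbrev Plane : Type := EuclideanSpace ℝ (Fin 2)

/-- Partial derivative `∂ᵢ w (y)` of a function on the plane. -/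
def partialDeriv (i : Fin 2) (w : Plane → ℝ) (y : Plane) : ℝ :=
  fderiv ℝ w y (EuclideanSpace.single i 1)

section Surface

variable {M : Type*} [TopologicalSpace M] [ChartedSpace Plane M]

/-- The coordinate vector `∂ᵢ` at the point of coordinates `y` in the preferred chart around `x`:
the image of the `i`-th basis vector of the plane under the derivative of the inverse chart.
Meaningful for `y` in the target of the chart. -/
def coordVector (x : M) (y : Plane) (i : Fin 2) :
    TangentSpace (𝓡 2) ((extChartAt (𝓡 2) x).symm y) :=
  mfderiv 𝓘(ℝ, Plane) (𝓡 2) (extChartAt (𝓡 2) x).symm y (EuclideanSpace.single i (1 : ℝ))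

section Metric

variable [RiemannianBundle (fun x : M ↦ TangentSpace (𝓡 2) x)]

/-- The matrix `gᵢⱼ(y) = ⟨∂ᵢ, ∂ⱼ⟩` of the metric, at the coordinate point `y`, in the preferred chart
around `x`. -/
def gram (x : M) (y : Plane) : Matrix (Fin 2) (Fin 2) ℝ :=
  Matrix.of fun i j ↦ inner ℝ (coordVector x y i) (coordVector x y j)

/-- The area density `√(det g)` in the preferred chart around `x`. -/
def areaDensity (x : M) (y : Plane) : ℝ :=
  Real.sqrt (gram x y).det

/-- The Laplace-Beltrami operator `Δ_g u = (1/√g) ∑ᵢ ∂ᵢ (√g ∑ⱼ gⁱʲ ∂ⱼ u)`, with `√g = √(det g)`,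
evaluated at `p` in the preferred chart around `p`. -/
def laplacian (u : M → ℝ) (p : M) : ℝ :=
  (areaDensity p (extChartAt (𝓡 2) p p))⁻¹ *
    ∑ i : Fin 2, partialDeriv i
      (fun y ↦ areaDensity p y *
        ∑ j : Fin 2, (gram p y)⁻¹ i j * partialDeriv j (u ∘ (extChartAt (𝓡 2) p).symm) y)
      (extChartAt (𝓡 2) p p)

variable [MeasurableSpace M]

/-- The Riemannian area on the domain of the preferred chart around `x`, as a measure on `M`:
the push-forward of `√(det g) dy` by the inverse chart. -/
def chartArea (x : M) : Measure M :=
  ((volume.restrict (extChartAt (𝓡 2) x).target).withDensity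
    (fun y ↦ ENNReal.ofReal (areaDensity x y))).map (extChartAt (𝓡 2) x).symm

variable (M) in
/-- The Riemannian area `μ` of the surface: the least measure which dominates the areas
`chartArea x` of all the chart domains. As these agree on overlaps, it is the measure whose
restriction to each chart domain is `√(det g) dy` read in the chart. -/
def area : Measure M := ⨆ x : M, chartArea x

end Metric

/-- Compact smooth domains: compact connected sets `E` which, near each point of their boundary,
are of the form `{ρ ≤ 0}` for a smooth function `ρ` whose differential does not vanish there. -/
structure IsCompactSmoothDomain (E : Set M) : Prop where
  isCompact : IsCompact E
  isConnected : IsConnected E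
  smooth_boundary : ∀ x ∈ frontier E, ∃ (U : Set M) (ρ : M → ℝ), IsOpen U ∧ x ∈ U ∧
    ContMDiffOn (𝓡 2) 𝓘(ℝ, ℝ) ∞ ρ U ∧ mfderiv (𝓡 2) 𝓘(ℝ, ℝ) ρ x ≠ 0 ∧
    E ∩ U = {y ∈ U | ρ y ≤ 0}

/-- `u ∈ C^∞(closure Ω)` for an open set `Ω`: the function `u` is smooth in `Ω`, continuous on the
closure, and all its partial derivatives in `Ω`, read in a chart around any point of the closure,
extend continuously to this point. -/
structure SmoothOnClosure (Ω : Set M) (u : M → ℝ) : Prop where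
  contMDiffOn : ContMDiffOn (𝓡 2) 𝓘(ℝ, ℝ) ∞ u Ω
  continuousOn : ContinuousOn u (closure Ω)
  tendsto_deriv : ∀ x ∈ closure Ω, ∀ k : ℕ, ∃ L : Plane [×k]→L[ℝ] ℝ,
    Tendsto (iteratedFDeriv ℝ k (u ∘ (extChartAt (𝓡 2) x).symm))
      (𝓝[(extChartAt (𝓡 2) x).target ∩ (extChartAt (𝓡 2) x).symm ⁻¹' Ω] (extChartAt (𝓡 2) x x))
      (𝓝 L)

end Surface

/-- The `(θ, κ)`-isoperimetric inequality `4πθ μ(E) - κ μ(E)² ≤ s(∂E)²` for compact smooth domains,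
where `μ` is the Riemannian area and `s` the one-dimensional Hausdorff measure of the
Riemannian distance. -/
def IsoperimetricInequality (M : Type*) [EMetricSpace M] [ChartedSpace Plane M]
    [RiemannianBundle (fun x : M ↦ TangentSpace (𝓡 2) x)]
    [MeasurableSpace M] [BorelSpace M] (θ κ : ℝ) : Prop :=
  ∀ E : Set M, IsCompactSmoothDomain E →
    4 * Real.pi * θ * (area M).real E - κ * (area M).real E ^ 2 ≤
      (Measure.hausdorffMeasure 1 : Measure M).real (frontier E) ^ 2

end SphereCovering

end

open MeasureTheory Set Filter Manifold Bundle
open scoped Topology ContDiff ENNReal MeasureTheory NNReal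

noncomputable section

namespace SphereCovering

set_option linter.unusedSectionVars false

attribute [-instance] TopCat.of.chartedSpace


/-! ### Smoothness of coordinate vector fields. -/

section Charts

variable {M : Type*} [TopologicalSpace M] [ChartedSpace Plane M] [IsManifold (𝓡 2) ∞ M]

/-! The proof is the level-set argument of Fiala, Huber and Bol. Write `a = -Δu`, `m(t) = μ{u ≥ t}`,
`A = ∫_Ω e^{2u}`, `β = ∫_Ω f⁺ = 2πΘ`, and let `G(t) = ∫_{u ≥ t} a` be the flux of the gradient
through the level `t`. For almost every `t > 0` the superlevel set `{u ≥ t}` is a finite union of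
compact smooth domains whose boundaries lie in the level line, so the isoperimetric inequality
bounds `4πθ m - κ m²` by the squared length of that line. By coarea and Cauchy-Schwarz this squared
length is at most `G(t)·ρ(t)`, where `ρ` is the density of the law of `u` (formally `-m'`). The
equation gives `G(t) ≤ H(t) = β + ∫_{u ≥ t} (λ e^{2u} - κ)`, hence `4πθ m(t) - κ m(t)² ≤ H(t) ρ(t)`.

Multiply by `e^{2t}` and integrate over `t > 0`. With `I = ∬ e^{2 min(u(x), u(y))}`, the layer cake
formula turns the left side into `4πθ (A - μ(Ω))/2 - κ (I - μ(Ω)²)/2`. The right side is at most `∫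
e^{2u} H(u) dμ`, and symmetrising this double integral gives `βA + (λA² - κI)/2`. The unknown `I`
cancels and the claim remains (`exp_comparison`). Levels of positive area are counted correctly by
averaging `H` over `{u ≥ t}` and `{u > t}`.

Regularity of `m` is never needed. The flux is handled through the weak equation `∫ ψ'(u)|∇u|² = ∫ a
ψ(u)`, which comes from Green's formula (`integral_gradInner`) and determines the law of `u` under
`|∇u|² dμ`. Only an upper coarea inequality is used, with a factor `c > 1` sent to `1` at the end
(`exists_coarea_le`, `ae_length_sq_le`). The law of `u` may have a singular part: `ρ` is its
absolutely continuous density, and dropping the rest is harmless since `H ≥ 0`. Sard's theorem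
(`volume_image_derivAt_eq_zero`) makes almost every level regular, and `isoperimetric_superlevel`
passes from connected domains to superlevel sets. -/

lemma contMDiffOn_coordVector (x : M) (i : Fin 2) :
    ContMDiffOn 𝓘(ℝ, Plane) ((𝓡 2).prod 𝓘(ℝ, Plane)) ∞
      (fun y ↦ (TotalSpace.mk' Plane ((extChartAt (𝓡 2) x).symm y) (coordVector x y i) :
        TangentBundle (𝓡 2) M))
      (extChartAt (𝓡 2) x).target := by
  have h1 := (contMDiffOn_extChartAt_symm (I := 𝓡 2) (n := ∞) x).contMDiffOn_tangentMapWithin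
    (m := ∞) (by simp) (isOpen_extChartAt_target x).uniqueMDiffOn
  have h2 : ContMDiff 𝓘(ℝ, Plane) (𝓘(ℝ, Plane).prod 𝓘(ℝ, Plane)) ∞
      (fun y ↦ (TotalSpace.mk' Plane y (EuclideanSpace.single i (1 : ℝ)) :
        TangentBundle 𝓘(ℝ, Plane) Plane)) := by
    intro y
    rw [contMDiffAt_totalSpace]
    refine ⟨contMDiffAt_id, ?_⟩
    simpa using contMDiffAt_const
  have h3 := h1.comp (h2.contMDiffOn (s := (extChartAt (𝓡 2) x).target))
    (fun y hy ↦ by simpa using hy)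
  refine h3.congr fun y hy ↦ ?_
  simp only [Function.comp, tangentMapWithin, coordVector]
  rw [mfderivWithin_of_isOpen (isOpen_extChartAt_target x) hy]

lemma sum_coord_smul_single (v : Plane) :
    v = ∑ i : Fin 2, v i • EuclideanSpace.single i (1 : ℝ) := by
  ext j; fin_cases j <;> simp

end Charts

/-! ### The metric in coordinates and its behaviour under changes of charts. -/

section MetricAt

variable {M : Type*} [TopologicalSpace M] [ChartedSpace Plane M]

/-- The derivative of the inverse of the preferred chart around `x`, as an endomorphism of the
plane. -/
def symmDeriv (x : M) (y : Plane) : Plane →L[ℝ] Plane :=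
  mfderiv 𝓘(ℝ, Plane) (𝓡 2) (extChartAt (𝓡 2) x).symm y

/-- The change of coordinates from the preferred chart around one point to that around another. -/
def transition (x x' : M) (y : Plane) : Plane :=
  extChartAt (𝓡 2) x' ((extChartAt (𝓡 2) x).symm y)

/-- The domain of the change of coordinates. -/
def overlap (x x' : M) : Set Plane :=
  (extChartAt (𝓡 2) x).target ∩ (extChartAt (𝓡 2) x).symm ⁻¹' (extChartAt (𝓡 2) x').source

lemma isOpen_symm_preimage (x : M) {s : Set M} (hs : IsOpen s) :
    IsOpen ((extChartAt (𝓡 2) x).target ∩ (extChartAt (𝓡 2) x).symm ⁻¹' s) :=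
  (continuousOn_extChartAt_symm x).isOpen_inter_preimage (isOpen_extChartAt_target x) hs

lemma isOpen_overlap (x x' : M) : IsOpen (overlap x x') :=
  isOpen_symm_preimage x (isOpen_extChartAt_source x')

lemma transition_mem_overlap {x x' : M} {y : Plane} (hy : y ∈ overlap x x') :
    transition x x' y ∈ overlap x' x := by
  refine ⟨(extChartAt (𝓡 2) x').map_source hy.2, ?_⟩
  simp only [transition, mem_preimage, (extChartAt (𝓡 2) x').left_inv hy.2]
  exact (extChartAt (𝓡 2) x).map_target hy.1

lemma symm_transition {x x' : M} {y : Plane} (hy : y ∈ overlap x x') :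
    (extChartAt (𝓡 2) x').symm (transition x x' y) = (extChartAt (𝓡 2) x).symm y :=
  (extChartAt (𝓡 2) x').left_inv hy.2

lemma transition_transition {x x' : M} {y : Plane} (hy : y ∈ overlap x x') :
    transition x' x (transition x x' y) = y := by
  rw [transition, symm_transition hy, (extChartAt (𝓡 2) x).right_inv hy.1]

lemma mem_overlap_of_mem_source {x x' p : M} (hp : p ∈ (extChartAt (𝓡 2) x).source)
    (hp' : p ∈ (extChartAt (𝓡 2) x').source) : extChartAt (𝓡 2) x p ∈ overlap x x' :=
  ⟨(extChartAt (𝓡 2) x).map_source hp, by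
    rw [mem_preimage, (extChartAt (𝓡 2) x).left_inv hp]; exact hp'⟩

section Smooth

variable [IsManifold (𝓡 2) ∞ M]

lemma mdifferentiableAt_symm (x : M) {y : Plane} (hy : y ∈ (extChartAt (𝓡 2) x).target) :
    MDifferentiableAt 𝓘(ℝ, Plane) (𝓡 2) (extChartAt (𝓡 2) x).symm y :=
  ((contMDiffOn_extChartAt_symm (I := 𝓡 2) (n := ∞) x).contMDiffAt
    ((isOpen_extChartAt_target x).mem_nhds hy)).mdifferentiableAt (by simp)

lemma contDiffOn_transition (x x' : M) :
    ContDiffOn ℝ ∞ (transition x x') (overlap x x') := by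
  rw [← contMDiffOn_iff_contDiffOn]
  exact (contMDiffOn_extChartAt (I := 𝓡 2) (x := x')).comp
    ((contMDiffOn_extChartAt_symm (I := 𝓡 2) (n := ∞) x).mono inter_subset_left)
    (fun y hy ↦ by simpa using hy.2)

lemma differentiableAt_transition {x x' : M} {y : Plane} (hy : y ∈ overlap x x') :
    DifferentiableAt ℝ (transition x x') y :=
  ((contDiffOn_transition x x').contDiffAt ((isOpen_overlap x x').mem_nhds hy)).differentiableAt
    (by simp)

lemma symmDeriv_eq_comp {x x' : M} {y : Plane} (hy : y ∈ overlap x x') :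
    symmDeriv x y = (symmDeriv x' (transition x x' y)).comp (fderiv ℝ (transition x x') y) := by
  have h1 : (extChartAt (𝓡 2) x).symm =ᶠ[𝓝 y] (extChartAt (𝓡 2) x').symm ∘ transition x x' := by
    filter_upwards [(isOpen_overlap x x').mem_nhds hy] with z hz
    exact (symm_transition hz).symm
  have h2 := (mdifferentiableAt_symm x' (transition_mem_overlap hy).1).hasMFDerivAt.comp y
    (differentiableAt_transition hy).mdifferentiableAt.hasMFDerivAt
  have h3 := (h2.congr_of_eventuallyEq h1).mfderiv
  rw [mfderiv_eq_fderiv] at h3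
  exact h3

lemma fderiv_transition_comp {x x' : M} {y : Plane} (hy : y ∈ overlap x x') :
    (fderiv ℝ (transition x' x) (transition x x' y)).comp (fderiv ℝ (transition x x') y) =
      ContinuousLinearMap.id ℝ Plane := by
  have h1 : transition x' x ∘ transition x x' =ᶠ[𝓝 y] id := by
    filter_upwards [(isOpen_overlap x x').mem_nhds hy] with z hz
    exact transition_transition hz
  rw [← fderiv_comp y (differentiableAt_transition (transition_mem_overlap hy))
    (differentiableAt_transition hy), h1.fderiv_eq, fderiv_id]

lemma symmDeriv_injective (x : M) {y : Plane} (hy : y ∈ (extChartAt (𝓡 2) x).target) :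
    Function.Injective (symmDeriv x y) := by
  have h := (isInvertible_mfderivWithin_extChartAt_symm (I := 𝓡 2) hy).injective
  rwa [ModelWithCorners.range_eq_univ, mfderivWithin_univ] at h

/-- The Jacobian matrix of the change of coordinates. -/
def jacobian (x x' : M) (y : Plane) : Matrix (Fin 2) (Fin 2) ℝ :=
  Matrix.of fun i j ↦ fderiv ℝ (transition x x') y (EuclideanSpace.single j 1) i

lemma det_eq_of_matrix (A : Plane →L[ℝ] Plane) :
    A.det = (Matrix.of fun i j ↦ A (EuclideanSpace.single j 1) i).det := by
  rw [ContinuousLinearMap.det,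
    ← LinearMap.det_toMatrix (EuclideanSpace.basisFun (Fin 2) ℝ).toBasis]
  congr 1

lemma isUnit_det_jacobian {x x' : M} {y : Plane} (hy : y ∈ overlap x x') :
    IsUnit (jacobian x x' y).det := by
  have h := congrArg ContinuousLinearMap.det (fderiv_transition_comp hy)
  have h2 : (fderiv ℝ (transition x' x) (transition x x' y)).det *
      (fderiv ℝ (transition x x') y).det = 1 := by
    simpa [ContinuousLinearMap.det] using h
  rw [jacobian, ← det_eq_of_matrix]
  exact IsUnit.of_mul_eq_one_right _ h2

end Smooth

variable [RiemannianBundle (fun x : M ↦ TangentSpace (𝓡 2) x)]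

/-- The Riemannian metric at `p`, on the model plane. -/
def metricAt (p : M) (v w : Plane) : ℝ :=
  @inner ℝ (TangentSpace (𝓡 2) p) _ v w

/-- The Riemannian metric at the point of coordinates `y` in the preferred chart around `x`. -/
def chartMetric (x : M) (y v w : Plane) : ℝ :=
  metricAt ((extChartAt (𝓡 2) x).symm y) (symmDeriv x y v) (symmDeriv x y w)

lemma metricAt_comm (p : M) (v w : Plane) : metricAt p v w = metricAt p w v :=
  real_inner_comm _ _

lemma metricAt_add_left (p : M) (v v' w : Plane) :
    metricAt p (v + v') w = metricAt p v w + metricAt p v' w :=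
  inner_add_left (𝕜 := ℝ) (E := TangentSpace (𝓡 2) p) v v' w

lemma metricAt_smul_left (p : M) (c : ℝ) (v w : Plane) :
    metricAt p (c • v) w = c * metricAt p v w :=
  real_inner_smul_left (F := TangentSpace (𝓡 2) p) v w c

lemma metricAt_self_pos (p : M) {v : Plane} (hv : v ≠ 0) : 0 < metricAt p v v :=
  real_inner_self_pos (F := TangentSpace (𝓡 2) p).2 hv

lemma chartMetric_comm (x : M) (y v w : Plane) : chartMetric x y v w = chartMetric x y w v :=
  metricAt_comm _ _ _

lemma chartMetric_add_left (x : M) (y v v' w : Plane) :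
    chartMetric x y (v + v') w = chartMetric x y v w + chartMetric x y v' w := by
  rw [chartMetric, map_add, metricAt_add_left]; rfl

lemma chartMetric_smul_left (x : M) (y : Plane) (c : ℝ) (v w : Plane) :
    chartMetric x y (c • v) w = c * chartMetric x y v w := by
  rw [chartMetric, map_smul, metricAt_smul_left]; rfl

lemma chartMetric_add_right (x : M) (y v w w' : Plane) :
    chartMetric x y v (w + w') = chartMetric x y v w + chartMetric x y v w' := by
  simp only [chartMetric_comm x y v, chartMetric_add_left]

lemma chartMetric_smul_right (x : M) (y : Plane) (c : ℝ) (v w : Plane) :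
    chartMetric x y v (c • w) = c * chartMetric x y v w := by
  simp only [chartMetric_comm x y v, chartMetric_smul_left]

lemma gram_apply (x : M) (y : Plane) (i j : Fin 2) :
    gram x y i j = chartMetric x y (EuclideanSpace.single i 1) (EuclideanSpace.single j 1) := rfl

lemma gram_comm (x : M) (y : Plane) (i j : Fin 2) : gram x y i j = gram x y j i :=
  chartMetric_comm _ _ _ _

lemma chartMetric_eq_sum (x : M) (y v w : Plane) :
    chartMetric x y v w = ∑ i : Fin 2, ∑ j : Fin 2, v i * w j * gram x y i j := by
  conv_lhs => rw [sum_coord_smul_single v, sum_coord_smul_single w]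
  simp only [Fin.sum_univ_two, chartMetric_add_left, chartMetric_smul_left, chartMetric_add_right,
    chartMetric_smul_right, gram_apply]
  ring

variable [IsManifold (𝓡 2) ∞ M]

lemma chartMetric_self_pos (x : M) {y v : Plane} (hy : y ∈ (extChartAt (𝓡 2) x).target)
    (hv : v ≠ 0) : 0 < chartMetric x y v v := by
  refine metricAt_self_pos _ fun h ↦ hv ?_
  exact symmDeriv_injective x hy (h.trans (map_zero _).symm)

lemma chartMetric_transition {x x' : M} {y : Plane} (hy : y ∈ overlap x x') (v w : Plane) :
    chartMetric x y v w = chartMetric x' (transition x x' y) (fderiv ℝ (transition x x') y v)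
      (fderiv ℝ (transition x x') y w) := by
  rw [chartMetric, symmDeriv_eq_comp hy, chartMetric, symm_transition hy]
  rfl

lemma gram_transition {x x' : M} {y : Plane} (hy : y ∈ overlap x x') :
    gram x y = (jacobian x x' y).transpose * gram x' (transition x x' y) * jacobian x x' y := by
  ext i j
  rw [gram_apply, chartMetric_transition hy, chartMetric_eq_sum]
  simp only [Matrix.mul_apply, Matrix.transpose_apply, jacobian, Matrix.of_apply,
    Fin.sum_univ_two]
  ring

lemma gram_det_pos (x : M) {y : Plane} (hy : y ∈ (extChartAt (𝓡 2) x).target) :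
    0 < (gram x y).det := by
  rw [Matrix.det_fin_two, gram_comm x y 1 0]
  -- For `v = (g₀₁, -g₀₀)` one has `⟨v, v⟩ = g₀₀ · det g`, so positivity of the metric forces `det g
  -- > 0`.
  set v : Plane := EuclideanSpace.single 0 (gram x y 0 1) + EuclideanSpace.single 1 (- gram x y 0 0)
    with hv
  have h00 : 0 < gram x y 0 0 :=
    chartMetric_self_pos x hy (by simp)
  have hv0 : v ≠ 0 := by
    intro h
    have := congrArg (fun w : Plane ↦ w 1) h
    simp [hv, h00.ne'] at this
  have h := chartMetric_self_pos x hy hv0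
  rw [chartMetric_eq_sum] at h
  simp [Fin.sum_univ_two, hv, gram_comm x y 1 0] at h
  nlinarith

lemma areaDensity_pos (x : M) {y : Plane} (hy : y ∈ (extChartAt (𝓡 2) x).target) :
    0 < areaDensity x y := Real.sqrt_pos.2 (gram_det_pos x hy)

lemma areaDensity_transition {x x' : M} {y : Plane} (hy : y ∈ overlap x x') :
    areaDensity x y = |(fderiv ℝ (transition x x') y).det| * areaDensity x' (transition x x' y) := by
  rw [areaDensity, gram_transition hy, det_eq_of_matrix, Matrix.det_mul, Matrix.det_mul,
    Matrix.det_transpose]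
  change √((jacobian x x' y).det * _ * (jacobian x x' y).det) = |(jacobian x x' y).det| * _
  rw [areaDensity, show (jacobian x x' y).det * (gram x' (transition x x' y)).det *
    (jacobian x x' y).det = (jacobian x x' y).det ^ 2 * (gram x' (transition x x' y)).det by ring,
    Real.sqrt_mul (sq_nonneg _), Real.sqrt_sq_eq_abs]

variable [IsContMDiffRiemannianBundle (𝓡 2) ∞ Plane (fun x : M ↦ TangentSpace (𝓡 2) x)]

lemma contDiffOn_gram (x : M) (i j : Fin 2) :
    ContDiffOn ℝ ∞ (fun y ↦ gram x y i j) (extChartAt (𝓡 2) x).target := by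
  rw [← contMDiffOn_iff_contDiffOn]
  exact (contMDiffOn_coordVector x i).inner_bundle (contMDiffOn_coordVector x j)

lemma contDiffOn_gram_det (x : M) :
    ContDiffOn ℝ ∞ (fun y ↦ (gram x y).det) (extChartAt (𝓡 2) x).target := by
  simp only [Matrix.det_fin_two]
  exact ((contDiffOn_gram x 0 0).mul (contDiffOn_gram x 1 1)).sub
    ((contDiffOn_gram x 0 1).mul (contDiffOn_gram x 1 0))

lemma contDiffOn_areaDensity (x : M) :
    ContDiffOn ℝ ∞ (areaDensity x) (extChartAt (𝓡 2) x).target :=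
  (contDiffOn_gram_det x).sqrt fun _ hy ↦ (gram_det_pos x hy).ne'

lemma contDiffOn_gram_inv (x : M) (i j : Fin 2) :
    ContDiffOn ℝ ∞ (fun y ↦ (gram x y)⁻¹ i j) (extChartAt (𝓡 2) x).target := by
  have h : ∀ A : Matrix (Fin 2) (Fin 2) ℝ, A⁻¹ i j = (A.det)⁻¹ * A.adjugate i j := by
    intro A; simp [Matrix.inv_def]
  simp only [h, Matrix.adjugate_fin_two]
  refine ((contDiffOn_gram_det x).inv fun y hy ↦ (gram_det_pos x hy).ne').mul ?_
  fin_cases i <;> fin_cases j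
  · exact contDiffOn_gram x 1 1
  · exact (contDiffOn_gram x 0 1).neg
  · exact (contDiffOn_gram x 1 0).neg
  · exact contDiffOn_gram x 0 0

lemma continuousOn_chartMetric (x : M) :
    ContinuousOn (fun q : Plane × Plane ↦ chartMetric x q.1 q.2 q.2)
      ((extChartAt (𝓡 2) x).target ×ˢ univ) := by
  simp only [chartMetric_eq_sum]
  refine continuousOn_finsetSum _ fun i _ ↦ continuousOn_finsetSum _ fun j _ ↦ ?_
  refine ContinuousOn.mul (by fun_prop) ?_
  exact (contDiffOn_gram x i j).continuousOn.comp continuousOn_fst fun q hq ↦ hq.1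

end MetricAt

/-! ### The Riemannian area as a measure. -/

section Area

/-- A supremum of measures is not computed set by set. Instead, each `m i`, hence the supremum, is
at most `ν` plus the supremum restricted to `Sᶜ`; restricting this to `S` kills the second term. -/
lemma restrict_iSup_le {ι α : Type*} [MeasurableSpace α] {m : ι → Measure α} {ν : Measure α}
    {S : Set α} (hS : MeasurableSet S) (h : ∀ i, (m i).restrict S ≤ ν) :
    (⨆ i, m i).restrict S ≤ ν := by
  have h1 : (⨆ i, m i) ≤ ν + (⨆ i, m i).restrict Sᶜ := by
    refine iSup_le fun i ↦ ?_
    rw [← Measure.restrict_add_restrict_compl (μ := m i) hS]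
    exact add_le_add (h i) (Measure.restrict_mono le_rfl (le_iSup m i))
  refine (Measure.restrict_mono (le_refl S) h1).trans ?_
  rw [Measure.restrict_add, Measure.restrict_restrict hS, inter_compl_self, Measure.restrict_empty,
    add_zero]
  exact Measure.restrict_le_self

variable {M : Type*} [TopologicalSpace M] [ChartedSpace Plane M] [IsManifold (𝓡 2) ∞ M]
  [RiemannianBundle (fun x : M ↦ TangentSpace (𝓡 2) x)]
  [MeasurableSpace M] [BorelSpace M]

/-- The measure `√(det g) dy` on the target of the preferred chart around `x`. -/
def coordArea (x : M) : Measure Plane :=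
  (volume.restrict (extChartAt (𝓡 2) x).target).withDensity
    (fun y ↦ ENNReal.ofReal (areaDensity x y))

lemma measurableSet_target (x : M) : MeasurableSet (extChartAt (𝓡 2) x).target :=
  (isOpen_extChartAt_target x).measurableSet

lemma measurableSet_source (x : M) : MeasurableSet (extChartAt (𝓡 2) x).source :=
  (isOpen_extChartAt_source x).measurableSet

lemma measurableSet_symm_preimage (x : M) {s : Set M} (hs : MeasurableSet s) :
    MeasurableSet ((extChartAt (𝓡 2) x).target ∩ (extChartAt (𝓡 2) x).symm ⁻¹' s) := by
  have h := (continuousOn_extChartAt_symm (I := 𝓡 2) x).domRestrict.measurable hs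
  have := (measurableSet_target x).subtype_image h
  convert this using 1
  ext y
  constructor
  · exact fun hy ↦ ⟨⟨y, hy.1⟩, hy.2, rfl⟩
  · rintro ⟨z, hz, rfl⟩
    exact ⟨z.2, hz⟩

lemma aemeasurable_symm (x : M) : AEMeasurable (extChartAt (𝓡 2) x).symm (coordArea x) := by
  refine AEMeasurable.mono_ac ?_ (withDensity_absolutelyContinuous _ _)
  refine aemeasurable_restrict_of_measurable_subtype (measurableSet_target x) ?_
  exact (continuousOn_extChartAt_symm (I := 𝓡 2) x).domRestrict.measurable

lemma chartArea_eq_map (x : M) : chartArea x = (coordArea x).map (extChartAt (𝓡 2) x).symm := rfl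

lemma coordArea_compl_target (x : M) : coordArea x (extChartAt (𝓡 2) x).targetᶜ = 0 := by
  refine withDensity_absolutelyContinuous _ _ ?_
  rw [Measure.restrict_apply (measurableSet_target x).compl, compl_inter_self, measure_empty]

lemma chartArea_apply (x : M) {s : Set M} (hs : MeasurableSet s) :
    chartArea x s = ∫⁻ y in (extChartAt (𝓡 2) x).target ∩ (extChartAt (𝓡 2) x).symm ⁻¹' s,
      ENNReal.ofReal (areaDensity x y) := by
  have hm := measurableSet_symm_preimage x hs
  rw [chartArea_eq_map, Measure.map_apply_of_aemeasurable (aemeasurable_symm x) hs]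
  calc coordArea x ((extChartAt (𝓡 2) x).symm ⁻¹' s)
      = coordArea x ((extChartAt (𝓡 2) x).target ∩ (extChartAt (𝓡 2) x).symm ⁻¹' s) := by
        rw [inter_comm]
        exact (measure_inter_conull (coordArea_compl_target x)).symm
    _ = _ := by
        rw [coordArea, withDensity_apply _ hm, Measure.restrict_restrict hm, inter_right_comm,
          inter_self]

lemma transition_image_overlap (x x' : M) {s : Set M}
    (hs' : s ⊆ (extChartAt (𝓡 2) x').source) (hs : s ⊆ (extChartAt (𝓡 2) x).source) :
    (transition x x') '' ((extChartAt (𝓡 2) x).target ∩ (extChartAt (𝓡 2) x).symm ⁻¹' s) =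
      (extChartAt (𝓡 2) x').target ∩ (extChartAt (𝓡 2) x').symm ⁻¹' s := by
  ext z
  constructor
  · rintro ⟨y, hy, rfl⟩
    have hy' : y ∈ overlap x x' := ⟨hy.1, hs' hy.2⟩
    exact ⟨(transition_mem_overlap hy').1, by rw [mem_preimage, symm_transition hy']; exact hy.2⟩
  · rintro ⟨hz, hz'⟩
    have h : z ∈ overlap x' x := ⟨hz, hs hz'⟩
    refine ⟨transition x' x z, ⟨(transition_mem_overlap h).1, ?_⟩, transition_transition h⟩
    rw [mem_preimage, symm_transition h]; exact hz'

/-- Change of variables: the density transforms by the absolute Jacobian determinant of the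
transition map. -/
lemma chartArea_eq_of_subset (x x' : M) {s : Set M} (hm : MeasurableSet s)
    (hs : s ⊆ (extChartAt (𝓡 2) x).source) (hs' : s ⊆ (extChartAt (𝓡 2) x').source) :
    chartArea x s = chartArea x' s := by
  rw [chartArea_apply x hm, chartArea_apply x' hm, ← transition_image_overlap x x' hs' hs]
  have hsub : ∀ y ∈ (extChartAt (𝓡 2) x).target ∩ (extChartAt (𝓡 2) x).symm ⁻¹' s,
      y ∈ overlap x x' := fun y hy ↦ ⟨hy.1, hs' hy.2⟩
  rw [lintegral_image_eq_lintegral_abs_det_fderiv_mul volume (measurableSet_symm_preimage x hm)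
    (fun y hy ↦ (differentiableAt_transition (hsub y hy)).hasFDerivAt.hasFDerivWithinAt)
    (fun y hy z hz h ↦ by
      rw [← transition_transition (hsub y hy), h, transition_transition (hsub z hz)])]
  refine setLIntegral_congr_fun (measurableSet_symm_preimage x hm) fun y hy ↦ ?_
  rw [areaDensity_transition (hsub y hy), ENNReal.ofReal_mul (abs_nonneg _)]

lemma chartArea_restrict_source (x : M) :
    (chartArea x).restrict (extChartAt (𝓡 2) x).source = chartArea x := by
  refine Measure.restrict_eq_self_of_ae_mem ?_
  change chartArea x (extChartAt (𝓡 2) x).sourceᶜ = 0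
  rw [chartArea_apply x (measurableSet_source x).compl]
  have : (extChartAt (𝓡 2) x).target ∩ (extChartAt (𝓡 2) x).symm ⁻¹'
      (extChartAt (𝓡 2) x).sourceᶜ = ∅ := by
    refine eq_empty_of_forall_notMem fun y hy ↦ hy.2 ((extChartAt (𝓡 2) x).map_target hy.1)
  rw [this, setLIntegral_empty]

/-- Chart areas agree on overlaps, so inside this chart domain no other `chartArea x'` exceeds
`chartArea x`. Every computation with `area` in a chart goes through this. -/
lemma area_restrict_source (x : M) :
    (area M).restrict (extChartAt (𝓡 2) x).source = chartArea x := by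
  refine le_antisymm ?_ ?_
  · refine restrict_iSup_le (measurableSet_source x) fun x' ↦ ?_
    refine Measure.le_iff.2 fun s hs ↦ ?_
    rw [Measure.restrict_apply hs, ← chartArea_restrict_source x',
      Measure.restrict_apply (hs.inter (measurableSet_source x)),
      chartArea_eq_of_subset x' x
        ((hs.inter (measurableSet_source x)).inter (measurableSet_source x'))
        inter_subset_right (inter_subset_left.trans inter_subset_right)]
    exact measure_mono (inter_subset_left.trans inter_subset_left)
  · rw [← chartArea_restrict_source x]
    exact Measure.restrict_mono le_rfl (le_iSup chartArea x)

lemma area_apply_of_subset_source (x : M) {s : Set M} (hm : MeasurableSet s)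
    (hs : s ⊆ (extChartAt (𝓡 2) x).source) :
    area M s = ∫⁻ y in (extChartAt (𝓡 2) x).target ∩ (extChartAt (𝓡 2) x).symm ⁻¹' s,
      ENNReal.ofReal (areaDensity x y) := by
  rw [← chartArea_apply x hm, ← area_restrict_source x, Measure.restrict_apply hm,
    inter_eq_left.2 hs]

variable [IsContMDiffRiemannianBundle (𝓡 2) ∞ Plane (fun x : M ↦ TangentSpace (𝓡 2) x)]

instance isLocallyFiniteMeasure_area : IsLocallyFiniteMeasure (area M) := by
  refine ⟨fun p ↦ ?_⟩
  set y := extChartAt (𝓡 2) p p with hy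
  have hyt : y ∈ (extChartAt (𝓡 2) p).target := mem_extChartAt_target p
  obtain ⟨r, hr, hrt⟩ := Metric.nhds_basis_closedBall.mem_iff.1
    ((isOpen_extChartAt_target p).mem_nhds hyt)
  refine ⟨(extChartAt (𝓡 2) p).source ∩ extChartAt (𝓡 2) p ⁻¹' Metric.ball y r, ?_, ?_⟩
  · refine inter_mem (extChartAt_source_mem_nhds p) ?_
    exact (continuousAt_extChartAt p).preimage_mem_nhds (Metric.ball_mem_nhds y hr)
  · have hopen : IsOpen ((extChartAt (𝓡 2) p).source ∩ extChartAt (𝓡 2) p ⁻¹' Metric.ball y r) :=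
      (continuousOn_extChartAt p).isOpen_inter_preimage (isOpen_extChartAt_source p)
        Metric.isOpen_ball
    rw [area_apply_of_subset_source p hopen.measurableSet inter_subset_left]
    have hc : IsCompact (Metric.closedBall y r) := isCompact_closedBall y r
    have h_intble : IntegrableOn (areaDensity p) (Metric.closedBall y r) :=
      ((contDiffOn_areaDensity p).continuousOn.mono hrt).integrableOn_compact hc
    refine lt_of_le_of_lt (lintegral_mono_set ?_) h_intble.lintegral_lt_top
    rintro z ⟨hz, hz'⟩
    have := hz'.2
    rw [mem_preimage, (extChartAt (𝓡 2) p).right_inv hz] at this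
    exact Metric.ball_subset_closedBall this

lemma aemeasurable_areaDensity (x : M) :
    AEMeasurable (areaDensity x) (volume.restrict (extChartAt (𝓡 2) x).target) :=
  (contDiffOn_areaDensity x).continuousOn.aemeasurable (measurableSet_target x)

lemma lintegral_source (x : M) {F : M → ℝ≥0∞} (hF : Measurable F) :
    ∫⁻ p in (extChartAt (𝓡 2) x).source, F p ∂(area M) =
      ∫⁻ y in (extChartAt (𝓡 2) x).target,
        ENNReal.ofReal (areaDensity x y) * F ((extChartAt (𝓡 2) x).symm y) := by
  rw [area_restrict_source, chartArea_eq_map, lintegral_map' hF.aemeasurable (aemeasurable_symm x),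
    coordArea, lintegral_withDensity_eq_lintegral_mul₀' (aemeasurable_areaDensity x).ennreal_ofReal]
  · rfl
  · exact (hF.comp_aemeasurable (aemeasurable_symm x))

lemma integral_source (x : M) {F : M → ℝ}
    (hF : AEStronglyMeasurable F ((area M).restrict (extChartAt (𝓡 2) x).source)) :
    ∫ p in (extChartAt (𝓡 2) x).source, F p ∂(area M) =
      ∫ y in (extChartAt (𝓡 2) x).target,
        areaDensity x y * F ((extChartAt (𝓡 2) x).symm y) := by
  rw [area_restrict_source, chartArea_eq_map] at *
  rw [integral_map (aemeasurable_symm x) hF, coordArea]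
  rw [integral_withDensity_eq_integral_toReal_smul₀ (aemeasurable_areaDensity x).ennreal_ofReal
    (by simp)]
  refine setIntegral_congr_fun (measurableSet_target x) fun y hy ↦ ?_
  simp [ENNReal.toReal_ofReal (areaDensity_pos x hy).le]

lemma area_pos_of_isOpen {U : Set M} (hU : IsOpen U) (hne : U.Nonempty) : 0 < area M U := by
  obtain ⟨p, hp⟩ := hne
  have hV : IsOpen ((extChartAt (𝓡 2) p).target ∩ (extChartAt (𝓡 2) p).symm ⁻¹' U) :=
    isOpen_symm_preimage p hU
  refine lt_of_lt_of_le ?_ (Measure.le_iff'.1 (le_iSup chartArea p) U)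
  rw [chartArea_apply p hU.measurableSet, pos_iff_ne_zero]
  intro h0
  rw [lintegral_eq_zero_iff' ((aemeasurable_areaDensity p).ennreal_ofReal.mono_set
    inter_subset_left)] at h0
  have h1 : ∀ᵐ y ∂volume.restrict
      ((extChartAt (𝓡 2) p).target ∩ (extChartAt (𝓡 2) p).symm ⁻¹' U), False := by
    filter_upwards [h0, ae_restrict_mem hV.measurableSet] with y hy hyV
    exact (ENNReal.ofReal_pos.2 (areaDensity_pos p hyV.1)).ne' hy
  rw [eventually_false_iff_eq_bot, ae_eq_bot, Measure.restrict_eq_zero] at h1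
  refine (hV.measure_pos volume ⟨extChartAt (𝓡 2) p p, mem_extChartAt_target p, ?_⟩).ne' h1
  rw [mem_preimage, extChartAt_to_inv]; exact hp

end Area

/-! ### Functions on the surface read in charts. -/

section Pullback

variable {M : Type*} [TopologicalSpace M] [ChartedSpace Plane M] [IsManifold (𝓡 2) ∞ M]

lemma contDiffAt_comp_symm {x : M} {y : Plane} (hy : y ∈ (extChartAt (𝓡 2) x).target)
    {u : M → ℝ} {n : ℕ∞ω} (hn : n ≤ (∞ : ℕ∞ω))
    (hu : ContMDiffAt (𝓡 2) 𝓘(ℝ, ℝ) n u ((extChartAt (𝓡 2) x).symm y)) :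
    ContDiffAt ℝ n (u ∘ (extChartAt (𝓡 2) x).symm) y := by
  rw [← contMDiffAt_iff_contDiffAt]
  exact hu.comp y (((contMDiffOn_extChartAt_symm (I := 𝓡 2) (n := ∞) x).contMDiffAt
    ((isOpen_extChartAt_target x).mem_nhds hy)).of_le hn)

lemma contDiffOn_comp_symm (x : M) {u : M → ℝ} {Ω : Set M} (hΩ : IsOpen Ω) {n : ℕ∞ω} (hn : n ≤ (∞ : ℕ∞ω))
    (hu : ContMDiffOn (𝓡 2) 𝓘(ℝ, ℝ) n u Ω) :
    ContDiffOn ℝ n (u ∘ (extChartAt (𝓡 2) x).symm)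
      ((extChartAt (𝓡 2) x).target ∩ (extChartAt (𝓡 2) x).symm ⁻¹' Ω) := fun _ hy ↦
  (contDiffAt_comp_symm hy.1 hn (hu.contMDiffAt (hΩ.mem_nhds hy.2))).contDiffWithinAt

lemma contDiffOn_partialDeriv {w : Plane → ℝ} {V : Set Plane} (hV : IsOpen V) {m n : ℕ∞ω}
    (hmn : m + 1 ≤ n) (hw : ContDiffOn ℝ n w V) (i : Fin 2) :
    ContDiffOn ℝ m (partialDeriv i w) V :=
  (hw.fderiv_of_isOpen hV hmn).clm_apply contDiffOn_const

lemma differentiableAt_comp_symm {x : M} {y : Plane} (hy : y ∈ (extChartAt (𝓡 2) x).target)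
    {u : M → ℝ} (hu : ContMDiffAt (𝓡 2) 𝓘(ℝ, ℝ) 1 u ((extChartAt (𝓡 2) x).symm y)) :
    DifferentiableAt ℝ (u ∘ (extChartAt (𝓡 2) x).symm) y :=
  (contDiffAt_comp_symm hy (by norm_cast) hu).differentiableAt (by simp)

lemma fderiv_comp_symm_transition {x x' : M} {y : Plane} (hy : y ∈ overlap x x') {u : M → ℝ}
    (hu : ContMDiffAt (𝓡 2) 𝓘(ℝ, ℝ) 1 u ((extChartAt (𝓡 2) x).symm y)) :
    fderiv ℝ (u ∘ (extChartAt (𝓡 2) x).symm) y =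
      (fderiv ℝ (u ∘ (extChartAt (𝓡 2) x').symm) (transition x x' y)).comp
        (fderiv ℝ (transition x x') y) := by
  have h1 : u ∘ (extChartAt (𝓡 2) x).symm =ᶠ[𝓝 y]
      (u ∘ (extChartAt (𝓡 2) x').symm) ∘ transition x x' := by
    filter_upwards [(isOpen_overlap x x').mem_nhds hy] with z hz
    simp only [Function.comp, symm_transition hz]
  rw [h1.fderiv_eq, fderiv_comp _ _ (differentiableAt_transition hy)]
  refine differentiableAt_comp_symm (transition_mem_overlap hy).1 ?_
  rwa [symm_transition hy]

lemma partialDeriv_transition {x x' : M} {y : Plane} (hy : y ∈ overlap x x') {u : M → ℝ}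
    (hu : ContMDiffAt (𝓡 2) 𝓘(ℝ, ℝ) 1 u ((extChartAt (𝓡 2) x).symm y)) :
    (fun i ↦ partialDeriv i (u ∘ (extChartAt (𝓡 2) x).symm) y) =
      (jacobian x x' y).transpose.mulVec fun j ↦
        partialDeriv j (u ∘ (extChartAt (𝓡 2) x').symm) (transition x x' y) := by
  ext i
  rw [partialDeriv, fderiv_comp_symm_transition hy hu, ContinuousLinearMap.comp_apply,
    sum_coord_smul_single (fderiv ℝ (transition x x') y (EuclideanSpace.single i 1)), map_sum]
  simp only [map_smul, Matrix.mulVec, dotProduct, Matrix.transpose_apply, jacobian,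
    Matrix.of_apply, smul_eq_mul, partialDeriv]

/-- The direction of the level line of `w` through `y`: the gradient of `w`, rotated. -/
def levelDir (w : Plane → ℝ) (y : Plane) : Plane :=
  !₂[- partialDeriv 1 w y, partialDeriv 0 w y]

end Pullback

/-! ### Gradient pairing, flux and Laplacian in charts. -/

section Gradient

variable {M : Type*} [TopologicalSpace M] [ChartedSpace Plane M]
  [RiemannianBundle (fun x : M ↦ TangentSpace (𝓡 2) x)]

/-- The pairing `⟨∇u, ∇φ⟩ = ∑ gⁱʲ ∂ᵢu ∂ⱼφ`, read in the preferred chart around `x`. -/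
def chartGradInner (x : M) (u φ : M → ℝ) (y : Plane) : ℝ :=
  ∑ i : Fin 2, ∑ j : Fin 2, (gram x y)⁻¹ i j *
    partialDeriv i (φ ∘ (extChartAt (𝓡 2) x).symm) y *
    partialDeriv j (u ∘ (extChartAt (𝓡 2) x).symm) y

/-- The pairing `⟨∇u, ∇φ⟩` of the gradients of two functions on a Riemannian surface. -/
def gradInner (u φ : M → ℝ) (p : M) : ℝ :=
  chartGradInner p u φ (extChartAt (𝓡 2) p p)

/-- The `i`-th component `√g ∑ⱼ gⁱʲ ∂ⱼu` of the weighted gradient, in the preferred chart around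
`x`. -/
def chartFlux (x : M) (u : M → ℝ) (i : Fin 2) (y : Plane) : ℝ :=
  areaDensity x y * ∑ j : Fin 2, (gram x y)⁻¹ i j *
    partialDeriv j (u ∘ (extChartAt (𝓡 2) x).symm) y

/-- The Laplace-Beltrami operator read in the preferred chart around `x`. -/
def chartLaplacian (x : M) (u : M → ℝ) (y : Plane) : ℝ :=
  (areaDensity x y)⁻¹ * ∑ i : Fin 2, partialDeriv i (chartFlux x u i) y

lemma chartGradInner_eq_dotProduct (x : M) (u φ : M → ℝ) (y : Plane) :
    chartGradInner x u φ y =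
      (fun i ↦ partialDeriv i (φ ∘ (extChartAt (𝓡 2) x).symm) y) ⬝ᵥ
        ((gram x y)⁻¹.mulVec fun j ↦ partialDeriv j (u ∘ (extChartAt (𝓡 2) x).symm) y) := by
  simp only [chartGradInner, dotProduct, Matrix.mulVec, Fin.sum_univ_two]
  ring

lemma areaDensity_mul_chartGradInner (x : M) (u φ : M → ℝ) (y : Plane) :
    areaDensity x y * chartGradInner x u φ y =
      ∑ i : Fin 2, chartFlux x u i y * partialDeriv i (φ ∘ (extChartAt (𝓡 2) x).symm) y := by
  simp only [chartGradInner, chartFlux, Fin.sum_univ_two]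
  ring

variable [IsManifold (𝓡 2) ∞ M]

/-- Differentials transform by `Jᵀ` and the inverse Gram matrix by `J⁻¹` and `J⁻ᵀ`, so the Jacobians
cancel. -/
lemma chartGradInner_transition {x x' : M} {y : Plane} (hy : y ∈ overlap x x') {u φ : M → ℝ}
    (hu : ContMDiffAt (𝓡 2) 𝓘(ℝ, ℝ) 1 u ((extChartAt (𝓡 2) x).symm y))
    (hφ : ContMDiffAt (𝓡 2) 𝓘(ℝ, ℝ) 1 φ ((extChartAt (𝓡 2) x).symm y)) :
    chartGradInner x u φ y = chartGradInner x' u φ (transition x x' y) := by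
  rw [chartGradInner_eq_dotProduct, chartGradInner_eq_dotProduct, partialDeriv_transition hy hu,
    partialDeriv_transition hy hφ, gram_transition hy]
  have hJ := isUnit_det_jacobian hy
  set J := jacobian x x' y
  rw [Matrix.mul_inv_rev, Matrix.mul_inv_rev, Matrix.mulVec_mulVec, Matrix.mul_assoc,
    Matrix.mul_assoc, Matrix.nonsing_inv_mul _ (by rwa [Matrix.det_transpose]), Matrix.mul_one,
    ← Matrix.mulVec_mulVec, Matrix.mulVec_transpose, ← Matrix.dotProduct_mulVec,
    Matrix.mulVec_mulVec, Matrix.mul_nonsing_inv _ hJ, Matrix.one_mulVec]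

lemma gradInner_eq_chartGradInner {x p : M} (hp : p ∈ (extChartAt (𝓡 2) x).source) {u φ : M → ℝ}
    (hu : ContMDiffAt (𝓡 2) 𝓘(ℝ, ℝ) 1 u p) (hφ : ContMDiffAt (𝓡 2) 𝓘(ℝ, ℝ) 1 φ p) :
    gradInner u φ p = chartGradInner x u φ (extChartAt (𝓡 2) x p) := by
  have hmem : extChartAt (𝓡 2) p p ∈ overlap p x :=
    mem_overlap_of_mem_source (mem_extChartAt_source p) hp
  rw [gradInner, chartGradInner_transition hmem (by rwa [extChartAt_to_inv])
    (by rwa [extChartAt_to_inv]), transition, extChartAt_to_inv]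

/-- For a symmetric 2×2 matrix, `det g · g⁻¹` is `g` conjugated by a quarter turn. Thus `√g |∇u|` is
the Riemannian length of the rotated coordinate gradient, which is tangent to the level line; this
is the link between gradient and length in the coarea inequality. -/
lemma areaDensity_sq_mul_chartGradInner_self {x : M} {y : Plane}
    (hy : y ∈ (extChartAt (𝓡 2) x).target) (u : M → ℝ) :
    areaDensity x y ^ 2 * chartGradInner x u u y =
      chartMetric x y (levelDir (u ∘ (extChartAt (𝓡 2) x).symm) y)
        (levelDir (u ∘ (extChartAt (𝓡 2) x).symm) y) := by
  have hd := gram_det_pos x hy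
  rw [areaDensity, Real.sq_sqrt hd.le, chartMetric_eq_sum, chartGradInner]
  simp only [Fin.sum_univ_two, Matrix.inv_def, Matrix.adjugate_fin_two, Matrix.smul_apply,
    Ring.inverse_eq_inv', smul_eq_mul, levelDir]
  simp
  field_simp
  ring

lemma gradInner_self_nonneg (u : M → ℝ) (p : M) : 0 ≤ gradInner u u p := by
  have hy := mem_extChartAt_target (I := 𝓡 2) p
  have h := areaDensity_sq_mul_chartGradInner_self hy u
  have h2 : 0 ≤ areaDensity p (extChartAt (𝓡 2) p p) ^ 2 * gradInner u u p := by
    rw [gradInner, h]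
    exact real_inner_self_nonneg (F := TangentSpace (𝓡 2) ((extChartAt (𝓡 2) p).symm _))
  exact nonneg_of_mul_nonneg_right h2 (pow_pos (areaDensity_pos p hy) 2)

variable [IsContMDiffRiemannianBundle (𝓡 2) ∞ Plane (fun x : M ↦ TangentSpace (𝓡 2) x)]

lemma continuousOn_chartGradInner (x : M) {u φ : M → ℝ} {Ω : Set M} (hΩ : IsOpen Ω)
    (hu : ContMDiffOn (𝓡 2) 𝓘(ℝ, ℝ) 1 u Ω) (hφ : ContMDiffOn (𝓡 2) 𝓘(ℝ, ℝ) 1 φ Ω) :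
    ContinuousOn (chartGradInner x u φ)
      ((extChartAt (𝓡 2) x).target ∩ (extChartAt (𝓡 2) x).symm ⁻¹' Ω) := by
  have h : ∀ {w : M → ℝ}, ContMDiffOn (𝓡 2) 𝓘(ℝ, ℝ) 1 w Ω → ∀ i,
      ContinuousOn (partialDeriv i (w ∘ (extChartAt (𝓡 2) x).symm))
        ((extChartAt (𝓡 2) x).target ∩ (extChartAt (𝓡 2) x).symm ⁻¹' Ω) := fun hw i ↦
    (contDiffOn_partialDeriv (isOpen_symm_preimage x hΩ) (m := 0) (by simp)
      (contDiffOn_comp_symm x hΩ (by norm_cast) hw) i).continuousOn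
  refine continuousOn_finsetSum _ fun i _ ↦ continuousOn_finsetSum _ fun j _ ↦ ?_
  exact (((contDiffOn_gram_inv x i j).continuousOn.mono inter_subset_left).mul (h hφ i)).mul (h hu j)

lemma continuousOn_gradInner {u φ : M → ℝ} {Ω : Set M} (hΩ : IsOpen Ω)
    (hu : ContMDiffOn (𝓡 2) 𝓘(ℝ, ℝ) 1 u Ω) (hφ : ContMDiffOn (𝓡 2) 𝓘(ℝ, ℝ) 1 φ Ω) :
    ContinuousOn (gradInner u φ) Ω := by
  intro p hp
  have hc : ContinuousOn (fun q ↦ chartGradInner p u φ (extChartAt (𝓡 2) p q))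
      ((extChartAt (𝓡 2) p).source ∩ Ω) :=
    (continuousOn_chartGradInner p hΩ hu hφ).comp
      ((continuousOn_extChartAt p).mono inter_subset_left) fun q hq ↦
        ⟨(extChartAt (𝓡 2) p).map_source hq.1, by
          rw [mem_preimage, (extChartAt (𝓡 2) p).left_inv hq.1]; exact hq.2⟩
  have hmem : (extChartAt (𝓡 2) p).source ∩ Ω ∈ 𝓝 p :=
    inter_mem (extChartAt_source_mem_nhds p) (hΩ.mem_nhds hp)
  refine ((hc.continuousAt hmem).congr ?_).continuousWithinAt
  filter_upwards [hmem] with q hq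
  exact (gradInner_eq_chartGradInner hq.1 (hu.contMDiffAt (hΩ.mem_nhds hq.2))
    (hφ.contMDiffAt (hΩ.mem_nhds hq.2))).symm

lemma contDiffOn_chartFlux (x : M) {u : M → ℝ} {Ω : Set M} (hΩ : IsOpen Ω)
    (hu : ContMDiffOn (𝓡 2) 𝓘(ℝ, ℝ) ∞ u Ω) (i : Fin 2) :
    ContDiffOn ℝ ∞ (chartFlux x u i)
      ((extChartAt (𝓡 2) x).target ∩ (extChartAt (𝓡 2) x).symm ⁻¹' Ω) := by
  refine ((contDiffOn_areaDensity x).mono inter_subset_left).mul (ContDiffOn.sum fun j _ ↦ ?_)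
  exact ((contDiffOn_gram_inv x i j).mono inter_subset_left).mul
    (contDiffOn_partialDeriv (isOpen_symm_preimage x hΩ) (by simp)
      (contDiffOn_comp_symm x hΩ le_rfl hu) j)

lemma continuousOn_chartLaplacian (x : M) {u : M → ℝ} {Ω : Set M} (hΩ : IsOpen Ω)
    (hu : ContMDiffOn (𝓡 2) 𝓘(ℝ, ℝ) ∞ u Ω) :
    ContinuousOn (chartLaplacian x u)
      ((extChartAt (𝓡 2) x).target ∩ (extChartAt (𝓡 2) x).symm ⁻¹' Ω) := by
  refine (((contDiffOn_areaDensity x).continuousOn.mono inter_subset_left).inv₀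
    fun y hy ↦ (areaDensity_pos x hy.1).ne').mul (continuousOn_finsetSum _ fun i _ ↦ ?_)
  exact (contDiffOn_partialDeriv (isOpen_symm_preimage x hΩ) (m := ∞) (by simp)
    (contDiffOn_chartFlux x hΩ hu i) i).continuousOn

end Gradient

/-! ### Green's formula for test functions supported in one chart. -/

section WeakForm

lemma integrable_mul_of_tsupport_subset {X : Type*} [TopologicalSpace X] [T2Space X]
    [MeasurableSpace X] [BorelSpace X] {ν : Measure X} [IsFiniteMeasureOnCompacts ν] {V : Set X}
    {h φ : X → ℝ} (hh : ContinuousOn h V) (hφ : Continuous φ) (hc : HasCompactSupport φ)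
    (hV : tsupport φ ⊆ V) : Integrable (fun x ↦ h x * φ x) ν := by
  have h1 : IntegrableOn (fun x ↦ h x * φ x) (tsupport φ) ν :=
    ((hh.mono hV).mul hφ.continuousOn).integrableOn_compact hc
  refine (integrableOn_iff_integrable_of_support_subset ?_).1 h1
  intro x hx
  exact subset_tsupport φ fun h0 ↦ hx (by simp [h0])

lemma integral_mul_partialDeriv {V : Set Plane} (hV : IsOpen V) {W φ : Plane → ℝ}
    (hW : ContDiffOn ℝ 1 W V) (hφ : ContDiff ℝ 1 φ) (hc : HasCompactSupport φ)
    (hsub : tsupport φ ⊆ V) (i : Fin 2) :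
    ∫ y, W y * partialDeriv i φ y = - ∫ y, partialDeriv i W y * φ y := by
  have hφ' : Continuous (partialDeriv i φ) :=
    (hφ.continuous_fderiv one_ne_zero).clm_apply continuous_const
  have hc' : HasCompactSupport (partialDeriv i φ) := hc.fderiv_apply ℝ _
  have hs' : tsupport (partialDeriv i φ) ⊆ V :=
    (tsupport_fderiv_apply_subset ℝ _).trans hsub
  refine integral_mul_fderiv_eq_neg_fderiv_mul_of_integrable
    (integrable_mul_of_tsupport_subset
      (contDiffOn_partialDeriv hV (m := 0) (by simp) hW i).continuousOn hφ.continuous hc hsub)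
    (integrable_mul_of_tsupport_subset hW.continuousOn hφ' hc' hs')
    (integrable_mul_of_tsupport_subset hW.continuousOn hφ.continuous hc hsub)
    (fun y hy ↦ (hW.contDiffAt (hV.mem_nhds (hsub hy))).differentiableAt one_ne_zero)
    (fun y _ ↦ hφ.differentiable one_ne_zero y)

variable {M : Type*} [TopologicalSpace M] [T2Space M] [ChartedSpace Plane M]

/-- A function on `M`, read in the preferred chart around `x` and extended by zero. -/
def chartPull (x : M) (φ : M → ℝ) : Plane → ℝ :=
  (extChartAt (𝓡 2) x).target.indicator (φ ∘ (extChartAt (𝓡 2) x).symm)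

lemma chartPull_eventuallyEq {x : M} {y : Plane} (hy : y ∈ (extChartAt (𝓡 2) x).target)
    (φ : M → ℝ) : chartPull x φ =ᶠ[𝓝 y] φ ∘ (extChartAt (𝓡 2) x).symm := by
  filter_upwards [(isOpen_extChartAt_target x).mem_nhds hy] with z hz
  exact indicator_of_mem hz _

lemma isCompact_image_tsupport {x : M} {φ : M → ℝ} (hc : HasCompactSupport φ)
    (hsub : tsupport φ ⊆ (extChartAt (𝓡 2) x).source) :
    IsCompact (extChartAt (𝓡 2) x '' tsupport φ) :=
  IsCompact.image_of_continuousOn hc ((continuousOn_extChartAt x).mono hsub)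

lemma tsupport_chartPull_subset {x : M} {φ : M → ℝ} (hc : HasCompactSupport φ)
    (hsub : tsupport φ ⊆ (extChartAt (𝓡 2) x).source) :
    tsupport (chartPull x φ) ⊆ extChartAt (𝓡 2) x '' tsupport φ := by
  refine closure_minimal ?_ (isCompact_image_tsupport hc hsub).isClosed
  intro y hy
  have hyt : y ∈ (extChartAt (𝓡 2) x).target := by
    by_contra h
    exact hy (indicator_of_notMem h _)
  rw [Function.mem_support, chartPull, indicator_of_mem hyt] at hy
  exact ⟨(extChartAt (𝓡 2) x).symm y, subset_tsupport φ hy, (extChartAt (𝓡 2) x).right_inv hyt⟩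

lemma hasCompactSupport_chartPull {x : M} {φ : M → ℝ} (hc : HasCompactSupport φ)
    (hsub : tsupport φ ⊆ (extChartAt (𝓡 2) x).source) : HasCompactSupport (chartPull x φ) :=
  (isCompact_image_tsupport hc hsub).of_isClosed_subset (isClosed_tsupport _)
    (tsupport_chartPull_subset hc hsub)

variable [IsManifold (𝓡 2) ∞ M]

lemma contDiff_chartPull {x : M} {φ : M → ℝ} (hφ : ContMDiff (𝓡 2) 𝓘(ℝ, ℝ) 1 φ)
    (hc : HasCompactSupport φ) (hsub : tsupport φ ⊆ (extChartAt (𝓡 2) x).source) :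
    ContDiff ℝ 1 (chartPull x φ) := by
  rw [contDiff_iff_contDiffAt]
  intro y
  by_cases hy : y ∈ (extChartAt (𝓡 2) x).target
  · exact (contDiffAt_comp_symm hy (by norm_cast) hφ.contMDiffAt).congr_of_eventuallyEq
      (chartPull_eventuallyEq hy φ)
  · have h : y ∉ tsupport (chartPull x φ) := fun h ↦ by
      obtain ⟨p, hp, rfl⟩ := tsupport_chartPull_subset hc hsub h
      exact hy ((extChartAt (𝓡 2) x).map_source (hsub hp))
    exact contDiffAt_const.congr_of_eventuallyEq (notMem_tsupport_iff_eventuallyEq.1 h)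

variable [RiemannianBundle (fun x : M ↦ TangentSpace (𝓡 2) x)]

lemma partialDeriv_comp_symm_eq_zero {φ : M → ℝ} {x : M} {y : Plane}
    (hy : y ∈ (extChartAt (𝓡 2) x).target)
    (h : (extChartAt (𝓡 2) x).symm y ∉ tsupport φ) (i : Fin 2) :
    partialDeriv i (φ ∘ (extChartAt (𝓡 2) x).symm) y = 0 := by
  have h1 : φ ∘ (extChartAt (𝓡 2) x).symm =ᶠ[𝓝 y] fun _ ↦ (0 : ℝ) :=
    (notMem_tsupport_iff_eventuallyEq.1 h).comp_tendsto
      ((continuousOn_extChartAt_symm x).continuousAt ((isOpen_extChartAt_target x).mem_nhds hy))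
  rw [partialDeriv, h1.fderiv_eq]
  simp

lemma gradInner_eq_zero {u φ : M → ℝ} {p : M} (h : p ∉ tsupport φ) : gradInner u φ p = 0 := by
  have h1 : ∀ i, partialDeriv i (φ ∘ (extChartAt (𝓡 2) p).symm) (extChartAt (𝓡 2) p p) = 0 :=
    partialDeriv_comp_symm_eq_zero (mem_extChartAt_target p) (by rwa [extChartAt_to_inv])
  simp only [gradInner, chartGradInner, h1, mul_zero, zero_mul, Finset.sum_const_zero]

variable [IsContMDiffRiemannianBundle (𝓡 2) ∞ Plane (fun x : M ↦ TangentSpace (𝓡 2) x)]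

lemma continuous_of_tsupport {X : Type*} [TopologicalSpace X] {K V : Set X} {F : X → ℝ}
    (hK : IsClosed K) (hV : IsOpen V) (hKV : K ⊆ V) (hF : ContinuousOn F V)
    (h0 : ∀ x ∉ K, F x = 0) : Continuous F := by
  rw [continuous_iff_continuousAt]
  intro x
  by_cases hx : x ∈ K
  · exact hF.continuousAt (hV.mem_nhds (hKV hx))
  · refine continuousAt_const.congr (f := fun _ ↦ (0 : ℝ)) ?_
    filter_upwards [hK.isOpen_compl.mem_nhds hx] with z hz
    exact (h0 z hz).symm

lemma continuous_gradInner {u φ : M → ℝ} {Ω : Set M} (hΩ : IsOpen Ω)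
    (hu : ContMDiffOn (𝓡 2) 𝓘(ℝ, ℝ) ∞ u Ω) (hφ : ContMDiff (𝓡 2) 𝓘(ℝ, ℝ) 1 φ)
    (hsub : tsupport φ ⊆ Ω) : Continuous (gradInner u φ) :=
  continuous_of_tsupport (isClosed_tsupport φ) hΩ hsub
    (continuousOn_gradInner hΩ (hu.of_le (by norm_cast)) hφ.contMDiffOn)
    fun _ hp ↦ gradInner_eq_zero hp

variable [MeasurableSpace M] [BorelSpace M]

lemma continuousOn_chartLaplacian_comp (x : M) {u : M → ℝ} {Ω : Set M} (hΩ : IsOpen Ω)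
    (hu : ContMDiffOn (𝓡 2) 𝓘(ℝ, ℝ) ∞ u Ω) :
    ContinuousOn (fun p ↦ chartLaplacian x u (extChartAt (𝓡 2) x p))
      ((extChartAt (𝓡 2) x).source ∩ Ω) :=
  (continuousOn_chartLaplacian x hΩ hu).comp ((continuousOn_extChartAt x).mono inter_subset_left)
    fun q hq ↦ ⟨(extChartAt (𝓡 2) x).map_source hq.1, by
      rw [mem_preimage, (extChartAt (𝓡 2) x).left_inv hq.1]; exact hq.2⟩

/-- In coordinates `√g ⟨∇u, ∇φ⟩` is the Euclidean pairing of the flux with `∇φ`, so this is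
integration by parts in the plane. The Laplacian is still the one of the fixed chart `x`; its
independence of the chart is deduced from this formula. -/
lemma integral_gradInner_of_tsupport_subset_source (x : M) {u φ : M → ℝ} {Ω : Set M}
    (hΩ : IsOpen Ω) (hu : ContMDiffOn (𝓡 2) 𝓘(ℝ, ℝ) ∞ u Ω)
    (hφ : ContMDiff (𝓡 2) 𝓘(ℝ, ℝ) 1 φ) (hc : HasCompactSupport φ)
    (hsub : tsupport φ ⊆ (extChartAt (𝓡 2) x).source ∩ Ω) :
    ∫ p, gradInner u φ p ∂(area M) =
      - ∫ p, chartLaplacian x u (extChartAt (𝓡 2) x p) * φ p ∂(area M) := by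
  set e := extChartAt (𝓡 2) x with he
  set V := e.target ∩ e.symm ⁻¹' Ω with hVdef
  have hV : IsOpen V := isOpen_symm_preimage x hΩ
  have hs : tsupport φ ⊆ e.source := hsub.trans inter_subset_left
  have hcg := continuous_gradInner hΩ hu hφ (hsub.trans inter_subset_right)
  have hcl : Continuous fun p ↦ chartLaplacian x u (e p) * φ p :=
    continuous_of_tsupport (isClosed_tsupport φ) ((isOpen_extChartAt_source x).inter hΩ) hsub
      ((continuousOn_chartLaplacian_comp x hΩ hu).mul hφ.continuous.continuousOn)
      fun p hp ↦ by simp [image_eq_zero_of_notMem_tsupport hp]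
  have htV : tsupport (chartPull x φ) ⊆ V := by
    intro y hy
    obtain ⟨p, hp, rfl⟩ := tsupport_chartPull_subset hc hs hy
    exact ⟨e.map_source (hs hp), by
      rw [mem_preimage, e.left_inv (hs hp)]; exact (hsub hp).2⟩
  have hP := contDiff_chartPull hφ hc hs
  have hPc := hasCompactSupport_chartPull hc hs
  have hfl : ∀ i, ContDiffOn ℝ 1 (chartFlux x u i) V := fun i ↦
    (contDiffOn_chartFlux x hΩ hu i).of_le (by norm_cast)
  have hP' : ∀ i, Continuous (partialDeriv i (chartPull x φ)) := fun i ↦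
    (hP.continuous_fderiv one_ne_zero).clm_apply continuous_const
  have hi1 : ∀ i, Integrable fun y ↦ chartFlux x u i y * partialDeriv i (chartPull x φ) y := fun i ↦
    integrable_mul_of_tsupport_subset (hfl i).continuousOn (hP' i) (hPc.fderiv_apply ℝ _)
      ((tsupport_fderiv_apply_subset ℝ _).trans htV)
  have hi2 : ∀ i, Integrable fun y ↦ partialDeriv i (chartFlux x u i) y * chartPull x φ y := fun i ↦
    integrable_mul_of_tsupport_subset
      (contDiffOn_partialDeriv hV (m := 0) (by simp) (hfl i) i).continuousOn hP.continuous hPc htV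
  calc ∫ p, gradInner u φ p ∂(area M)
      = ∫ p in e.source, gradInner u φ p ∂(area M) := by
        refine (setIntegral_eq_integral_of_forall_compl_eq_zero fun p hp ↦ ?_).symm
        exact gradInner_eq_zero fun h ↦ hp (hs h)
    _ = ∫ y in e.target, areaDensity x y * gradInner u φ (e.symm y) :=
        integral_source x hcg.aestronglyMeasurable
    _ = ∫ y in e.target, ∑ i, chartFlux x u i y * partialDeriv i (chartPull x φ) y := by
        refine setIntegral_congr_fun (measurableSet_target x) fun y hy ↦ ?_
        have hpd : ∀ i, partialDeriv i (chartPull x φ) y = partialDeriv i (φ ∘ e.symm) y :=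
          fun i ↦ by rw [partialDeriv, (chartPull_eventuallyEq hy φ).fderiv_eq]; rfl
        simp only [hpd]
        rw [← areaDensity_mul_chartGradInner]
        -- The pairing is independent of the chart only where `u` is known to be smooth. That covers
        -- the support of `φ`; elsewhere both sides vanish.
        by_cases h : e.symm y ∈ tsupport φ
        · rw [gradInner_eq_chartGradInner (x := x) (e.map_target hy)
            ((hu.of_le (by norm_cast)).contMDiffAt (hΩ.mem_nhds (hsub h).2)) hφ.contMDiffAt,
            ← he, e.right_inv hy]
        · rw [gradInner_eq_zero h, areaDensity_mul_chartGradInner]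
          simp only [partialDeriv_comp_symm_eq_zero hy h]
          simp
    _ = ∫ y, ∑ i, chartFlux x u i y * partialDeriv i (chartPull x φ) y := by
        refine setIntegral_eq_integral_of_forall_compl_eq_zero fun y hy ↦ ?_
        refine Finset.sum_eq_zero fun i _ ↦ ?_
        have : y ∉ tsupport (partialDeriv i (chartPull x φ)) := fun h ↦
          hy (htV (tsupport_fderiv_apply_subset ℝ _ h)).1
        rw [image_eq_zero_of_notMem_tsupport this, mul_zero]
    _ = ∑ i, ∫ y, chartFlux x u i y * partialDeriv i (chartPull x φ) y :=
        integral_finsetSum _ fun i _ ↦ hi1 i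
    _ = ∑ i, - ∫ y, partialDeriv i (chartFlux x u i) y * chartPull x φ y := by
        simp only [fun i ↦ integral_mul_partialDeriv hV (hfl i) hP hPc htV i]
    _ = - ∫ y, ∑ i, partialDeriv i (chartFlux x u i) y * chartPull x φ y := by
        rw [Finset.sum_neg_distrib, integral_finsetSum _ fun i _ ↦ hi2 i]
    _ = - ∫ y in e.target, ∑ i, partialDeriv i (chartFlux x u i) y * chartPull x φ y := by
        congr 1
        refine (setIntegral_eq_integral_of_forall_compl_eq_zero fun y hy ↦ ?_).symm
        refine Finset.sum_eq_zero fun i _ ↦ ?_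
        rw [chartPull, indicator_of_notMem hy, mul_zero]
    _ = - ∫ y in e.target, areaDensity x y *
          (chartLaplacian x u (e (e.symm y)) * φ (e.symm y)) := by
        congr 1
        refine setIntegral_congr_fun (measurableSet_target x) fun y hy ↦ ?_
        have hd := (areaDensity_pos x hy).ne'
        have hp : chartPull x φ y = φ (e.symm y) := indicator_of_mem hy _
        simp only [← Finset.sum_mul, hp]
        rw [e.right_inv hy, chartLaplacian]
        field_simp
    _ = - ∫ p in e.source, chartLaplacian x u (e p) * φ p ∂(area M) := by
        rw [integral_source x (F := fun p ↦ chartLaplacian x u (e p) * φ p)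
          hcl.aestronglyMeasurable]
    _ = - ∫ p, chartLaplacian x u (e p) * φ p ∂(area M) := by
        congr 1
        refine setIntegral_eq_integral_of_forall_compl_eq_zero fun p hp ↦ ?_
        rw [image_eq_zero_of_notMem_tsupport fun h ↦ hp (hs h), mul_zero]

end WeakForm

/-! ### Chart independence of the Laplacian and the global Green formula. -/

section GlobalWeakForm

variable {M : Type*} [TopologicalSpace M] [T2Space M] [SecondCountableTopology M]
  [ChartedSpace Plane M] [IsManifold (𝓡 2) ∞ M]
  [RiemannianBundle (fun x : M ↦ TangentSpace (𝓡 2) x)]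
  [IsContMDiffRiemannianBundle (𝓡 2) ∞ Plane (fun x : M ↦ TangentSpace (𝓡 2) x)]
  [MeasurableSpace M] [BorelSpace M]

instance isOpenPosMeasure_area : (area M).IsOpenPosMeasure :=
  ⟨fun _ hU hne ↦ (area_pos_of_isOpen hU hne).ne'⟩

/-- No second-order transformation rule is computed. Tested against any `φ` supported in the
overlap, both Laplacians give minus the integral of `⟨∇u, ∇φ⟩`, which does not depend on the chart.
They therefore agree almost everywhere, and by continuity everywhere, since nonempty open sets have
positive area. -/
lemma eqOn_chartLaplacian (x x' : M) {u : M → ℝ} {Ω : Set M} (hΩ : IsOpen Ω)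
    (hu : ContMDiffOn (𝓡 2) 𝓘(ℝ, ℝ) ∞ u Ω) :
    EqOn (fun p ↦ chartLaplacian x u (extChartAt (𝓡 2) x p))
      (fun p ↦ chartLaplacian x' u (extChartAt (𝓡 2) x' p))
      ((extChartAt (𝓡 2) x).source ∩ (extChartAt (𝓡 2) x').source ∩ Ω) := by
  have : LocallyCompactSpace M := ChartedSpace.locallyCompactSpace Plane M
  set U := (extChartAt (𝓡 2) x).source ∩ (extChartAt (𝓡 2) x').source ∩ Ω with hUdef
  have hU : IsOpen U :=
    ((isOpen_extChartAt_source x).inter (isOpen_extChartAt_source x')).inter hΩ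
  have h1 : ContinuousOn (fun p ↦ chartLaplacian x u (extChartAt (𝓡 2) x p)) U :=
    (continuousOn_chartLaplacian_comp x hΩ hu).mono fun p hp ↦ ⟨hp.1.1, hp.2⟩
  have h2 : ContinuousOn (fun p ↦ chartLaplacian x' u (extChartAt (𝓡 2) x' p)) U :=
    (continuousOn_chartLaplacian_comp x' hΩ hu).mono fun p hp ↦ ⟨hp.1.2, hp.2⟩
  refine Measure.eqOn_open_of_ae_eq (μ := area M) ?_ hU h1 h2
  have h3 := hU.ae_eq_zero_of_integral_contMDiff_smul_eq_zero (𝓡 2) (μ := area M)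
    ((h1.sub h2).locallyIntegrableOn hU.measurableSet) fun φ hφ hc hsub ↦ by
      have hφ1 : ContMDiff (𝓡 2) 𝓘(ℝ, ℝ) 1 φ := hφ.of_le (by norm_cast)
      have e1 := integral_gradInner_of_tsupport_subset_source x hΩ hu hφ1 hc
        (hsub.trans fun p hp ↦ ⟨hp.1.1, hp.2⟩)
      have e2 := integral_gradInner_of_tsupport_subset_source x' hΩ hu hφ1 hc
        (hsub.trans fun p hp ↦ ⟨hp.1.2, hp.2⟩)
      have i1 : Integrable (fun p ↦ chartLaplacian x u (extChartAt (𝓡 2) x p) * φ p) (area M) :=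
        integrable_mul_of_tsupport_subset h1 hφ.continuous hc hsub
      have i2 : Integrable (fun p ↦ chartLaplacian x' u (extChartAt (𝓡 2) x' p) * φ p) (area M) :=
        integrable_mul_of_tsupport_subset h2 hφ.continuous hc hsub
      have h4 : ∫ p, φ p • (chartLaplacian x u (extChartAt (𝓡 2) x p) -
          chartLaplacian x' u (extChartAt (𝓡 2) x' p)) ∂(area M) =
          ∫ p, (chartLaplacian x u (extChartAt (𝓡 2) x p) * φ p -
          chartLaplacian x' u (extChartAt (𝓡 2) x' p) * φ p) ∂(area M) := by
        refine integral_congr_ae (Eventually.of_forall fun p ↦ ?_)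
        simp only [smul_eq_mul]
        ring
      refine h4.trans ?_
      rw [integral_sub i1 i2]
      linarith
  rw [EventuallyEq, ae_restrict_iff' hU.measurableSet]
  filter_upwards [h3] with p hp hpU
  exact sub_eq_zero.1 (hp hpU)

lemma laplacian_eqOn_source (x : M) {u : M → ℝ} {Ω : Set M} (hΩ : IsOpen Ω)
    (hu : ContMDiffOn (𝓡 2) 𝓘(ℝ, ℝ) ∞ u Ω) :
    EqOn (laplacian u) (fun p ↦ chartLaplacian x u (extChartAt (𝓡 2) x p))
      ((extChartAt (𝓡 2) x).source ∩ Ω) := fun p hp ↦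
  eqOn_chartLaplacian p x hΩ hu ⟨⟨mem_extChartAt_source p, hp.1⟩, hp.2⟩

lemma continuousOn_laplacian {u : M → ℝ} {Ω : Set M} (hΩ : IsOpen Ω)
    (hu : ContMDiffOn (𝓡 2) 𝓘(ℝ, ℝ) ∞ u Ω) : ContinuousOn (laplacian u) Ω := by
  intro p hp
  have hmem : (extChartAt (𝓡 2) p).source ∩ Ω ∈ 𝓝 p :=
    inter_mem (extChartAt_source_mem_nhds p) (hΩ.mem_nhds hp)
  have h := (continuousOn_chartLaplacian_comp p hΩ hu).continuousAt hmem
  refine (h.congr ?_).continuousWithinAt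
  filter_upwards [hmem] with q hq
  exact (laplacian_eqOn_source p hΩ hu hq).symm

lemma gradInner_finset_sum {ι : Type*} (s : Finset ι) {u : M → ℝ} {φ : ι → M → ℝ} {p : M}
    (hφ : ∀ k ∈ s, ContMDiffAt (𝓡 2) 𝓘(ℝ, ℝ) 1 (φ k) p) :
    gradInner u (fun q ↦ ∑ k ∈ s, φ k q) p = ∑ k ∈ s, gradInner u (φ k) p := by
  have h : ∀ i, partialDeriv i ((fun q ↦ ∑ k ∈ s, φ k q) ∘ (extChartAt (𝓡 2) p).symm)
      (extChartAt (𝓡 2) p p) =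
      ∑ k ∈ s, partialDeriv i (φ k ∘ (extChartAt (𝓡 2) p).symm) (extChartAt (𝓡 2) p p) := by
    intro i
    have : (fun q ↦ ∑ k ∈ s, φ k q) ∘ (extChartAt (𝓡 2) p).symm =
        fun y ↦ ∑ k ∈ s, (φ k ∘ (extChartAt (𝓡 2) p).symm) y := rfl
    rw [partialDeriv, this, fderiv_fun_sum]
    · rw [sum_apply]; rfl
    · exact fun k hk ↦ differentiableAt_comp_symm (mem_extChartAt_target p)
        (by rw [extChartAt_to_inv]; exact hφ k hk)
  simp only [gradInner, chartGradInner, h, Fin.sum_univ_two, Finset.mul_sum, Finset.sum_mul,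
    ← Finset.sum_add_distrib]

lemma gradInner_comp {u : M → ℝ} {p : M} {ψ : ℝ → ℝ} {d : ℝ}
    (hu : ContMDiffAt (𝓡 2) 𝓘(ℝ, ℝ) 1 u p) (hψ : HasDerivAt ψ d (u p)) :
    gradInner u (ψ ∘ u) p = d * gradInner u u p := by
  have h : ∀ i, partialDeriv i ((ψ ∘ u) ∘ (extChartAt (𝓡 2) p).symm) (extChartAt (𝓡 2) p p) =
      d * partialDeriv i (u ∘ (extChartAt (𝓡 2) p).symm) (extChartAt (𝓡 2) p p) := by
    intro i
    have h1 := (differentiableAt_comp_symm (mem_extChartAt_target p)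
      (by rwa [extChartAt_to_inv])).hasFDerivAt (f := u ∘ (extChartAt (𝓡 2) p).symm)
    have h2 : HasDerivAt ψ d ((u ∘ (extChartAt (𝓡 2) p).symm) (extChartAt (𝓡 2) p p)) := by
      rwa [Function.comp, extChartAt_to_inv]
    have h3 := h2.comp_hasFDerivAt (extChartAt (𝓡 2) p p) h1
    rw [partialDeriv, Function.comp_assoc, h3.fderiv]
    rfl
  simp only [gradInner, chartGradInner, h, Finset.mul_sum]
  refine Finset.sum_congr rfl fun i _ ↦ Finset.sum_congr rfl fun j _ ↦ ?_
  ring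

/-- Green's formula `∫ ⟨∇u, ∇φ⟩ = - ∫ φ Δu` for test functions with compact support. -/
theorem integral_gradInner {u φ : M → ℝ} {Ω : Set M}
    (hΩ : IsOpen Ω) (hu : ContMDiffOn (𝓡 2) 𝓘(ℝ, ℝ) ∞ u Ω)
    (hφ : ContMDiff (𝓡 2) 𝓘(ℝ, ℝ) 1 φ) (hc : HasCompactSupport φ) (hsub : tsupport φ ⊆ Ω) :
    ∫ p, gradInner u φ p ∂(area M) = - ∫ p, laplacian u p * φ p ∂(area M) := by
  have : LocallyCompactSpace M := ChartedSpace.locallyCompactSpace Plane M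
  -- A partition of unity subordinate to the chart domains cuts `φ` into pieces covered by the
  -- one-chart formula; only finitely many meet its compact support.
  obtain ⟨ρ, hρ⟩ := SmoothPartitionOfUnity.exists_isSubordinate (𝓡 2) (s := (univ : Set M))
    isClosed_univ (fun x : M ↦ (extChartAt (𝓡 2) x).source) (fun x ↦ isOpen_extChartAt_source x)
    (fun x _ ↦ mem_iUnion.2 ⟨x, mem_extChartAt_source x⟩)
  have hfin : {k | (Function.support (ρ k) ∩ tsupport φ).Nonempty}.Finite :=
    ρ.locallyFinite.finite_nonempty_inter_compact hc
  set S := hfin.toFinset with hS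
  have hsum : φ = fun q ↦ ∑ k ∈ S, ρ k q * φ q := by
    ext q
    by_cases hq : q ∈ tsupport φ
    · rw [← Finset.sum_mul, ← finsum_eq_sum_of_support_subset, ρ.sum_eq_one (mem_univ q), one_mul]
      intro k hk
      simp only [hS, Finite.coe_toFinset, mem_ofPred_eq]
      exact ⟨q, hk, hq⟩
    · simp [image_eq_zero_of_notMem_tsupport hq]
  have hsm : ∀ k, ContMDiff (𝓡 2) 𝓘(ℝ, ℝ) 1 fun q ↦ ρ k q * φ q := fun k ↦
    ((ρ k).contMDiff.of_le (by norm_cast)).mul hφ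
  have hck : ∀ k, HasCompactSupport fun q ↦ ρ k q * φ q := fun k ↦ hc.mul_left
  have hsk : ∀ k, tsupport (fun q ↦ ρ k q * φ q) ⊆ (extChartAt (𝓡 2) k).source ∩ Ω := fun k ↦
    subset_inter ((tsupport_mul_subset_left).trans (hρ k))
      ((tsupport_mul_subset_right).trans hsub)
  have hik : ∀ k, Integrable (gradInner u fun q ↦ ρ k q * φ q) (area M) := fun k ↦
    (continuous_gradInner hΩ hu (hsm k) ((hsk k).trans inter_subset_right)).integrable_of_hasCompactSupport
      (HasCompactSupport.intro' (hck k) (isClosed_tsupport _) fun p hp ↦ gradInner_eq_zero hp)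
  have hil : ∀ k, Integrable (fun p ↦ laplacian u p * (ρ k p * φ p)) (area M) := fun k ↦
    integrable_mul_of_tsupport_subset (continuousOn_laplacian hΩ hu) (hsm k).continuous (hck k)
      ((hsk k).trans inter_subset_right)
  calc ∫ p, gradInner u φ p ∂(area M)
      = ∫ p, ∑ k ∈ S, gradInner u (fun q ↦ ρ k q * φ q) p ∂(area M) := by
        conv_lhs => rw [hsum]
        refine integral_congr_ae (Eventually.of_forall fun p ↦ ?_)
        exact gradInner_finset_sum S fun k _ ↦ (hsm k).contMDiffAt
    _ = ∑ k ∈ S, ∫ p, gradInner u (fun q ↦ ρ k q * φ q) p ∂(area M) :=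
        integral_finsetSum _ fun k _ ↦ hik k
    _ = ∑ k ∈ S, - ∫ p, laplacian u p * (ρ k p * φ p) ∂(area M) := by
        refine Finset.sum_congr rfl fun k _ ↦ ?_
        rw [integral_gradInner_of_tsupport_subset_source k hΩ hu (hsm k) (hck k) (hsk k)]
        congr 1
        refine integral_congr_ae (Eventually.of_forall fun p ↦ ?_)
        by_cases hp : p ∈ tsupport fun q ↦ ρ k q * φ q
        · simp only [laplacian_eqOn_source k hΩ hu (hsk k hp)]
        · have h0 := image_eq_zero_of_notMem_tsupport hp
          simp only [h0, mul_zero]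
    _ = - ∫ p, ∑ k ∈ S, laplacian u p * (ρ k p * φ p) ∂(area M) := by
        rw [integral_finsetSum _ fun k _ ↦ hil k, Finset.sum_neg_distrib]
    _ = - ∫ p, laplacian u p * φ p ∂(area M) := by
        congr 1
        refine integral_congr_ae (Eventually.of_forall fun p ↦ ?_)
        simp only [← Finset.mul_sum]
        rw [← congrFun hsum p]

end GlobalWeakForm

/-! ### Boundedness of the Laplacian up to the boundary. -/

section Bounded

open Asymptotics

variable {M : Type*} [TopologicalSpace M] [T2Space M] [SecondCountableTopology M]
  [ChartedSpace Plane M] [IsManifold (𝓡 2) ∞ M]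
  [RiemannianBundle (fun x : M ↦ TangentSpace (𝓡 2) x)]
  [IsContMDiffRiemannianBundle (𝓡 2) ∞ Plane (fun x : M ↦ TangentSpace (𝓡 2) x)]
  [MeasurableSpace M] [BorelSpace M]

lemma isBigO_partialDeriv_of_tendsto {l : Filter Plane} {w : Plane → ℝ}
    {L : Plane [×1]→L[ℝ] ℝ} (h : Tendsto (iteratedFDeriv ℝ 1 w) l (𝓝 L)) (j : Fin 2) :
    partialDeriv j w =O[l] fun _ ↦ (1 : ℝ) := by
  refine IsBigO.trans (IsBigO.of_bound 1 (Eventually.of_forall fun y ↦ ?_)) (h.isBigO_one ℝ)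
  have := (fderiv ℝ w y).le_opNorm (EuclideanSpace.single j 1)
  rw [one_mul, ← norm_iteratedFDeriv_fderiv, norm_iteratedFDeriv_zero]
  simpa [partialDeriv] using this

lemma isBigO_partialDeriv_partialDeriv_of_tendsto {l : Filter Plane} {w : Plane → ℝ}
    {L : Plane [×2]→L[ℝ] ℝ} (h : Tendsto (iteratedFDeriv ℝ 2 w) l (𝓝 L))
    (hw : ∀ᶠ y in l, DifferentiableAt ℝ (fderiv ℝ w) y) (i j : Fin 2) :
    partialDeriv i (partialDeriv j w) =O[l] fun _ ↦ (1 : ℝ) := by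
  refine IsBigO.trans (IsBigO.of_bound 1 ?_) (h.isBigO_one ℝ)
  filter_upwards [hw] with y hy
  have h1 : partialDeriv i (partialDeriv j w) y =
      fderiv ℝ (fderiv ℝ w) y (EuclideanSpace.single i 1) (EuclideanSpace.single j 1) := by
    change fderiv ℝ (fun z ↦ fderiv ℝ w z (EuclideanSpace.single j 1)) y _ = _
    rw [fderiv_clm_apply hy (by fun_prop)]
    simp
  have h2 := (fderiv ℝ (fderiv ℝ w) y).le_opNorm₂ (EuclideanSpace.single i 1)
    (EuclideanSpace.single j 1)
  rw [h1, one_mul, ← norm_iteratedFDeriv_fderiv, ← norm_iteratedFDeriv_fderiv,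
    norm_iteratedFDeriv_zero]
  simpa using h2

/-- Expanded by the product rule, the Laplacian in the chart at `x` is a combination of first and
second derivatives of `u` with coefficients continuous at `x`, and these derivatives have limits at
`x` even when `x` lies on the boundary. -/
lemma isBigO_chartLaplacian {Ω : Set M} (hΩ : IsOpen Ω) {u : M → ℝ} (hu : SmoothOnClosure Ω u)
    {x : M} (hx : x ∈ closure Ω) :
    chartLaplacian x u =O[𝓝[(extChartAt (𝓡 2) x).target ∩ (extChartAt (𝓡 2) x).symm ⁻¹' Ω]
      (extChartAt (𝓡 2) x x)] fun _ ↦ (1 : ℝ) := by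
  set e := extChartAt (𝓡 2) x
  set V := e.target ∩ e.symm ⁻¹' Ω with hVdef
  have hV : IsOpen V := isOpen_symm_preimage x hΩ
  set w := u ∘ e.symm with hw
  have hwV : ContDiffOn ℝ ∞ w V := contDiffOn_comp_symm x hΩ le_rfl hu.contMDiffOn
  have hVl : V ∈ 𝓝[V] (e x) := self_mem_nhdsWithin
  obtain ⟨L1, hL1⟩ := hu.tendsto_deriv x hx 1
  obtain ⟨L2, hL2⟩ := hu.tendsto_deriv x hx 2
  have hmem : e.target ∈ 𝓝 (e x) := (isOpen_extChartAt_target x).mem_nhds (mem_extChartAt_target x)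
  have hO : ∀ {a : Plane → ℝ}, ContinuousOn a e.target → a =O[𝓝[V] (e x)] fun _ ↦ (1 : ℝ) :=
    fun ha ↦ ((ha.continuousAt hmem).tendsto.mono_left nhdsWithin_le_nhds).isBigO_one ℝ
  have hd1 := isBigO_partialDeriv_of_tendsto hL1
  have hd2 := isBigO_partialDeriv_partialDeriv_of_tendsto hL2 (by
    filter_upwards [hVl] with y hy
    exact ((hwV.fderiv_of_isOpen hV (m := ∞) (by simp)).contDiffAt
      (hV.mem_nhds hy)).differentiableAt (by simp))
  set a : Fin 2 → Fin 2 → Plane → ℝ := fun i j y ↦ areaDensity x y * (gram x y)⁻¹ i j with ha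
  have hsm : ∀ i j, ContDiffOn ℝ ∞ (a i j) e.target := fun i j ↦
    (contDiffOn_areaDensity x).mul (contDiffOn_gram_inv x i j)
  have hexp : ∀ y ∈ V, chartLaplacian x u y = (areaDensity x y)⁻¹ *
      ∑ i : Fin 2, ∑ j : Fin 2, (partialDeriv i (a i j) y * partialDeriv j w y +
        a i j y * partialDeriv i (partialDeriv j w) y) := by
    intro y hy
    rw [chartLaplacian]
    congr 1
    refine Finset.sum_congr rfl fun i _ ↦ ?_
    have h1 : chartFlux x u i = fun z ↦ ∑ j : Fin 2, a i j z * partialDeriv j w z := by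
      ext z
      simp only [chartFlux, ha, Finset.mul_sum, mul_assoc]
      rfl
    have hda : ∀ j, DifferentiableAt ℝ (a i j) y := fun j ↦
      ((hsm i j).contDiffAt ((isOpen_extChartAt_target x).mem_nhds hy.1)).differentiableAt (by simp)
    have hdw : ∀ j, DifferentiableAt ℝ (partialDeriv j w) y := fun j ↦
      ((contDiffOn_partialDeriv hV (m := ∞) (by simp) hwV j).contDiffAt
        (hV.mem_nhds hy)).differentiableAt (by simp)
    rw [h1, partialDeriv, fderiv_fun_sum fun j _ ↦ (hda j).fun_mul (hdw j), sum_apply]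
    refine Finset.sum_congr rfl fun j _ ↦ ?_
    rw [fderiv_fun_mul (hda j) (hdw j)]
    simp only [partialDeriv, add_apply, smul_apply, smul_eq_mul]
    ring
  refine IsBigO.congr' (f₁ := fun y ↦ (areaDensity x y)⁻¹ *
      ∑ i : Fin 2, ∑ j : Fin 2, (partialDeriv i (a i j) y * partialDeriv j w y +
        a i j y * partialDeriv i (partialDeriv j w) y)) (g₁ := fun _ ↦ (1 : ℝ) * 1) ?_
    (by filter_upwards [hVl] with y hy using (hexp y hy).symm)
    (Eventually.of_forall fun _ ↦ one_mul 1)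
  have hone : ∀ {b c : Plane → ℝ}, b =O[𝓝[V] (e x)] (fun _ ↦ (1 : ℝ)) →
      c =O[𝓝[V] (e x)] (fun _ ↦ (1 : ℝ)) →
      (fun y ↦ b y * c y) =O[𝓝[V] (e x)] fun _ ↦ (1 : ℝ) := fun hb hc ↦ by
    simpa using hb.mul hc
  refine IsBigO.mul (hO ((contDiffOn_areaDensity x).continuousOn.inv₀
    fun y hy ↦ (areaDensity_pos x hy).ne')) ?_
  refine IsBigO.fun_sum fun i _ ↦ IsBigO.fun_sum fun j _ ↦ IsBigO.add (hone ?_ (hd1 j))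
    (hone (hO (hsm i j).continuousOn) (hd2 i j))
  exact hO (contDiffOn_partialDeriv (isOpen_extChartAt_target x) (m := ∞) (by simp)
    (hsm i j) i).continuousOn

/-- Local bounds near each point of the compact closure are patched together. The bound makes `-Δu`
integrable over `Ω`. -/
lemma exists_bound_laplacian {Ω : Set M} (hΩ : IsOpen Ω) (hc : IsCompact (closure Ω)) {u : M → ℝ}
    (hu : SmoothOnClosure Ω u) : ∃ C, ∀ p ∈ Ω, |laplacian u p| ≤ C := by
  suffices h : ∃ C, ∀ p ∈ closure Ω ∩ Ω, |laplacian u p| ≤ C by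
    obtain ⟨C, hC⟩ := h
    exact ⟨C, fun p hp ↦ hC p ⟨subset_closure hp, hp⟩⟩
  refine hc.induction_on (p := fun s ↦ ∃ C, ∀ p ∈ s ∩ Ω, |laplacian u p| ≤ C) ⟨0, by simp⟩
    (fun s t hst ⟨C, hC⟩ ↦ ⟨C, fun p hp ↦ hC p ⟨hst hp.1, hp.2⟩⟩) ?_ ?_
  · rintro s t ⟨C, hC⟩ ⟨D, hD⟩
    refine ⟨max C D, ?_⟩
    rintro p ⟨hp | hp, hp'⟩
    · exact (hC p ⟨hp, hp'⟩).trans (le_max_left _ _)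
    · exact (hD p ⟨hp, hp'⟩).trans (le_max_right _ _)
  · intro x hx
    obtain ⟨C, hC⟩ := (isBigO_chartLaplacian hΩ hu hx).bound
    have ht : Tendsto (extChartAt (𝓡 2) x) (𝓝[Ω] x)
        (𝓝[(extChartAt (𝓡 2) x).target ∩ (extChartAt (𝓡 2) x).symm ⁻¹' Ω]
          (extChartAt (𝓡 2) x x)) := by
      refine tendsto_nhdsWithin_iff.2
        ⟨(continuousAt_extChartAt x).tendsto.mono_left nhdsWithin_le_nhds, ?_⟩
      filter_upwards [self_mem_nhdsWithin,
        nhdsWithin_le_nhds (extChartAt_source_mem_nhds (I := 𝓡 2) x)] with q hq hq'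
      exact ⟨(extChartAt (𝓡 2) x).map_source hq', by
        rw [mem_preimage, (extChartAt (𝓡 2) x).left_inv hq']; exact hq⟩
    have h1 : ∀ᶠ p in 𝓝[Ω] x, |laplacian u p| ≤ C := by
      filter_upwards [ht.eventually hC, self_mem_nhdsWithin,
        nhdsWithin_le_nhds (extChartAt_source_mem_nhds (I := 𝓡 2) x)] with q hq hqΩ hqs
      rw [laplacian_eqOn_source x hΩ hu.contMDiffOn ⟨hqs, hqΩ⟩]
      simpa using hq
    obtain ⟨t, ht, htx⟩ := mem_nhdsWithin_iff_exists_mem_nhds_inter.1 h1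
    exact ⟨t, mem_nhdsWithin_of_mem_nhds ht, C, fun p hp ↦ htx hp⟩

end Bounded

/-! ### Sard's theorem in the plane, by Hausdorff dimension. -/

section Sard

lemma exists_fderiv_eq_zero {w : Plane → ℝ} {B : Set Plane} (hB : Convex ℝ B)
    (hw : ∀ z ∈ B, DifferentiableAt ℝ w z) {y y' : Plane} (hy : y ∈ B) (hy' : y' ∈ B)
    (h : w y = w y') : ∃ z ∈ segment ℝ y y', fderiv ℝ w z (y' - y) = 0 := by
  obtain ⟨z, hz, hz'⟩ := domain_mvt (fun z hz ↦ (hw z hz).hasFDerivAt.hasFDerivWithinAt) hB hy hy'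
  exact ⟨z, hz, by rw [← hz', h, sub_self]⟩

lemma fderiv_apply_eq_sum (w : Plane → ℝ) (y v : Plane) :
    fderiv ℝ w y v = v 0 * partialDeriv 0 w y + v 1 * partialDeriv 1 w y := by
  conv_lhs => rw [sum_coord_smul_single v, map_sum]
  simp [Fin.sum_univ_two, partialDeriv]

/-- In the plane a vector killed by `dw` is parallel to the rotated gradient. This identity states
the proportionality without dividing, so it also holds at critical points. -/
lemma inner_levelDir_smul {w : Plane → ℝ} {z δ : Plane} (h : fderiv ℝ w z δ = 0) (v : Plane) :
    inner ℝ v (levelDir w z) • δ = inner ℝ v δ • levelDir w z := by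
  rw [fderiv_apply_eq_sum] at h
  ext i
  fin_cases i
  · simp [levelDir, PiLp.inner_apply, Fin.sum_univ_two]
    linear_combination v 1 * h
  · simp [levelDir, PiLp.inner_apply, Fin.sum_univ_two]
    linear_combination -v 0 * h

lemma continuousOn_levelDir {w : Plane → ℝ} {V : Set Plane} (hV : IsOpen V)
    (hw : ContDiffOn ℝ 1 w V) : ContinuousOn (levelDir w) V := by
  have h := fun i ↦ (contDiffOn_partialDeriv hV (m := 0) (by simp) hw i).continuousOn
  refine (PiLp.continuous_toLp 2 _).comp_continuousOn (continuousOn_pi.2 fun i ↦ ?_)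
  fin_cases i
  · exact (h 1).neg
  · exact h 0

lemma levelDir_ne_zero {w : Plane → ℝ} {y : Plane} (h : fderiv ℝ w y ≠ 0) : levelDir w y ≠ 0 := by
  intro h0
  apply h
  ext v
  have h1 : partialDeriv 1 w y = 0 := by simpa [levelDir] using congrArg (fun v : Plane ↦ v 0) h0
  have h2 : partialDeriv 0 w y = 0 := by simpa [levelDir] using congrArg (fun v : Plane ↦ v 1) h0
  rw [fderiv_apply_eq_sum, h1, h2]
  simp

lemma norm_image_sub_le_pow {E F : Type*} [NormedAddCommGroup E] [NormedSpace ℝ E]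
    [NormedAddCommGroup F] [NormedSpace ℝ F] {f : E → F} {y y' : E} {L : ℝ} (hL : 0 ≤ L) {k : ℕ}
    (hf : ∀ z ∈ segment ℝ y y', DifferentiableAt ℝ f z)
    (hb : ∀ z ∈ segment ℝ y y', ‖fderiv ℝ f z‖ ≤ L * ‖z - y‖ ^ k) :
    ‖f y' - f y‖ ≤ L * ‖y' - y‖ ^ (k + 1) := by
  rw [pow_succ, ← mul_assoc]
  refine (convex_segment y y').norm_image_sub_le_of_norm_fderiv_le hf (fun z hz ↦ ?_)
    (left_mem_segment ℝ y y') (right_mem_segment ℝ y y')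
  refine (hb z hz).trans ?_
  gcongr
  obtain ⟨t, ht, rfl⟩ := (segment_eq_image' ℝ y y').le hz
  simp only [add_sub_cancel_left, norm_smul, Real.norm_eq_abs, abs_of_nonneg ht.1]
  exact mul_le_of_le_one_left (norm_nonneg _) ht.2

/-- A `k`-Hölder map divides Hausdorff dimension by `k`, so the image has dimension at most `d/k <
1` and is Lebesgue null. -/
lemma volume_image_eq_zero_of_pow {X : Type*} [EMetricSpace X] {w : X → ℝ} {S : Set X}
    {k d : ℕ} (hdim : dimH S ≤ d) (hdk : d < k) {L : ℝ≥0}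
    (h : ∀ y ∈ S, ∀ y' ∈ S, edist (w y) (w y') ≤ L * edist y y' ^ k) :
    volume (w '' S) = 0 := by
  have hk : 0 < k := by lia
  have hH : HolderOnWith L (k : ℝ≥0) w S := fun y hy y' hy' ↦ by
    simpa using h y hy y' hy'
  have h1 := hH.dimH_image_le (by exact_mod_cast hk)
  rw [← hausdorffMeasure_real]
  refine hausdorffMeasure_of_dimH_lt (d := 1) (h1.trans_lt ?_)
  refine (ENNReal.div_le_div_right hdim _).trans_lt ?_
  rw [ENNReal.div_lt_iff (by simp [hk.ne']) (by simp)]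
  simpa using hdk

/-- Under this bound `S` is the image of a subset of the line under a Lipschitz map, the inverse of
the projection `⟨v, ·⟩`. -/
lemma dimH_le_one_of_inner {S : Set Plane} {v : Plane} {K : ℝ≥0}
    (h : ∀ y ∈ S, ∀ y' ∈ S, edist y y' ≤ K * edist (inner ℝ v y) (inner ℝ v y')) :
    dimH S ≤ 1 := by
  set pr : Plane → ℝ := fun y ↦ inner ℝ v y with hpr
  have hinj : InjOn pr S := by
    intro y hy y' hy' hyy
    have := h y hy y' hy'
    rw [show inner ℝ v y = inner ℝ v y' from hyy, edist_self, mul_zero] at this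
    exact edist_le_zero.1 this
  set g := Function.invFunOn pr S with hg
  have hgS : ∀ y ∈ S, g (pr y) = y := fun y hy ↦ hinj.leftInvOn_invFunOn hy
  have hlip : LipschitzOnWith K g (pr '' S) := by
    rintro _ ⟨y, hy, rfl⟩ _ ⟨y', hy', rfl⟩
    rw [hgS y hy, hgS y' hy']
    exact h y hy y' hy'
  have him : g '' (pr '' S) = S := by
    rw [image_image]
    exact (image_congr hgS).trans (image_id' S)
  rw [← him]
  exact hlip.dimH_image_le.trans ((dimH_mono (subset_univ _)).trans Real.dimH_univ.le)

lemma edist_le_of_norm_le_pow {E F : Type*} [NormedAddCommGroup E] [NormedAddCommGroup F]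
    {a b : F} {y y' : E} {L : ℝ≥0} {k : ℕ} (h : ‖b - a‖ ≤ L * ‖y' - y‖ ^ k) :
    edist a b ≤ L * edist y y' ^ k := by
  rw [edist_comm a, edist_comm y, edist_eq_enorm_sub, edist_eq_enorm_sub, enorm_eq_nnnorm,
    enorm_eq_nnnorm]
  exact_mod_cast h

/-- The first two derivatives are Lipschitz near `y₀`. From a critical point `w` therefore moves by
at most a square of the distance, and by at most a cube if the Hessian vanishes too; `L` and the
ball are uniform in the critical point. -/
lemma exists_taylor_bounds {E : Type*} [NormedAddCommGroup E] [NormedSpace ℝ E] {w : E → ℝ}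
    {V : Set E} (hV : IsOpen V) (hw : ContDiffOn ℝ ∞ w V) {y₀ : E} (hy₀ : y₀ ∈ V) :
    ∃ L : ℝ≥0, ∃ ε > 0, Metric.ball y₀ ε ⊆ V ∧ ∀ y ∈ Metric.ball y₀ ε, fderiv ℝ w y = 0 →
      ∀ y' ∈ Metric.ball y₀ ε, edist (w y) (w y') ≤ L * edist y y' ^ 2 ∧
        (fderiv ℝ (fderiv ℝ w) y = 0 → edist (w y) (w y') ≤ L * edist y y' ^ 3) := by
  have hD1 : ContDiffOn ℝ ∞ (fderiv ℝ w) V := hw.fderiv_of_isOpen hV (by simp)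
  have hD2 : ContDiffOn ℝ ∞ (fderiv ℝ (fderiv ℝ w)) V := hD1.fderiv_of_isOpen hV (by simp)
  have hVn := hV.mem_nhds hy₀
  have hle : (1 : ℕ∞ω) ≤ (∞ : ℕ∞ω) := by norm_cast
  obtain ⟨L₁, t₁, ht₁, hL₁⟩ := ((hD1.contDiffAt hVn).of_le hle).exists_lipschitzOnWith
  obtain ⟨L₂, t₂, ht₂, hL₂⟩ := ((hD2.contDiffAt hVn).of_le hle).exists_lipschitzOnWith
  obtain ⟨ε, hε, hball⟩ := Metric.nhds_basis_ball.mem_iff.1 (inter_mem (inter_mem ht₁ ht₂) hVn)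
  set L := max L₁ L₂ with hL
  have hb1 : ∀ y ∈ Metric.ball y₀ ε, ∀ y' ∈ Metric.ball y₀ ε,
      ‖fderiv ℝ w y' - fderiv ℝ w y‖ ≤ L * ‖y' - y‖ := fun y hy y' hy' ↦
    (hL₁.norm_sub_le (hball hy').1.1 (hball hy).1.1).trans <| by
      gcongr; exact le_max_left _ _
  have hb2 : ∀ y ∈ Metric.ball y₀ ε, ∀ y' ∈ Metric.ball y₀ ε,
      ‖fderiv ℝ (fderiv ℝ w) y' - fderiv ℝ (fderiv ℝ w) y‖ ≤ L * ‖y' - y‖ := fun y hy y' hy' ↦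
    (hL₂.norm_sub_le (hball hy').1.2 (hball hy).1.2).trans <| by
      gcongr; exact le_max_right _ _
  have hseg : ∀ {y y' : E}, y ∈ Metric.ball y₀ ε → y' ∈ Metric.ball y₀ ε →
      segment ℝ y y' ⊆ Metric.ball y₀ ε := fun h h' ↦
    (convex_ball y₀ ε).segment_subset h h'
  have hdw : ∀ z ∈ Metric.ball y₀ ε, DifferentiableAt ℝ w z := fun z hz ↦
    (hw.contDiffAt (hV.mem_nhds (hball hz).2)).differentiableAt (by simp)
  have hdD1 : ∀ z ∈ Metric.ball y₀ ε, DifferentiableAt ℝ (fderiv ℝ w) z := fun z hz ↦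
    (hD1.contDiffAt (hV.mem_nhds (hball hz).2)).differentiableAt (by simp)
  refine ⟨L, ε, hε, fun y hy ↦ (hball hy).2, fun y hy hy1 y' hy' ↦ ⟨?_, fun hy2 ↦ ?_⟩⟩
  · refine edist_le_of_norm_le_pow (norm_image_sub_le_pow L.2
      (fun z hz ↦ hdw z (hseg hy hy' hz)) fun z hz ↦ ?_)
    simpa [hy1] using hb1 y hy z (hseg hy hy' hz)
  · refine edist_le_of_norm_le_pow (norm_image_sub_le_pow L.2
      (fun z hz ↦ hdw z (hseg hy hy' hz)) fun z hz ↦ ?_)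
    have hz' := hseg hy hy' hz
    have := norm_image_sub_le_pow (k := 1) (f := fderiv ℝ w) (y := y) (y' := z) L.2
      (fun q hq ↦ hdD1 q (hseg hy hz' hq)) fun q hq ↦ by
        simpa [hy2] using hb2 y hy q (hseg hy hz' hq)
    simpa [hy1] using this

/-- By the mean value theorem a chord between two zeros is parallel to `levelDir v` at an
intermediate point, which is close to the one at `y₀`. Projection along that fixed direction is then
injective on the zeros with Lipschitz inverse, so no curve has to be parametrised. -/
lemma exists_nhds_dimH_zeroSet_le_one {v : Plane → ℝ} {V : Set Plane} (hV : IsOpen V)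
    (hv : ContDiffOn ℝ ∞ v V) {y₀ : Plane} (hy₀ : y₀ ∈ V) (h : fderiv ℝ v y₀ ≠ 0) :
    ∃ U ∈ 𝓝 y₀, dimH {y ∈ U | v y = 0} ≤ 1 := by
  have hVn := hV.mem_nhds hy₀
  set r := levelDir v with hr
  have hrc : ContinuousAt r y₀ :=
    (continuousOn_levelDir hV (hv.of_le (by norm_cast))).continuousAt hVn
  have hr0 : r y₀ ≠ 0 := levelDir_ne_zero h
  have hpos : 0 < inner ℝ (r y₀) (r y₀) := real_inner_self_pos.2 hr0
  have hev : ∀ᶠ z in 𝓝 y₀, inner ℝ (r y₀) (r y₀) / 2 < inner ℝ (r y₀) (r z) ∧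
      ‖r z‖ < ‖r y₀‖ + 1 :=
    ((continuousAt_const.inner hrc).eventually_const_lt (half_lt_self hpos)).and
      (hrc.norm.eventually_lt_const (lt_add_one _))
  obtain ⟨ε, hε, hball⟩ := Metric.eventually_nhds_iff_ball.1 (hev.and hVn)
  refine ⟨Metric.ball y₀ ε, Metric.ball_mem_nhds _ hε, ?_⟩
  -- The ratio of the upper bound for `‖r z‖` to the lower bound for `⟨r y₀, r z⟩` on the ball.
  set K : ℝ≥0 := NNReal.mk ((‖r y₀‖ + 1) / (inner ℝ (r y₀) (r y₀) / 2)) (by positivity) with hK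
  refine dimH_le_one_of_inner (v := r y₀) (K := K) fun y hy y' hy' ↦ ?_
  obtain ⟨z, hz, hz'⟩ := exists_fderiv_eq_zero (w := v) (convex_ball y₀ ε)
    (fun z hz ↦ (hv.contDiffAt (hV.mem_nhds (hball z hz).2)).differentiableAt (by simp))
    hy.1 hy'.1 (by rw [hy.2, hy'.2])
  have hzB := (convex_ball y₀ ε).segment_subset hy.1 hy'.1 hz
  obtain ⟨hz1, hz2⟩ := (hball z hzB).1
  have hid := congrArg norm (inner_levelDir_smul hz' (r y₀))
  rw [norm_smul, norm_smul, Real.norm_of_nonneg (by linarith), ← hr, inner_sub_right] at hid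
  have h1 : ‖y' - y‖ ≤ (K : ℝ) * ‖inner ℝ (r y₀) y' - inner ℝ (r y₀) y‖ ^ 1 := by
    rw [hK, NNReal.coe_mk, pow_one, div_mul_eq_mul_div, le_div_iff₀ (by positivity)]
    calc ‖y' - y‖ * (inner ℝ (r y₀) (r y₀) / 2)
        ≤ inner ℝ (r y₀) (r z) * ‖y' - y‖ := by
          rw [mul_comm]; gcongr
      _ ≤ _ := by
          rw [hid, mul_comm]; gcongr
  rw [edist_comm y, edist_comm (inner ℝ (r y₀) y), edist_eq_enorm_sub, edist_eq_enorm_sub,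
    enorm_eq_nnnorm, enorm_eq_nnnorm]
  rw [pow_one] at h1
  exact_mod_cast h1

/-- The critical values of a smooth function on an open subset of the plane are negligible. -/
theorem volume_image_critical_eq_zero {w : Plane → ℝ} {V : Set Plane} (hV : IsOpen V)
    (hw : ContDiffOn ℝ ∞ w V) : volume (w '' {y ∈ V | fderiv ℝ w y = 0}) = 0 := by
  set C := {y ∈ V | fderiv ℝ w y = 0} with hC
  -- Around a critical point with nonzero Hessian all nearby critical points are treated; around one
  -- with zero Hessian, only those whose Hessian vanishes as well.
  have hloc : ∀ y₀ ∈ C, ∃ U ∈ 𝓝 y₀, volume (w '' {y ∈ C ∩ U |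
      fderiv ℝ (fderiv ℝ w) y₀ ≠ 0 ∨ fderiv ℝ (fderiv ℝ w) y = 0}) = 0 := by
    intro y₀ hy₀
    obtain ⟨L, ε, hε, hεV, hball⟩ := exists_taylor_bounds hV hw hy₀.1
    -- Zero Hessian: exponent 3 on a set of dimension at most 2. Otherwise some `∂ᵢw` has nonzero
    -- differential at `y₀`, and the critical points nearby lie in its zero set: exponent 2 in
    -- dimension at most 1.
    by_cases hne : fderiv ℝ (fderiv ℝ w) y₀ = 0
    · refine ⟨Metric.ball y₀ ε, Metric.ball_mem_nhds _ hε, ?_⟩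
      refine volume_image_eq_zero_of_pow (d := 2) (k := 3) (L := L) ?_ (by norm_num) ?_
      · refine (dimH_mono (subset_univ _)).trans ?_
        rw [Real.dimH_univ_eq_finrank, finrank_euclideanSpace_fin]
      · rintro y ⟨hy, hy2⟩ y' ⟨hy', -⟩
        exact (hball y hy.2 hy.1.2 y' hy'.2).2 (hy2.resolve_left fun h ↦ h hne)
    obtain ⟨i, hi⟩ : ∃ i, fderiv ℝ (partialDeriv i w) y₀ ≠ 0 := by
      by_contra! hcon
      apply hne
      have hd : DifferentiableAt ℝ (fderiv ℝ w) y₀ :=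
        ((hw.fderiv_of_isOpen hV (m := ∞) (by simp)).contDiffAt
          (hV.mem_nhds hy₀.1)).differentiableAt (by simp)
      have h1 : ∀ i v, fderiv ℝ (fderiv ℝ w) y₀ v (EuclideanSpace.single i 1) = 0 := by
        intro i v
        have h2 : fderiv ℝ (fun z ↦ fderiv ℝ w z (EuclideanSpace.single i 1)) y₀ v = 0 := by
          change fderiv ℝ (partialDeriv i w) y₀ v = 0
          rw [hcon i]; rfl
        rw [fderiv_clm_apply hd (by fun_prop)] at h2
        simpa using h2
      ext v v'
      rw [sum_coord_smul_single v', map_sum]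
      simp [h1]
    obtain ⟨U, hU, hdim⟩ := exists_nhds_dimH_zeroSet_le_one hV
      (contDiffOn_partialDeriv hV (m := ∞) (by simp) hw i) hy₀.1 hi
    refine ⟨U ∩ Metric.ball y₀ ε, inter_mem hU (Metric.ball_mem_nhds _ hε), ?_⟩
    refine volume_image_eq_zero_of_pow (d := 1) (k := 2) (L := L) ?_ (by norm_num) ?_
    · rw [Nat.cast_one]
      refine (dimH_mono ?_).trans hdim
      rintro y ⟨hy, -⟩
      refine ⟨hy.2.1, ?_⟩
      rw [partialDeriv, hy.1.2]; rfl
    · rintro y ⟨hy, -⟩ y' ⟨hy', -⟩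
      exact (hball y hy.2.2 hy.1.2 y' hy'.2.2).1
  choose! U hU hUnull using hloc
  -- The nondegenerate critical points need their own countable cover, centred at nondegenerate
  -- points: neighbourhoods of degenerate centres do not control them.
  set C₁ := {y ∈ C | fderiv ℝ (fderiv ℝ w) y ≠ 0}
  obtain ⟨t₁, ht₁, htc₁, hcov₁⟩ := TopologicalSpace.countable_cover_nhdsWithin
    (f := U) (s := C₁) fun y hy ↦ mem_nhdsWithin_of_mem_nhds (hU y hy.1)
  obtain ⟨t, ht, htc, hcov⟩ := TopologicalSpace.countable_cover_nhdsWithin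
    (f := U) (s := C) fun y hy ↦ mem_nhdsWithin_of_mem_nhds (hU y hy)
  have hnull : volume (⋃ y₀ ∈ t₁ ∪ t, w '' {y ∈ C ∩ U y₀ |
      fderiv ℝ (fderiv ℝ w) y₀ ≠ 0 ∨ fderiv ℝ (fderiv ℝ w) y = 0}) = 0 :=
    (measure_biUnion_null_iff (htc₁.union htc)).2 fun y₀ hy₀ ↦
      hUnull y₀ (hy₀.elim (fun h ↦ (ht₁ h).1) fun h ↦ ht h)
  refine measure_mono_null ?_ hnull
  rintro _ ⟨y, hy, rfl⟩
  by_cases h : fderiv ℝ (fderiv ℝ w) y = 0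
  · obtain ⟨y₀, hy₀, hyU⟩ := mem_iUnion₂.1 (hcov hy)
    exact mem_biUnion (Or.inr hy₀) ⟨y, ⟨⟨hy, hyU⟩, Or.inr h⟩, rfl⟩
  · obtain ⟨y₀, hy₀, hyU⟩ := mem_iUnion₂.1 (hcov₁ ⟨hy, h⟩)
    exact mem_biUnion (Or.inl hy₀) ⟨y, ⟨⟨hy, hyU⟩, Or.inl (ht₁ hy₀).2⟩, rfl⟩

end Sard

/-! ### Riemannian distance and chart segments. -/

section EDist

variable {M : Type*} [EMetricSpace M] [ChartedSpace Plane M] [IsManifold (𝓡 2) ∞ M]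
  [RiemannianBundle (fun x : M ↦ TangentSpace (𝓡 2) x)]

lemma norm_sq_mfderiv_symm (x : M) (y v : Plane) :
    ‖(mfderiv 𝓘(ℝ, Plane) (𝓡 2) (extChartAt (𝓡 2) x).symm y v :
      TangentSpace (𝓡 2) ((extChartAt (𝓡 2) x).symm y))‖ ^ 2 = chartMetric x y v v :=
  (real_inner_self_eq_norm_sq (F := TangentSpace (𝓡 2) ((extChartAt (𝓡 2) x).symm y)) _).symm

/-- The Riemannian distance is bounded by the length of segments in a chart. -/
lemma edist_symm_le [IsRiemannianManifold (𝓡 2) M] (x : M) {y y' : Plane}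
    (hseg : segment ℝ y y' ⊆ (extChartAt (𝓡 2) x).target) {S : ℝ} (hS0 : 0 ≤ S)
    (hS : ∀ z ∈ segment ℝ y y', chartMetric x z (y' - y) (y' - y) ≤ S ^ 2) :
    edist ((extChartAt (𝓡 2) x).symm y) ((extChartAt (𝓡 2) x).symm y') ≤ ENNReal.ofReal S := by
  set η : ℝ → Plane := fun t ↦ y + t • (y' - y) with hη
  set γ : ℝ → M := (extChartAt (𝓡 2) x).symm ∘ η with hγ
  have hmaps : MapsTo η (Icc 0 1) (segment ℝ y y') := fun t ht ↦ by
    rw [segment_eq_image']; exact ⟨t, ht, rfl⟩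
  have hηs : ContMDiff 𝓘(ℝ, ℝ) 𝓘(ℝ, Plane) 1 η := by
    rw [contMDiff_iff_contDiff]; fun_prop
  have hle : riemannianEDist (𝓡 2) ((extChartAt (𝓡 2) x).symm y) ((extChartAt (𝓡 2) x).symm y') ≤
      pathELength (𝓡 2) γ 0 1 := by
    refine riemannianEDist_le_pathELength ?_ (by simp [hγ, hη]) (by simp [hγ, hη]) zero_le_one
    exact ((contMDiffOn_extChartAt_symm (I := 𝓡 2) (n := ∞) x).of_le (by norm_cast)).comp
      hηs.contMDiffOn fun t ht ↦ hseg (hmaps ht)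
  rw [IsRiemannianManifold.out (I := 𝓡 2)]
  refine hle.trans ?_
  rw [pathELength_eq_lintegral_mfderiv_Ioo]
  have hb : ∀ t ∈ Ioo (0 : ℝ) 1, ‖mfderiv 𝓘(ℝ, ℝ) (𝓡 2) γ t 1‖ₑ ≤ ENNReal.ofReal S := by
    intro t ht
    have hz := hmaps (Ioo_subset_Icc_self ht)
    have hd : HasDerivAt η (y' - y) t := by
      have := ((hasDerivAt_id t).smul_const (y' - y)).const_add y
      rwa [one_smul] at this
    have h1 := (mdifferentiableAt_symm x (hseg hz)).hasMFDerivAt.comp t hd.hasFDerivAt.hasMFDerivAt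
    have h2 : mfderiv 𝓘(ℝ, ℝ) (𝓡 2) γ t 1 =
        mfderiv 𝓘(ℝ, Plane) (𝓡 2) (extChartAt (𝓡 2) x).symm (η t) (y' - y) := by
      rw [h1.mfderiv]
      change mfderiv 𝓘(ℝ, Plane) (𝓡 2) (extChartAt (𝓡 2) x).symm (η t)
        ((1 : ℝ) • (y' - y)) = _
      rw [one_smul]
    have h3 : ‖mfderiv 𝓘(ℝ, ℝ) (𝓡 2) γ t 1‖ ^ 2 ≤ S ^ 2 := by
      rw [h2]
      exact (norm_sq_mfderiv_symm x (η t) (y' - y)).trans_le (hS _ hz)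
    rw [← ofReal_norm]
    exact ENNReal.ofReal_le_ofReal (le_of_sq_le_sq h3 hS0)
  refine (setLIntegral_mono' measurableSet_Ioo hb).trans ?_
  simp

end EDist

/-! ### Sard's theorem on a surface. -/

section SardSurface

variable {M : Type*} [TopologicalSpace M] [SecondCountableTopology M] [ChartedSpace Plane M]
  [IsManifold (𝓡 2) ∞ M]

/-- The derivative of `u` at `p`, in the preferred chart around `p`. -/
def derivAt (u : M → ℝ) (p : M) : Plane →L[ℝ] ℝ :=
  fderiv ℝ (u ∘ (extChartAt (𝓡 2) p).symm) (extChartAt (𝓡 2) p p)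

variable (M) in
lemma exists_countable_charts :
    ∃ s : Set M, s.Countable ∧ ⋃ x ∈ s, (extChartAt (𝓡 2) x).source = univ :=
  TopologicalSpace.countable_cover_nhds fun x ↦ extChartAt_source_mem_nhds x

/-- The critical values of a smooth function on an open subset of a surface are negligible. -/
theorem volume_image_derivAt_eq_zero {u : M → ℝ} {Ω : Set M} (hΩ : IsOpen Ω)
    (hu : ContMDiffOn (𝓡 2) 𝓘(ℝ, ℝ) ∞ u Ω) :
    volume (u '' {p ∈ Ω | derivAt u p = 0}) = 0 := by
  obtain ⟨s, hs, hcov⟩ := exists_countable_charts M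
  have hnull : volume (⋃ x ∈ s, (u ∘ (extChartAt (𝓡 2) x).symm) ''
      {y ∈ (extChartAt (𝓡 2) x).target ∩ (extChartAt (𝓡 2) x).symm ⁻¹' Ω |
        fderiv ℝ (u ∘ (extChartAt (𝓡 2) x).symm) y = 0}) = 0 :=
    (measure_biUnion_null_iff hs).2 fun x _ ↦ volume_image_critical_eq_zero
      (isOpen_symm_preimage x hΩ) (contDiffOn_comp_symm x hΩ le_rfl hu)
  refine measure_mono_null ?_ hnull
  rintro _ ⟨p, ⟨hpΩ, hp⟩, rfl⟩
  obtain ⟨x, hx, hpx⟩ := mem_iUnion₂.1 (hcov.ge (mem_univ p))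
  have hinv := (extChartAt (𝓡 2) x).left_inv hpx
  refine mem_biUnion hx ⟨extChartAt (𝓡 2) x p, ⟨⟨(extChartAt (𝓡 2) x).map_source hpx, ?_⟩, ?_⟩, ?_⟩
  · rw [mem_preimage, hinv]; exact hpΩ
  · rw [fderiv_comp_symm_transition (x' := p)
      (mem_overlap_of_mem_source hpx (mem_extChartAt_source p)), transition, hinv]
    · rw [show fderiv ℝ (u ∘ (extChartAt (𝓡 2) p).symm) (extChartAt (𝓡 2) p p) = 0 from hp,
        ContinuousLinearMap.zero_comp]
    · rw [hinv]
      exact (hu.contMDiffAt (hΩ.mem_nhds hpΩ)).of_le (by norm_cast)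
  · rw [Function.comp, hinv]

end SardSurface

/-! ### Fubini for horizontal slices of the plane. -/

section Slices

/-- Coordinates on the plane, as a measurable equivalence. -/
def planeEquiv : Plane ≃ᵐ ℝ × ℝ :=
  (MeasurableEquiv.toLp 2 (Fin 2 → ℝ)).symm.trans MeasurableEquiv.finTwoArrow

lemma measurePreserving_planeEquiv : MeasurePreserving planeEquiv :=
  (PiLp.volume_preserving_ofLp (Fin 2)).trans (volume_preserving_finTwoArrow ℝ)

lemma planeEquiv_apply (y : Plane) : planeEquiv y = (y 0, y 1) := rfl

lemma planeEquiv_symm_apply (a t : ℝ) : planeEquiv.symm (a, t) = !₂[a, t] := by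
  rw [MeasurableEquiv.symm_apply_eq, planeEquiv_apply]
  simp

/-- The horizontal slice of a subset of the plane at height `t`. -/
def slice (S : Set Plane) (t : ℝ) : Set ℝ := {a | !₂[a, t] ∈ S}

lemma slice_eq (S : Set Plane) (t : ℝ) :
    slice S t = (fun a ↦ (a, t)) ⁻¹' (planeEquiv.symm ⁻¹' S) := by
  ext a; simp [slice, planeEquiv_symm_apply]

lemma measurable_volume_slice {S : Set Plane} (hS : MeasurableSet S) :
    Measurable fun t ↦ volume (slice S t) := by
  simp only [slice_eq]
  exact measurable_measure_prodMk_right (planeEquiv.symm.measurable hS)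

lemma lintegral_volume_slice {S : Set Plane} (hS : MeasurableSet S) :
    ∫⁻ t, volume (slice S t) = volume S := by
  simp only [slice_eq]
  rw [← Measure.prod_apply_symm (planeEquiv.symm.measurable hS)]
  exact (measurePreserving_planeEquiv.symm _).measure_preimage hS.nullMeasurableSet

lemma setLIntegral_volume_slice {S : Set Plane} (hS : MeasurableSet S) {B : Set ℝ}
    (hB : MeasurableSet B) :
    ∫⁻ t in B, volume (slice S t) = volume (S ∩ {y | y 1 ∈ B}) := by
  have hm : MeasurableSet {y : Plane | y 1 ∈ B} := by
    have : Measurable fun y : Plane ↦ y 1 := (measurable_snd.comp planeEquiv.measurable)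
    exact this hB
  rw [← lintegral_volume_slice (hS.inter hm), ← lintegral_indicator hB]
  congr 1
  ext t
  by_cases ht : t ∈ B
  · rw [indicator_of_mem ht]
    congr 1
    ext a
    simp [slice, ht]
  · rw [indicator_of_notMem ht]
    have : slice (S ∩ {y | y 1 ∈ B}) t = ∅ := by
      ext a
      simp [slice, ht]
    rw [this, measure_empty]

end Slices

/-! ### The coarea inequality for level lines. -/

section Coarea

lemma measurableSet_inter_preimage_of_continuousOn {X : Type*} [TopologicalSpace X]
    [MeasurableSpace X] [BorelSpace X] {u : X → ℝ} {Ω D : Set X} (hΩ : IsOpen Ω)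
    (hu : ContinuousOn u Ω) (hD : MeasurableSet D) (hDΩ : D ⊆ Ω) {B : Set ℝ}
    (hB : MeasurableSet B) : MeasurableSet (D ∩ u ⁻¹' B) := by
  have h := hΩ.measurableSet.subtype_image (hu.domRestrict.measurable hB)
  have h2 : D ∩ u ⁻¹' B = D ∩ (Subtype.val '' (Ω.domRestrict u ⁻¹' B)) := by
    ext p
    constructor
    · exact fun hp ↦ ⟨hp.1, ⟨p, hDΩ hp.1⟩, hp.2, rfl⟩
    · rintro ⟨hp, q, hq, rfl⟩
      exact ⟨hp, hq⟩
  rw [h2]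
  exact hD.inter h

/-- The map `y ↦ (⟨v, y⟩, w y)`. -/
def straighten (v : Plane) (w : Plane → ℝ) (y : Plane) : Plane :=
  !₂[inner ℝ v y, w y]

/-- The derivative of `straighten v w`. -/
def straightenDeriv (v : Plane) (w : Plane → ℝ) (y : Plane) : Plane →L[ℝ] Plane :=
  (PiLp.continuousLinearEquiv 2 ℝ (fun _ : Fin 2 ↦ ℝ)).symm.toContinuousLinearMap.comp
    (ContinuousLinearMap.pi ![innerSL ℝ v, fderiv ℝ w y])

lemma hasFDerivAt_straighten (v : Plane) {w : Plane → ℝ} {y : Plane}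
    (hw : DifferentiableAt ℝ w y) :
    HasFDerivAt (straighten v w) (straightenDeriv v w y) y := by
  refine (PiLp.continuousLinearEquiv 2 ℝ (fun _ : Fin 2 ↦ ℝ)).symm.hasFDerivAt.comp y
    (f := fun y ↦ ![inner ℝ v y, w y]) ?_
  rw [hasFDerivAt_pi]
  intro i
  fin_cases i
  · exact (innerSL ℝ v).hasFDerivAt
  · exact hw.hasFDerivAt

/-- The Jacobian of the straightening map is the quantity that compares `⟨v, ·⟩` with arc length
along the level lines, which is what makes the coarea constant close to `1`. -/
lemma det_straightenDeriv (v : Plane) (w : Plane → ℝ) (y : Plane) :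
    (straightenDeriv v w y).det = - inner ℝ v (levelDir w y) := by
  rw [det_eq_of_matrix, Matrix.det_fin_two]
  simp [straightenDeriv, levelDir, PiLp.inner_apply, Fin.sum_univ_two, partialDeriv]
  ring

lemma lintegral_of_subset_source {M : Type*} [TopologicalSpace M] [ChartedSpace Plane M]
    [IsManifold (𝓡 2) ∞ M] [RiemannianBundle (fun x : M ↦ TangentSpace (𝓡 2) x)]
    [MeasurableSpace M] [BorelSpace M]
    [IsContMDiffRiemannianBundle (𝓡 2) ∞ Plane (fun x : M ↦ TangentSpace (𝓡 2) x)]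
    (x : M) {F : M → ℝ≥0∞} (hF : Measurable F) {S : Set M} (hS : MeasurableSet S)
    (hsub : S ⊆ (extChartAt (𝓡 2) x).source) :
    ∫⁻ p in S, F p ∂(area M) =
      ∫⁻ y in (extChartAt (𝓡 2) x).target ∩ (extChartAt (𝓡 2) x).symm ⁻¹' S,
        ENNReal.ofReal (areaDensity x y) * F ((extChartAt (𝓡 2) x).symm y) := by
  have h := lintegral_source x (hF.indicator hS)
  rw [setLIntegral_indicator hS, inter_eq_left.2 hsub] at h
  rw [h, ← lintegral_indicator (measurableSet_target x),
    ← lintegral_indicator (measurableSet_symm_preimage x hS)]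
  congr 1
  ext y
  by_cases hy : y ∈ (extChartAt (𝓡 2) x).target
  · by_cases hy' : (extChartAt (𝓡 2) x).symm y ∈ S
    · rw [indicator_of_mem hy, indicator_of_mem hy', 
        indicator_of_mem (show y ∈ (extChartAt (𝓡 2) x).target ∩ _ from ⟨hy, hy'⟩)]
    · rw [indicator_of_mem hy, indicator_of_notMem hy', indicator_of_notMem fun h ↦ hy' h.2,
        mul_zero]
  · rw [indicator_of_notMem hy, indicator_of_notMem fun h ↦ hy h.1]

variable {M : Type*} [EMetricSpace M] [ChartedSpace Plane M] [IsManifold (𝓡 2) ∞ M]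
  [RiemannianBundle (fun x : M ↦ TangentSpace (𝓡 2) x)]
  [IsContMDiffRiemannianBundle (𝓡 2) ∞ Plane (fun x : M ↦ TangentSpace (𝓡 2) x)]
  [MeasurableSpace M] [BorelSpace M]

/-- The norm of the gradient of `u` in `Ω`, extended by zero. -/
def gradNorm (Ω : Set M) (u : M → ℝ) : M → ℝ :=
  Ω.indicator fun p ↦ √(gradInner u u p)

lemma measurable_gradNorm {u : M → ℝ} {Ω : Set M} (hΩ : IsOpen Ω)
    (hu : ContMDiffOn (𝓡 2) 𝓘(ℝ, ℝ) 1 u Ω) : Measurable (gradNorm Ω u) := by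
  classical
  rw [gradNorm, ← piecewise_eq_indicator]
  exact (continuousOn_gradInner hΩ hu hu).sqrt.measurable_piecewise continuousOn_const
    hΩ.measurableSet

/-- Local coarea inequality: near a regular point, the lengths of the level lines of `u` in a set `D`
are bounded by a function of integral at most `c ∫_D |∇u|`, for any `c > 1`. -/
lemma exists_nhds_coarea_le [IsRiemannianManifold (𝓡 2) M] {u : M → ℝ} {Ω : Set M} (hΩ : IsOpen Ω)
    (hu : ContMDiffOn (𝓡 2) 𝓘(ℝ, ℝ) ∞ u Ω) {p : M} (hp : p ∈ Ω) (hreg : derivAt u p ≠ 0)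
    {c : ℝ} (hc : 1 < c) :
    ∃ U : Set M, IsOpen U ∧ p ∈ U ∧ U ⊆ Ω ∧ ∀ D ⊆ U, MeasurableSet D → ∃ L : ℝ → ℝ≥0∞,
      Measurable L ∧ (∀ t, μH[1] (D ∩ u ⁻¹' {t}) ≤ L t) ∧ ∀ B, MeasurableSet B →
        ∫⁻ t in B, L t ≤ ENNReal.ofReal c *
          ∫⁻ q in D ∩ u ⁻¹' B, ENNReal.ofReal (gradNorm Ω u q) ∂(area M) := by
  have hu1 : ContMDiffOn (𝓡 2) 𝓘(ℝ, ℝ) 1 u Ω := hu.of_le (by norm_cast)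
  set e := extChartAt (𝓡 2) p with he
  set y₀ := e p with hy₀
  set V := e.target ∩ e.symm ⁻¹' Ω with hVdef
  have hV : IsOpen V := isOpen_symm_preimage p hΩ
  set w := u ∘ e.symm with hw
  have hwV : ContDiffOn ℝ ∞ w V := contDiffOn_comp_symm p hΩ le_rfl hu
  set r := levelDir w with hr
  have hrV : ContinuousOn r V := continuousOn_levelDir hV (hwV.of_le (by norm_cast))
  have hy₀V : y₀ ∈ V := ⟨mem_extChartAt_target p, by
    rw [mem_preimage, hy₀, he, extChartAt_to_inv]; exact hp⟩
  set v := r y₀ with hv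
  have hv0 : v ≠ 0 := levelDir_ne_zero hreg
  have hvv : 0 < inner ℝ v v := real_inner_self_pos.2 hv0
  -- The Riemannian length, measured at the first point, of the level direction at the second. The
  -- two points are kept apart because the metric varies along a chord while the mean value theorem
  -- gives the direction at a single point.
  set Q : Plane × Plane → ℝ := fun q ↦ √(chartMetric p q.1 (r q.2) (r q.2)) with hQ
  have hQc : ContinuousOn Q (V ×ˢ V) := by
    refine ContinuousOn.sqrt ?_
    exact (continuousOn_chartMetric p).comp
      (continuousOn_fst.prodMk (hrV.comp continuousOn_snd fun q hq ↦ hq.2))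
      fun q hq ↦ ⟨hq.1.1, mem_univ _⟩
  have hQat : ContinuousAt Q (y₀, y₀) := hQc.continuousAt ((hV.prod hV).mem_nhds ⟨hy₀V, hy₀V⟩)
  have hrat : ContinuousAt r y₀ := hrV.continuousAt (hV.mem_nhds hy₀V)
  have hQ0 : 0 < Q (y₀, y₀) := Real.sqrt_pos.2 (chartMetric_self_pos p hy₀V.1 hv0)
  -- Chosen so that `K⟨v, v⟩` lies strictly between `Q(y₀, y₀)` and `c Q(y₀, y₀)`. By continuity
  -- both inequalities persist on a small ball: the first yields the Lipschitz constant `K`, the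
  -- second the factor `c`.
  set K : ℝ := (1 + c) / 2 * Q (y₀, y₀) / inner ℝ v v with hK
  have hK0 : 0 < K := by positivity
  have hKv : K * inner ℝ v v = (1 + c) / 2 * Q (y₀, y₀) := by
    rw [hK]; field_simp
  obtain ⟨ε, hε, hball⟩ : ∃ ε > 0, ∀ z ∈ Metric.ball y₀ ε, ∀ z' ∈ Metric.ball y₀ ε,
      z ∈ V ∧ 0 < inner ℝ v (r z) ∧ Q (z, z') ≤ K * inner ℝ v (r z') ∧
        K * inner ℝ v (r z) ≤ c * Q (z, z) := by
    have hin : ContinuousAt (fun z ↦ inner ℝ v (r z)) y₀ := continuousAt_const.inner hrat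
    have e1 : ∀ᶠ z in 𝓝 y₀, 0 < inner ℝ v (r z) := hin.eventually_const_lt hvv
    have e2 : ∀ᶠ z in 𝓝 y₀, K * inner ℝ v (r z) < c * Q (z, z) := by
      refine ContinuousAt.eventually_lt (continuousAt_const.mul hin) (continuousAt_const.mul
        (ContinuousAt.comp (f := fun z ↦ (z, z)) hQat (by fun_prop))) ?_
      rw [hKv]; nlinarith
    have e3 : ∀ᶠ q in 𝓝 (y₀, y₀), Q q < K * inner ℝ v (r q.2) := by
      have hin2 : ContinuousAt (fun q : Plane × Plane ↦ inner ℝ v (r q.2)) (y₀, y₀) :=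
        ContinuousAt.comp (x := (y₀, y₀)) (g := fun z ↦ inner ℝ v (r z)) hin continuousAt_snd
      refine ContinuousAt.eventually_lt hQat (continuousAt_const.mul hin2) ?_
      rw [hKv]; nlinarith
    obtain ⟨ε₁, hε₁, hb₁⟩ := Metric.eventually_nhds_iff_ball.1
      ((e1.and e2).and (hV.mem_nhds hy₀V))
    obtain ⟨ε₂, hε₂, hb₂⟩ := Metric.eventually_nhds_iff_ball.1 e3
    refine ⟨min ε₁ ε₂, lt_min hε₁ hε₂, fun z hz z' hz' ↦ ?_⟩
    have h1 := hb₁ z (Metric.ball_subset_ball (min_le_left _ _) hz)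
    have h2 := hb₂ (z, z') (by
      rw [← ball_prod_same]
      exact ⟨Metric.ball_subset_ball (min_le_right _ _) hz,
        Metric.ball_subset_ball (min_le_right _ _) hz'⟩)
    exact ⟨h1.2, h1.1.1, h2.le, h1.1.2.le⟩
  have hbV : ∀ z ∈ Metric.ball y₀ ε, z ∈ V := fun z hz ↦ (hball z hz z hz).1
  have hdw : ∀ z ∈ Metric.ball y₀ ε, DifferentiableAt ℝ w z := fun z hz ↦
    (hwV.contDiffAt (hV.mem_nhds (hbV z hz))).differentiableAt (by simp)
  -- On one level, `⟨v, ·⟩` is a parameter in which distances grow at rate at most `K`: the chord is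
  -- parallel to the level direction at some `z'`, and its length is measured by `Q(z, z')` along
  -- the segment.
  have hdist : ∀ y ∈ Metric.ball y₀ ε, ∀ y' ∈ Metric.ball y₀ ε, w y = w y' →
      edist (e.symm y) (e.symm y') ≤ ENNReal.ofReal (K * |inner ℝ v y' - inner ℝ v y|) := by
    intro y hy y' hy' hww
    have hseg : segment ℝ y y' ⊆ Metric.ball y₀ ε := (convex_ball y₀ ε).segment_subset hy hy'
    obtain ⟨z', hz', hz'0⟩ := exists_fderiv_eq_zero (convex_ball y₀ ε) hdw hy hy' hww
    have hpos := (hball z' (hseg hz') z' (hseg hz')).2.1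
    refine edist_symm_le p (fun z hz ↦ (hbV z (hseg hz)).1) (by positivity) fun z hz ↦ ?_
    have hid := inner_levelDir_smul hz'0 v
    rw [← hr, inner_sub_right] at hid
    set a := inner ℝ v y' - inner ℝ v y with ha
    have h1 : inner ℝ v (r z') ^ 2 * chartMetric p z (y' - y) (y' - y) =
        a ^ 2 * chartMetric p z (r z') (r z') := by
      have := congrArg (fun q ↦ chartMetric p z q q) hid
      simp only [chartMetric_smul_left, chartMetric_smul_right] at this
      linarith
    have h2 := (hball z (hseg hz) z' (hseg hz')).2.2.1
    have h3 : chartMetric p z (r z') (r z') ≤ (K * inner ℝ v (r z')) ^ 2 :=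
      Real.sqrt_le_left (by positivity) |>.1 h2
    rw [mul_pow, sq_abs]
    have h4 : inner ℝ v (r z') ^ 2 * chartMetric p z (y' - y) (y' - y) ≤
        inner ℝ v (r z') ^ 2 * (K ^ 2 * a ^ 2) := by
      rw [h1]
      nlinarith [mul_le_mul_of_nonneg_left h3 (sq_nonneg a)]
    exact le_of_mul_le_mul_left h4 (by positivity)
  set Ψ := straighten v w with hΨ
  have hΨ0 : ∀ y, (Ψ y) 0 = inner ℝ v y := fun y ↦ rfl
  have hΨ1 : ∀ y, (Ψ y) 1 = w y := fun y ↦ rfl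
  have hinj : InjOn Ψ (Metric.ball y₀ ε) := by
    intro y hy y' hy' hyy
    have h0 : inner ℝ v y = inner ℝ v y' := by rw [← hΨ0, hyy, hΨ0]
    have h1 : w y = w y' := by rw [← hΨ1, hyy, hΨ1]
    have h := hdist y hy y' hy' h1
    rw [h0, sub_self, abs_zero, mul_zero, ENNReal.ofReal_zero] at h
    have h2 := edist_le_zero.1 h
    rw [← e.right_inv (hbV y hy).1, h2, e.right_inv (hbV y' hy').1]
  refine ⟨e.source ∩ e ⁻¹' Metric.ball y₀ ε, (continuousOn_extChartAt p).isOpen_inter_preimage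
    (isOpen_extChartAt_source p) Metric.isOpen_ball, ⟨mem_extChartAt_source p,
      Metric.mem_ball_self hε⟩, ?_, fun D hDU hD ↦ ?_⟩
  · intro q hq
    have := (hbV _ hq.2).2
    rwa [mem_preimage, e.left_inv hq.1] at this
  have hDΩ : D ⊆ Ω := fun q hq ↦ by
    have := (hbV _ (hDU hq).2).2
    rwa [mem_preimage, e.left_inv (hDU hq).1] at this
  have hT : ∀ A ⊆ D, ∀ y ∈ e.target ∩ e.symm ⁻¹' A, y ∈ Metric.ball y₀ ε := fun A hA y hy ↦ by
    have := (hDU (hA hy.2)).2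
    rwa [mem_preimage, e.right_inv hy.1] at this
  set T := e.target ∩ e.symm ⁻¹' D with hTdef
  have hTm : MeasurableSet T := measurableSet_symm_preimage p hD
  have hTb : ∀ y ∈ T, y ∈ Metric.ball y₀ ε := hT D le_rfl
  have hΨd : ∀ y ∈ Metric.ball y₀ ε, HasFDerivAt Ψ (straightenDeriv v w y) y := fun y hy ↦
    hasFDerivAt_straighten v (hdw y hy)
  have hSm : MeasurableSet (Ψ '' T) := measurable_image_of_fderivWithin hTm
    (fun y hy ↦ (hΨd y (hTb y hy)).hasFDerivWithinAt) (hinj.mono hTb)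
  -- Straightened, the part of the level `t` in `D` becomes a slice of `Ψ '' T`, and it is the image
  -- of that slice under a `K`-Lipschitz map.
  refine ⟨fun t ↦ ENNReal.ofReal K * volume (slice (Ψ '' T) t),
    (measurable_volume_slice hSm).const_mul _, fun t ↦ ?_, fun B hB ↦ ?_⟩
  · set g : ℝ → Plane := fun a ↦ Function.invFunOn Ψ T !₂[a, t] with hg
    have hgT : ∀ a ∈ slice (Ψ '' T) t, g a ∈ T ∧ Ψ (g a) = !₂[a, t] := fun a ha ↦
      ⟨Function.invFunOn_mem ha, Function.invFunOn_eq ha⟩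
    have hg0 : ∀ a ∈ slice (Ψ '' T) t, inner ℝ v (g a) = a := fun a ha ↦ by
      rw [← hΨ0, (hgT a ha).2]; rfl
    have hg1 : ∀ a ∈ slice (Ψ '' T) t, w (g a) = t := fun a ha ↦ by
      rw [← hΨ1, (hgT a ha).2]; rfl
    have hlip : LipschitzOnWith K.toNNReal (e.symm ∘ g) (slice (Ψ '' T) t) := by
      intro a ha a' ha'
      refine (hdist _ (hTb _ (hgT a ha).1) _ (hTb _ (hgT a' ha').1)
        (by rw [hg1 a ha, hg1 a' ha'])).trans_eq ?_
      rw [hg0 a ha, hg0 a' ha', ENNReal.ofReal_mul hK0.le, edist_comm, edist_dist,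
        Real.dist_eq]
      rfl
    have hsub : D ∩ u ⁻¹' {t} ⊆ (e.symm ∘ g) '' slice (Ψ '' T) t := by
      rintro q ⟨hqD, hqt⟩
      have hqs := (hDU hqD).1
      have hqT : e q ∈ T := ⟨e.map_source hqs, by rw [mem_preimage, e.left_inv hqs]; exact hqD⟩
      have hΨq : Ψ (e q) = !₂[inner ℝ v (e q), t] := by
        ext i
        fin_cases i
        · rfl
        · change w (e q) = t
          rw [hw, Function.comp, e.left_inv hqs]; exact hqt
      have ha : inner ℝ v (e q) ∈ slice (Ψ '' T) t := ⟨e q, hqT, hΨq⟩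
      refine ⟨inner ℝ v (e q), ha, ?_⟩
      have h1 : g (inner ℝ v (e q)) = e q :=
        hinj (hTb _ (hgT _ ha).1) (hTb _ hqT) ((hgT _ ha).2.trans hΨq.symm)
      rw [Function.comp, h1, e.left_inv hqs]
    refine (measure_mono hsub).trans ?_
    have := hlip.hausdorffMeasure_image_le zero_le_one
    rwa [hausdorffMeasure_real, ENNReal.rpow_one] at this
  · have hAm : MeasurableSet (D ∩ u ⁻¹' B) :=
      measurableSet_inter_preimage_of_continuousOn hΩ hu.continuousOn hD hDΩ hB
    set T' := e.target ∩ e.symm ⁻¹' (D ∩ u ⁻¹' B) with hT'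
    have hT'm : MeasurableSet T' := measurableSet_symm_preimage p hAm
    have hT'b : ∀ y ∈ T', y ∈ Metric.ball y₀ ε := hT _ inter_subset_left
    -- Since the second coordinate of `Ψ` is `w`, restricting heights to `B` amounts to restricting
    -- `D` to `u ⁻¹' B`. Fubini and the change of variables by `Ψ` then give the integral of `L`.
    have himg : Ψ '' T ∩ {y | y 1 ∈ B} = Ψ '' T' := by
      ext z
      constructor
      · rintro ⟨⟨y, hy, rfl⟩, hz⟩
        exact ⟨y, ⟨hy.1, hy.2, hz⟩, rfl⟩
      · rintro ⟨y, hy, rfl⟩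
        exact ⟨⟨y, ⟨hy.1, hy.2.1⟩, rfl⟩, hy.2.2⟩
    rw [lintegral_const_mul _ (measurable_volume_slice hSm), setLIntegral_volume_slice hSm hB, himg,
      ← lintegral_abs_det_fderiv_eq_addHaar_image volume hT'm
        (fun y hy ↦ (hΨd y (hT'b y hy)).hasFDerivWithinAt) (hinj.mono hT'b),
      lintegral_of_subset_source p (measurable_gradNorm hΩ hu1).ennreal_ofReal hAm
        (fun q hq ↦ (hDU hq.1).1),
      ← lintegral_const_mul' _ _ ENNReal.ofReal_ne_top,
      ← lintegral_const_mul' _ _ ENNReal.ofReal_ne_top]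
    refine setLIntegral_mono' hT'm fun y hy ↦ ?_
    have hyb := hT'b y hy
    obtain ⟨hyV, hpos, -, hle⟩ := hball y hyb y hyb
    have hd := areaDensity_pos p hyV.1
    rw [det_straightenDeriv, abs_neg, ← hr, abs_of_pos hpos, ← ENNReal.ofReal_mul hK0.le,
      ← ENNReal.ofReal_mul hd.le, ← ENNReal.ofReal_mul (by linarith)]
    refine ENNReal.ofReal_le_ofReal (hle.trans_eq ?_)
    have hgn : gradNorm Ω u (e.symm y) = √(chartGradInner p u u y) := by
      rw [gradNorm, indicator_of_mem (show e.symm y ∈ Ω from hyV.2),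
        gradInner_eq_chartGradInner (x := p)
        (e.map_target hyV.1) (hu1.contMDiffAt (hΩ.mem_nhds hyV.2))
        (hu1.contMDiffAt (hΩ.mem_nhds hyV.2)), ← he, e.right_inv hyV.1]
    have hQy : Q (y, y) = √(areaDensity p y ^ 2 * chartGradInner p u u y) := by
      rw [areaDensity_sq_mul_chartGradInner_self hyV.1]
    rw [hQy, Real.sqrt_mul (sq_nonneg _), Real.sqrt_sq hd.le, ← hgn]

variable [SecondCountableTopology M] [IsRiemannianManifold (𝓡 2) M]

/-- Coarea inequality: the lengths of the level lines of `u` in the set of regular points are bounded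
by a function of integral at most `c ∫ |∇u|`, for any `c > 1`. -/
theorem exists_coarea_le {u : M → ℝ} {Ω : Set M} (hΩ : IsOpen Ω)
    (hu : ContMDiffOn (𝓡 2) 𝓘(ℝ, ℝ) ∞ u Ω) {c : ℝ} (hc : 1 < c) :
    ∃ L : ℝ → ℝ≥0∞, Measurable L ∧
      (∀ t, μH[1] ({p ∈ Ω | derivAt u p ≠ 0} ∩ u ⁻¹' {t}) ≤ L t) ∧ ∀ B, MeasurableSet B →
        ∫⁻ t in B, L t ≤ ENNReal.ofReal c *
          ∫⁻ q in Ω ∩ u ⁻¹' B, ENNReal.ofReal (gradNorm Ω u q) ∂(area M) := by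
  set R := {p ∈ Ω | derivAt u p ≠ 0} with hR
  choose! U hUo hpU hUΩ hU using fun p (hp : p ∈ R) ↦
    exists_nhds_coarea_le hΩ hu hp.1 hp.2 hc
  rcases R.eq_empty_or_nonempty with hRe | hRne
  · refine ⟨fun _ ↦ 0, measurable_const, fun t ↦ by simp [hRe], fun B hB ↦ by simp⟩
  obtain ⟨s, hsR, hsc, hcov⟩ := TopologicalSpace.countable_cover_nhdsWithin
    (f := U) (s := R) fun p hp ↦ mem_nhdsWithin_of_mem_nhds ((hUo p hp).mem_nhds (hpU p hp))
  have hsne : s.Nonempty := by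
    obtain ⟨p, hp⟩ := hRne
    obtain ⟨q, hq, -⟩ := mem_iUnion₂.1 (hcov hp)
    exact ⟨q, hq⟩
  obtain ⟨f, hf⟩ := hsc.exists_eq_range hsne
  have hfR : ∀ n, f n ∈ R := fun n ↦ hsR (hf ▸ mem_range_self n)
  -- Disjoint pieces, so that the integrals of `|∇u|` add up without overlap and the constant stays
  -- `c`.
  set D : ℕ → Set M := disjointed fun n ↦ U (f n) with hD
  have hDm : ∀ n, MeasurableSet (D n) := fun n ↦
    MeasurableSet.disjointed (fun n ↦ (hUo _ (hfR n)).measurableSet) n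
  have hDU : ∀ n, D n ⊆ U (f n) := fun n ↦ disjointed_subset _ n
  have hDd : Pairwise (Function.onFun Disjoint D) := disjoint_disjointed _
  have hDcov : R ⊆ ⋃ n, D n := by
    rw [hD, iUnion_disjointed]
    refine hcov.trans ?_
    rw [hf, biUnion_range]
  choose L hLm hLH hLint using fun n ↦ hU (f n) (hfR n) (D n) (hDU n) (hDm n)
  refine ⟨fun t ↦ ∑' n, L n t, Measurable.tsum hLm, fun t ↦ ?_, fun B hB ↦ ?_⟩
  · calc μH[1] (R ∩ u ⁻¹' {t}) ≤ μH[1] (⋃ n, D n ∩ u ⁻¹' {t}) := by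
          rw [← iUnion_inter]
          exact measure_mono (inter_subset_inter_left _ hDcov)
      _ ≤ ∑' n, μH[1] (D n ∩ u ⁻¹' {t}) := measure_iUnion_le _
      _ ≤ ∑' n, L n t := ENNReal.tsum_le_tsum fun n ↦ hLH n t
  · rw [lintegral_tsum fun n ↦ (hLm n).aemeasurable]
    calc ∑' n, ∫⁻ t in B, L n t
        ≤ ∑' n, ENNReal.ofReal c *
            ∫⁻ q in D n ∩ u ⁻¹' B, ENNReal.ofReal (gradNorm Ω u q) ∂(area M) :=
          ENNReal.tsum_le_tsum fun n ↦ hLint n B hB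
      _ = ENNReal.ofReal c * ∫⁻ q in ⋃ n, D n ∩ u ⁻¹' B,
            ENNReal.ofReal (gradNorm Ω u q) ∂(area M) := by
          rw [ENNReal.tsum_mul_left, lintegral_iUnion
            (fun n ↦ measurableSet_inter_preimage_of_continuousOn hΩ hu.continuousOn (hDm n)
              ((hDU n).trans (hUΩ _ (hfR n))) hB)
            (fun i j hij ↦ (hDd hij).mono inter_subset_left inter_subset_left)]
      _ ≤ _ := by
          gcongr
          refine iUnion_subset fun n ↦ inter_subset_inter_left _ ?_
          exact (hDU n).trans (hUΩ _ (hfR n))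

end Coarea

/-! ### Additivity of the isoperimetric inequality; local structure of superlevel sets. -/

section LevelSets

/-- Expanding the squares, only the cross terms `-κ m m' ≤ s s'` are missing. They are trivial for
`κ ≥ 0`; for `κ < 0` the hypotheses give `-κ m² ≤ s²` and `-κ m'² ≤ s'²`, whose product is the
square of the claim. -/
lemma isoperimetric_add {A κ m s m' s' : ℝ} (hA : 0 ≤ A) (hm : 0 ≤ m) (hs : 0 ≤ s) (hm' : 0 ≤ m')
    (hs' : 0 ≤ s') (h : A * m - κ * m ^ 2 ≤ s ^ 2) (h' : A * m' - κ * m' ^ 2 ≤ s' ^ 2) :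
    A * (m + m') - κ * (m + m') ^ 2 ≤ (s + s') ^ 2 := by
  have key : -κ * (m * m') ≤ s * s' := by
    rcases le_or_gt 0 κ with hκ | hκ
    · nlinarith [mul_nonneg hm hm', mul_nonneg hs hs', mul_nonneg hκ (mul_nonneg hm hm')]
    · have h1 : -κ * m ^ 2 ≤ s ^ 2 := by nlinarith [mul_nonneg hA hm]
      have h2 : -κ * m' ^ 2 ≤ s' ^ 2 := by nlinarith [mul_nonneg hA hm']
      refine le_of_sq_le_sq ?_ (mul_nonneg hs hs')
      have := mul_le_mul h1 h2 (by nlinarith [sq_nonneg m']) (sq_nonneg s)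
      nlinarith
  nlinarith

lemma isoperimetric_sum {ι : Type*} (F : Finset ι) {A κ : ℝ} {m s : ι → ℝ} (hA : 0 ≤ A)
    (hm : ∀ i ∈ F, 0 ≤ m i) (hs : ∀ i ∈ F, 0 ≤ s i)
    (h : ∀ i ∈ F, A * m i - κ * m i ^ 2 ≤ s i ^ 2) :
    A * (∑ i ∈ F, m i) - κ * (∑ i ∈ F, m i) ^ 2 ≤ (∑ i ∈ F, s i) ^ 2 := by
  classical
  induction F using Finset.induction_on with
  | empty => simp
  | insert i F hi ih =>
    rw [Finset.sum_insert hi, Finset.sum_insert hi]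
    have hF : ∀ j ∈ F, j ∈ insert i F := fun j hj ↦ Finset.mem_insert_of_mem hj
    have hii := Finset.mem_insert_self i F
    exact isoperimetric_add hA (hm i hii) (hs i hii) (Finset.sum_nonneg fun j hj ↦ hm j (hF j hj))
      (Finset.sum_nonneg fun j hj ↦ hs j (hF j hj)) (h i hii)
      (ih (fun j hj ↦ hm j (hF j hj)) (fun j hj ↦ hs j (hF j hj)) fun j hj ↦ h j (hF j hj))

variable {M : Type*} [TopologicalSpace M] [ChartedSpace Plane M] [IsManifold (𝓡 2) ∞ M]

lemma mfderiv_ne_zero_of_derivAt_ne_zero {u : M → ℝ} {p : M}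
    (hu : ContMDiffAt (𝓡 2) 𝓘(ℝ, ℝ) ∞ u p) (h : derivAt u p ≠ 0) (t : ℝ) :
    mfderiv (𝓡 2) 𝓘(ℝ, ℝ) (fun q ↦ t - u q) p ≠ 0 := by
  intro h0
  have hρ : ContMDiffAt (𝓡 2) 𝓘(ℝ, ℝ) ∞ (fun q ↦ t - u q) p := contMDiffAt_const.sub hu
  have h1 := (hρ.mdifferentiableAt (by simp)).hasMFDerivAt.2
  rw [h0] at h1
  have h2 : HasFDerivWithinAt (fun y ↦ t - (u ∘ (extChartAt (𝓡 2) p).symm) y)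
      (0 : Plane →L[ℝ] ℝ) (range (𝓡 2)) (extChartAt (𝓡 2) p p) := h1
  rw [ModelWithCorners.range_eq_univ, hasFDerivWithinAt_univ] at h2
  have h3 := h2.fderiv
  rw [fderiv_const_sub] at h3
  exact h (neg_eq_zero.1 h3)

lemma exists_nhds_subset_component_of_lt {u : M → ℝ} {Ω : Set M} (hΩ : IsOpen Ω)
    (hu : ContinuousOn u Ω) {t : ℝ} {p : M} (hp : p ∈ Ω) (hpt : t < u p) :
    ∃ V ∈ 𝓝 p, V ⊆ connectedComponentIn {q ∈ Ω | t ≤ u q} p := by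
  set e := extChartAt (𝓡 2) p with he
  have hO : IsOpen (Ω ∩ u ⁻¹' Ioi t) := hu.isOpen_inter_preimage hΩ isOpen_Ioi
  have hW := isOpen_symm_preimage p hO
  obtain ⟨ε, hε, hball⟩ := Metric.isOpen_iff.1 hW (e p) ⟨mem_extChartAt_target p, by
    rw [mem_preimage, he, extChartAt_to_inv]; exact ⟨hp, hpt⟩⟩
  refine ⟨e.source ∩ e ⁻¹' Metric.ball (e p) ε, inter_mem (extChartAt_source_mem_nhds p)
    ((continuousAt_extChartAt p).preimage_mem_nhds (Metric.ball_mem_nhds _ hε)), fun q hq ↦ ?_⟩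
  have hpre : IsPreconnected (e.symm '' Metric.ball (e p) ε) :=
    (convex_ball _ _).isPreconnected.image _
      ((continuousOn_extChartAt_symm p).mono fun y hy ↦ (hball hy).1)
  refine hpre.subset_connectedComponentIn ⟨e p, Metric.mem_ball_self hε, extChartAt_to_inv p⟩ ?_
    ⟨e q, hq.2, e.left_inv hq.1⟩
  rintro _ ⟨y, hy, rfl⟩
  exact ⟨(hball hy).2.1, le_of_lt (hball hy).2.2⟩

/-- Near a regular point, `u` increases along a fixed direction `v`. Every nearby point of the
superlevel set can be pushed along `v`, without leaving that set, into one small ball where `u > t`;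
this connects it to `p`. -/
lemma exists_nhds_subset_component_of_eq {u : M → ℝ} {Ω : Set M} (hΩ : IsOpen Ω)
    (hu : ContMDiffOn (𝓡 2) 𝓘(ℝ, ℝ) ∞ u Ω) {t : ℝ} {p : M} (hp : p ∈ Ω) (hpt : u p = t)
    (hreg : derivAt u p ≠ 0) :
    ∃ V ∈ 𝓝 p, V ∩ {q ∈ Ω | t ≤ u q} ⊆ connectedComponentIn {q ∈ Ω | t ≤ u q} p := by
  set e := extChartAt (𝓡 2) p with he
  set y₀ := e p with hy₀
  set W := e.target ∩ e.symm ⁻¹' Ω with hWdef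
  have hW : IsOpen W := isOpen_symm_preimage p hΩ
  set w := u ∘ e.symm with hw
  have hwW : ContDiffOn ℝ ∞ w W := contDiffOn_comp_symm p hΩ le_rfl hu
  have hy₀W : y₀ ∈ W := ⟨mem_extChartAt_target p, by
    rw [mem_preimage, hy₀, he, extChartAt_to_inv]; exact hp⟩
  have hwy₀ : w y₀ = t := by rw [hw, Function.comp, hy₀, he, extChartAt_to_inv, hpt]
  obtain ⟨v, hv⟩ : ∃ v, 0 < fderiv ℝ w y₀ v := by
    obtain ⟨v, hv⟩ : ∃ v, fderiv ℝ w y₀ v ≠ 0 := by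
      by_contra! hcon
      exact hreg (ContinuousLinearMap.ext hcon)
    rcases lt_or_gt_of_ne hv with h | h
    · exact ⟨-v, by rw [map_neg]; linarith⟩
    · exact ⟨v, h⟩
  have hfc : ContinuousAt (fun z ↦ fderiv ℝ w z v) y₀ :=
    (((hwW.fderiv_of_isOpen hW (m := ∞) (by simp)).continuousOn.continuousAt
      (hW.mem_nhds hy₀W))).clm_apply continuousAt_const
  obtain ⟨ε, hε, hball⟩ := Metric.eventually_nhds_iff_ball.1
    ((hfc.eventually_const_lt hv).and (hW.mem_nhds hy₀W))
  have hbW : ∀ z ∈ Metric.ball y₀ ε, z ∈ W := fun z hz ↦ (hball z hz).2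
  have hdw : ∀ z ∈ Metric.ball y₀ ε, DifferentiableAt ℝ w z := fun z hz ↦
    (hwW.contDiffAt (hW.mem_nhds (hbW z hz))).differentiableAt (by simp)
  have hinc : ∀ y ∈ Metric.ball y₀ ε, ∀ s : ℝ, 0 ≤ s → y + s • v ∈ Metric.ball y₀ ε →
      w y ≤ w (y + s • v) ∧ (0 < s → w y < w (y + s • v)) := by
    intro y hy s hs hys
    obtain ⟨z, hz, hz'⟩ := domain_mvt (fun z hz ↦ (hdw z hz).hasFDerivAt.hasFDerivWithinAt)
      (convex_ball y₀ ε) hy hys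
    have hpos := (hball z ((convex_ball y₀ ε).segment_subset hy hys hz)).1
    rw [add_sub_cancel_left, map_smul, smul_eq_mul] at hz'
    exact ⟨by nlinarith [mul_nonneg hs hpos.le], fun h ↦ by nlinarith [mul_pos h hpos]⟩
  obtain ⟨a, ha, hav⟩ : ∃ a : ℝ, 0 < a ∧ y₀ + a • v ∈ Metric.ball y₀ ε := by
    have hcont : ContinuousAt (fun a : ℝ ↦ y₀ + a • v) 0 := by fun_prop
    have hev : ∀ᶠ a : ℝ in 𝓝 0, y₀ + a • v ∈ Metric.ball y₀ ε :=
      hcont.preimage_mem_nhds (by simpa using Metric.ball_mem_nhds y₀ hε)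
    obtain ⟨a, ha, ha'⟩ := ((hev.filter_mono nhdsWithin_le_nhds).and
      (self_mem_nhdsWithin (s := Ioi (0 : ℝ)))).exists
    exact ⟨a, ha', ha⟩
  have hwt : t < w (y₀ + a • v) :=
    hwy₀ ▸ (hinc y₀ (Metric.mem_ball_self hε) a ha.le hav).2 ha
  obtain ⟨δ₁, hδ₁, hball₁⟩ : ∃ δ > 0, ∀ z ∈ Metric.ball (y₀ + a • v) δ,
      t < w z ∧ z ∈ Metric.ball y₀ ε := by
    refine Metric.eventually_nhds_iff_ball.1 (Filter.Eventually.and ?_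
      (Metric.isOpen_ball.mem_nhds hav))
    exact (hdw _ hav).continuousAt.eventually_const_lt hwt
  set δ := min δ₁ ε with hδ
  have hδ0 : 0 < δ := lt_min hδ₁ hε
  have htr : ∀ y ∈ Metric.ball y₀ δ, y + a • v ∈ Metric.ball (y₀ + a • v) δ₁ := fun y hy ↦ by
    rw [Metric.mem_ball, dist_add_right]
    exact (Metric.mem_ball.1 hy).trans_le (min_le_left _ _)
  have hyε : ∀ y ∈ Metric.ball y₀ δ, y ∈ Metric.ball y₀ ε := fun y hy ↦
    Metric.ball_subset_ball (min_le_right _ _) hy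
  have hA : ∀ y ∈ Metric.ball y₀ δ, t ≤ w y →
      IsPreconnected (segment ℝ y (y + a • v) ∪ Metric.ball (y₀ + a • v) δ₁) ∧
      ∀ z ∈ segment ℝ y (y + a • v) ∪ Metric.ball (y₀ + a • v) δ₁,
        z ∈ Metric.ball y₀ ε ∧ t ≤ w z := by
    intro y hy hty
    have hyv := (hball₁ _ (htr y hy)).2
    refine ⟨(convex_segment _ _).isPreconnected.union (y + a • v) (right_mem_segment ℝ _ _)
      (htr y hy) (convex_ball _ _).isPreconnected, ?_⟩
    rintro z (hz | hz)
    · have hzb := (convex_ball y₀ ε).segment_subset (hyε y hy) hyv hz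
      refine ⟨hzb, ?_⟩
      obtain ⟨s, hs, rfl⟩ := (segment_eq_image' ℝ _ _).le hz
      simp only [add_sub_cancel_left, smul_smul] at hzb ⊢
      exact hty.trans (hinc y (hyε y hy) (s * a) (mul_nonneg hs.1 ha.le) hzb).1
    · exact ⟨(hball₁ z hz).2, (hball₁ z hz).1.le⟩
  refine ⟨e.source ∩ e ⁻¹' Metric.ball y₀ δ, inter_mem (extChartAt_source_mem_nhds p)
    ((continuousAt_extChartAt p).preimage_mem_nhds (Metric.ball_mem_nhds _ hδ0)), ?_⟩
  rintro q ⟨hq, hqE⟩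
  have hwq : t ≤ w (e q) := by
    rw [hw, Function.comp, e.left_inv hq.1]; exact hqE.2
  obtain ⟨hc1, hs1⟩ := hA _ hq.2 hwq
  obtain ⟨hc2, hs2⟩ := hA y₀ (Metric.mem_ball_self hδ0) hwy₀.ge
  have hpre := hc2.union (y₀ + a • v) (Or.inr (Metric.mem_ball_self hδ₁))
    (Or.inr (Metric.mem_ball_self hδ₁)) hc1
  have hall : ∀ z ∈ (segment ℝ y₀ (y₀ + a • v) ∪ Metric.ball (y₀ + a • v) δ₁) ∪
      (segment ℝ (e q) (e q + a • v) ∪ Metric.ball (y₀ + a • v) δ₁),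
      z ∈ Metric.ball y₀ ε ∧ t ≤ w z := fun z hz ↦ hz.elim (hs2 z) (hs1 z)
  have hpre' := hpre.image e.symm
    ((continuousOn_extChartAt_symm p).mono fun z hz ↦ (hbW z (hall z hz).1).1)
  refine hpre'.subset_connectedComponentIn
    ⟨y₀, Or.inl (Or.inl (left_mem_segment ℝ _ _)), extChartAt_to_inv p⟩ ?_
    ⟨e q, Or.inr (Or.inl (left_mem_segment ℝ _ _)), e.left_inv hq.1⟩
  rintro _ ⟨z, hz, rfl⟩
  exact ⟨(hbW z (hall z hz).1).2, (hall z hz).2⟩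

end LevelSets

/-! ### Components of superlevel sets are compact smooth domains. -/

section Isoperimetric

variable {M : Type*} [EMetricSpace M] [ChartedSpace Plane M] [IsManifold (𝓡 2) ∞ M]

/-- As `u = 0` on `∂Ω`, a positive superlevel set stays away from the boundary and is closed in the
compact closure. -/
lemma isCompact_superlevel {u : M → ℝ} {Ω : Set M} (hΩ : IsOpen Ω) (hc : IsCompact (closure Ω))
    (hu : ContinuousOn u (closure Ω)) (hbd : ∀ x ∈ frontier Ω, u x = 0) {t : ℝ} (ht : 0 < t) :
    IsCompact {q ∈ Ω | t ≤ u q} := by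
  have h : {q ∈ Ω | t ≤ u q} = closure Ω ∩ u ⁻¹' Ici t := by
    ext q
    constructor
    · exact fun hq ↦ ⟨subset_closure hq.1, hq.2⟩
    · rintro ⟨hq, hqt⟩
      refine ⟨?_, hqt⟩
      by_contra hqΩ
      have := hbd q (by rw [hΩ.frontier_eq]; exact ⟨hq, hqΩ⟩)
      rw [mem_preimage, this] at hqt
      exact absurd ht (not_lt.2 hqt)
  rw [h]
  exact hc.of_isClosed_subset (hu.preimage_isClosed_of_isClosed isClosed_closure isClosed_Ici)
    inter_subset_left

lemma exists_nhds_inter_subset_component {u : M → ℝ} {Ω : Set M} (hΩ : IsOpen Ω)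
    (hu : ContMDiffOn (𝓡 2) 𝓘(ℝ, ℝ) ∞ u Ω) {t : ℝ}
    (hreg : ∀ p ∈ Ω, u p = t → derivAt u p ≠ 0) {p : M} (hp : p ∈ {q ∈ Ω | t ≤ u q}) :
    ∃ V ∈ 𝓝 p, V ∩ {q ∈ Ω | t ≤ u q} ⊆ connectedComponentIn {q ∈ Ω | t ≤ u q} p := by
  rcases hp.2.lt_or_eq with h | h
  · obtain ⟨V, hV, hsub⟩ := exists_nhds_subset_component_of_lt hΩ hu.continuousOn hp.1 h
    exact ⟨V, hV, inter_subset_left.trans hsub⟩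
  · exact exists_nhds_subset_component_of_eq hΩ hu hp.1 h.symm (hreg p hp.1 h.symm)

/-- Where `u > t`, a whole neighbourhood lies in the same component, so frontier points sit on the
level `u = t`. -/
lemma frontier_component_subset {u : M → ℝ} {Ω : Set M} (hΩ : IsOpen Ω)
    (hu : ContMDiffOn (𝓡 2) 𝓘(ℝ, ℝ) ∞ u Ω) {t : ℝ} (hE : IsClosed {q ∈ Ω | t ≤ u q}) (p : M) :
    IsClosed (connectedComponentIn {q ∈ Ω | t ≤ u q} p) ∧
    frontier (connectedComponentIn {q ∈ Ω | t ≤ u q} p) ⊆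
      connectedComponentIn {q ∈ Ω | t ≤ u q} p ∩ (Ω ∩ u ⁻¹' {t}) := by
  set E := {q ∈ Ω | t ≤ u q} with hEdef
  have hcl : IsClosed (connectedComponentIn E p) := by
    by_cases hp : p ∈ E
    · refine isClosed_of_closure_subset ?_
      refine isPreconnected_connectedComponentIn.closure.subset_connectedComponentIn
        (subset_closure (mem_connectedComponentIn hp))
        (closure_minimal (connectedComponentIn_subset E p) hE)
    · rw [connectedComponentIn_eq_empty hp]; exact isClosed_empty
  refine ⟨hcl, fun q hq ↦ ?_⟩
  have hqC := hcl.frontier_subset hq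
  have hqE := connectedComponentIn_subset E p hqC
  refine ⟨hqC, hqE.1, ?_⟩
  by_contra hne
  have hlt : t < u q := lt_of_le_of_ne hqE.2 (Ne.symm hne)
  obtain ⟨V, hV, hsub⟩ := exists_nhds_subset_component_of_lt hΩ hu.continuousOn hqE.1 hlt
  rw [← connectedComponentIn_eq hqC] at hsub
  exact hq.2 (mem_interior_iff_mem_nhds.2 (mem_of_superset hV hsub))

/-- The defining function is `t - u`. Near a frontier point the component coincides with the whole
superlevel set, since no other component comes close. -/
lemma isCompactSmoothDomain_component {u : M → ℝ} {Ω : Set M} (hΩ : IsOpen Ω)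
    (hu : ContMDiffOn (𝓡 2) 𝓘(ℝ, ℝ) ∞ u Ω) {t : ℝ} (hE : IsCompact {q ∈ Ω | t ≤ u q})
    (hreg : ∀ p ∈ Ω, u p = t → derivAt u p ≠ 0) {p : M} (hp : p ∈ {q ∈ Ω | t ≤ u q}) :
    IsCompactSmoothDomain (connectedComponentIn {q ∈ Ω | t ≤ u q} p) := by
  obtain ⟨hcl, hfr⟩ := frontier_component_subset hΩ hu hE.isClosed p
  refine ⟨hE.of_isClosed_subset hcl (connectedComponentIn_subset _ _),
    isConnected_connectedComponentIn_iff.2 hp, fun x hx ↦ ?_⟩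
  obtain ⟨hxC, hxΩ, hxt⟩ := hfr hx
  obtain ⟨V, hV, hsub⟩ := exists_nhds_inter_subset_component hΩ hu hreg
    (connectedComponentIn_subset _ _ hxC)
  rw [← connectedComponentIn_eq hxC] at hsub
  refine ⟨interior V ∩ Ω, fun q ↦ t - u q, isOpen_interior.inter hΩ,
    ⟨mem_interior_iff_mem_nhds.2 hV, hxΩ⟩, ?_, ?_, ?_⟩
  · exact contMDiffOn_const.sub (hu.mono inter_subset_right)
  · exact mfderiv_ne_zero_of_derivAt_ne_zero (hu.contMDiffAt (hΩ.mem_nhds hxΩ))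
      (hreg x hxΩ hxt) t
  · ext q
    constructor
    · rintro ⟨hq, hqU⟩
      exact ⟨hqU, sub_nonpos.2 (connectedComponentIn_subset _ _ hq).2⟩
    · rintro ⟨hqU, hq⟩
      exact ⟨hsub ⟨interior_subset hqU.1, hqU.2, sub_nonpos.1 hq⟩, hqU⟩

variable [RiemannianBundle (fun x : M ↦ TangentSpace (𝓡 2) x)]
  [IsContMDiffRiemannianBundle (𝓡 2) ∞ Plane (fun x : M ↦ TangentSpace (𝓡 2) x)]
  [MeasurableSpace M] [BorelSpace M]

/-- The isoperimetric inequality for the superlevel sets at a regular value. -/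
theorem isoperimetric_superlevel {θ κ : ℝ} (hθ : 0 ≤ θ) (hiso : IsoperimetricInequality M θ κ)
    {u : M → ℝ} {Ω : Set M} (hΩ : IsOpen Ω)
    (hu : ContMDiffOn (𝓡 2) 𝓘(ℝ, ℝ) ∞ u Ω) {t : ℝ} (hE : IsCompact {q ∈ Ω | t ≤ u q})
    (hreg : ∀ p ∈ Ω, u p = t → derivAt u p ≠ 0) (hfin : μH[1] (Ω ∩ u ⁻¹' {t}) ≠ ⊤) :
    4 * Real.pi * θ * (area M).real {q ∈ Ω | t ≤ u q} -
      κ * (area M).real {q ∈ Ω | t ≤ u q} ^ 2 ≤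
      (μH[1] : Measure M).real (Ω ∩ u ⁻¹' {t}) ^ 2 := by
  classical
  set E := {q ∈ Ω | t ≤ u q} with hEdef
  choose! V hV hVE using fun p (hp : p ∈ E) ↦ exists_nhds_inter_subset_component hΩ hu hreg hp
  obtain ⟨s, hsE, hcov⟩ := hE.elim_nhds_subcover V hV
  -- Each point has a neighbourhood meeting only its own component, so by compactness there are
  -- finitely many components.
  set F : Finset (Set M) := s.image (connectedComponentIn E) with hF
  have hFE : ∀ C ∈ F, ∃ p ∈ E, C = connectedComponentIn E p := fun C hC ↦ by
    obtain ⟨p, hp, rfl⟩ := Finset.mem_image.1 hC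
    exact ⟨p, hsE p hp, rfl⟩
  have hdisj : (F : Set (Set M)).PairwiseDisjoint id := by
    intro C hC C' hC' hne
    obtain ⟨p, -, rfl⟩ := hFE C hC
    obtain ⟨p', -, rfl⟩ := hFE C' hC'
    refine disjoint_left.2 fun q hq hq' ↦ hne ?_
    exact (connectedComponentIn_eq hq).trans (connectedComponentIn_eq hq').symm
  have hclosed : ∀ C ∈ F, IsClosed C := fun C hC ↦ by
    obtain ⟨p, -, rfl⟩ := hFE C hC
    exact (frontier_component_subset hΩ hu hE.isClosed p).1
  have hunion : E = ⋃ C ∈ F, C := by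
    refine subset_antisymm (fun q hq ↦ ?_) (iUnion₂_subset fun C hC ↦ ?_)
    · obtain ⟨p, hp, hqV⟩ := mem_iUnion₂.1 (hcov hq)
      exact mem_biUnion (Finset.mem_image_of_mem _ hp) (hVE p (hsE p hp) ⟨hqV, hq⟩)
    · obtain ⟨p, -, rfl⟩ := hFE C hC
      exact connectedComponentIn_subset E p
  have hfr : ∀ C ∈ F, frontier C ⊆ C ∩ (Ω ∩ u ⁻¹' {t}) := fun C hC ↦ by
    obtain ⟨p, -, rfl⟩ := hFE C hC
    exact (frontier_component_subset hΩ hu hE.isClosed p).2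
  have hm : (area M).real E = ∑ C ∈ F, (area M).real C := by
    conv_lhs => rw [hunion]
    refine measureReal_biUnion_finset hdisj (fun C hC ↦ (hclosed C hC).measurableSet) fun C hC ↦ ?_
    refine (measure_mono ?_).trans_lt hE.measure_lt_top |>.ne
    rw [hunion]
    exact subset_biUnion_of_mem (u := fun C ↦ C) hC
  -- The frontiers are disjoint parts of the level line. Its length must be finite here, because the
  -- real value of an infinite measure is `0`.
  have hs : ∑ C ∈ F, (μH[1] : Measure M).real (frontier C) ≤
      (μH[1] : Measure M).real (Ω ∩ u ⁻¹' {t}) := by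
    have hsub : ⋃ C ∈ F, frontier C ⊆ Ω ∩ u ⁻¹' {t} :=
      iUnion₂_subset fun C hC ↦ (hfr C hC).trans inter_subset_right
    rw [← measureReal_biUnion_finset (s := F) (f := frontier) ?_ ?_ fun C hC ↦
      measure_ne_top_of_subset ((hfr C hC).trans inter_subset_right) hfin]
    · exact measureReal_mono hsub hfin
    · intro C hC C' hC' hne
      exact (hdisj hC hC' hne).mono ((hfr C hC).trans inter_subset_left)
        ((hfr C' hC').trans inter_subset_left)
    · exact fun C hC ↦ isClosed_frontier.measurableSet
  have hpi := Real.pi_pos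
  rw [hm]
  refine (isoperimetric_sum F (s := fun C ↦ (μH[1] : Measure M).real (frontier C)) (by positivity)
    (fun _ _ ↦ measureReal_nonneg) (fun _ _ ↦ measureReal_nonneg) fun C hC ↦ ?_).trans ?_
  · obtain ⟨p, hp, rfl⟩ := hFE C hC
    exact hiso _ (isCompactSmoothDomain_component hΩ hu hE hreg hp)
  · have := Finset.sum_nonneg fun C (_ : C ∈ F) ↦
      measureReal_nonneg (μ := (μH[1] : Measure M)) (s := frontier C)
    exact pow_le_pow_left₀ this hs 2

end Isoperimetric

/-! ### Layer cake formulas. -/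

section LayerCake

variable {X : Type*} [MeasurableSpace X] {μ : Measure X}

lemma measurable_setIntegral_ge [SFinite μ] {u b : X → ℝ} (hu : Measurable u) (hb : Measurable b) :
    Measurable fun t ↦ ∫ x in {x | t ≤ u x}, b x ∂μ := by
  have h : StronglyMeasurable fun p : ℝ × X ↦ {p : ℝ × X | p.1 ≤ u p.2}.indicator (b ∘ Prod.snd) p :=
    ((hb.comp measurable_snd).indicator
      (measurableSet_le measurable_fst (hu.comp measurable_snd))).stronglyMeasurable
  convert (h.integral_prod_right' (ν := μ)).measurable using 1
  funext t
  rw [← integral_indicator (measurableSet_le measurable_const hu)]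
  rfl

lemma measurable_setIntegral_gt [SFinite μ] {u b : X → ℝ} (hu : Measurable u) (hb : Measurable b) :
    Measurable fun t ↦ ∫ x in {x | t < u x}, b x ∂μ := by
  have h : StronglyMeasurable fun p : ℝ × X ↦ {p : ℝ × X | p.1 < u p.2}.indicator (b ∘ Prod.snd) p :=
    ((hb.comp measurable_snd).indicator
      (measurableSet_lt measurable_fst (hu.comp measurable_snd))).stronglyMeasurable
  convert (h.integral_prod_right' (ν := μ)).measurable using 1
  funext t
  rw [← integral_indicator (measurableSet_lt measurable_const hu)]
  rfl

/-- Layer cake formula with a signed weight. -/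
lemma integral_mul_intervalIntegral [SFinite μ] {u a : X → ℝ} {K : ℝ} (hu : Measurable u)
    (h0 : ∀ x, 0 ≤ u x) (hK : ∀ x, u x ≤ K) (ha : Integrable a μ) {g : ℝ → ℝ}
    (hg : Continuous g) :
    ∫ x, a x * (∫ t in (0 : ℝ)..u x, g t) ∂μ =
      ∫ t in Ioc 0 K, g t * ∫ x in {x | t ≤ u x}, a x ∂μ := by
  set S : Set (X × ℝ) := {p | p.2 ≤ u p.1} with hS
  have hSm : MeasurableSet S := measurableSet_le measurable_snd (hu.comp measurable_fst)
  have hgi : Integrable g (volume.restrict (Ioc 0 K)) :=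
    (hg.integrableOn_Icc (a := 0) (b := K)).mono_set Ioc_subset_Icc_self
  have h_intble : Integrable (fun p : X × ℝ ↦ S.indicator (fun p ↦ a p.1 * g p.2) p)
      (μ.prod (volume.restrict (Ioc 0 K))) := (ha.mul_prod hgi).indicator hSm
  have h1 : ∀ x, a x * (∫ t in (0 : ℝ)..u x, g t) =
      ∫ t in Ioc 0 K, S.indicator (fun p ↦ a p.1 * g p.2) (x, t) := by
    intro x
    rw [intervalIntegral.integral_of_le (h0 x), ← integral_const_mul]
    have : ∀ t, S.indicator (fun p ↦ a p.1 * g p.2) (x, t) =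
        (Iic (u x)).indicator (fun t ↦ a x * g t) t := fun t ↦ rfl
    simp_rw [this]
    rw [setIntegral_indicator measurableSet_Iic, Ioc_inter_Iic, inf_eq_right.2 (hK x)]
  simp_rw [h1]
  rw [integral_integral_swap h_intble]
  refine integral_congr_ae (Eventually.of_forall fun t ↦ ?_)
  have : ∀ x, S.indicator (fun p ↦ a p.1 * g p.2) (x, t) =
      {x | t ≤ u x}.indicator (fun x ↦ a x * g t) x := fun x ↦ rfl
  simp_rw [this]
  rw [integral_indicator (measurableSet_le measurable_const hu), integral_mul_const, mul_comm]

lemma integral_exp_two_mul (s : ℝ) :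
    ∫ t in (0 : ℝ)..s, Real.exp (2 * t) = (Real.exp (2 * s) - 1) / 2 := by
  rw [intervalIntegral.integral_comp_mul_left (fun t ↦ Real.exp t) two_ne_zero, integral_exp]
  simp
  ring

lemma integral_exp_mul_measureReal [IsFiniteMeasure μ] {u : X → ℝ} {K : ℝ} (hu : Measurable u)
    (h0 : ∀ x, 0 ≤ u x) (hK : ∀ x, u x ≤ K) :
    ∫ t in Ioc 0 K, Real.exp (2 * t) * μ.real {x | t ≤ u x} =
      ((∫ x, Real.exp (2 * u x) ∂μ) - μ.real univ) / 2 := by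
  have h := integral_mul_intervalIntegral hu h0 hK (integrable_const (1 : ℝ)) (μ := μ)
    (g := fun t ↦ Real.exp (2 * t)) (by fun_prop)
  simp only [integral_exp_two_mul, one_mul, integral_const, smul_eq_mul, mul_one,
    measureReal_restrict_apply_univ] at h
  rw [← h, integral_div, integral_sub _ (integrable_const 1)]
  · simp
  · exact Integrable.of_bound (by fun_prop) (Real.exp (2 * K)) (Eventually.of_forall fun x ↦ by
      rw [Real.norm_eq_abs, Real.abs_exp]; gcongr; exact hK x)

end LayerCake

/-! ### Positivity of the flux from the weak equation. -/

section Weak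

variable {X : Type*} [MeasurableSpace X] {μ : Measure X}

/-- The weak form of `-Δu = a`, `D = |∇u|²`, tested with the functions of `u` that vanish near
zero. -/
def WeakEquation (μ : Measure X) (u a D : X → ℝ) : Prop :=
  ∀ (ψ ψ' : ℝ → ℝ) (ε : ℝ), 0 < ε → (∀ t, HasDerivAt ψ (ψ' t) t) → Continuous ψ' →
    (∀ t ≤ ε, ψ t = 0) → ∫ x, ψ' (u x) * D x ∂μ = ∫ x, a x * ψ (u x) ∂μ

lemma WeakEquation.integral_mul_nonneg {u a D : X → ℝ} (h : WeakEquation μ u a D)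
    (hD : ∀ x, 0 ≤ D x) {ψ : ℝ → ℝ} (hψ : ContDiff ℝ 1 ψ) (hm : Monotone ψ) {ε : ℝ} (hε : 0 < ε)
    (h0 : ∀ t ≤ ε, ψ t = 0) : 0 ≤ ∫ x, a x * ψ (u x) ∂μ := by
  rw [← h ψ (deriv ψ) ε hε (fun t ↦ (hψ.differentiable one_ne_zero t).hasDerivAt)
    (hψ.continuous_deriv le_rfl) h0]
  exact integral_nonneg fun x ↦ mul_nonneg hm.deriv_nonneg (hD x)

/-- Test with smooth nondecreasing functions of `u` that converge to the indicator of `{u > t}`;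
each integral is nonnegative because it equals one of `ψ'(u)|∇u|²`. -/
lemma WeakEquation.setIntegral_gt_nonneg {u a D : X → ℝ} (h : WeakEquation μ u a D)
    (hu : Measurable u) (hD : ∀ x, 0 ≤ D x) (ha : Integrable a μ) {t : ℝ} (ht : 0 < t) :
    0 ≤ ∫ x in {x | t < u x}, a x ∂μ := by
  have hlim : Tendsto (fun n : ℕ ↦ ∫ x, a x * Real.smoothTransition (n * (u x - t)) ∂μ) atTop
      (𝓝 (∫ x, {x | t < u x}.indicator a x ∂μ)) := by
    refine tendsto_integral_of_dominated_convergence (fun x ↦ |a x|) (fun n ↦ ?_) ha.abs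
      (fun n ↦ Eventually.of_forall fun x ↦ ?_) (Eventually.of_forall fun x ↦ ?_)
    · exact ha.aestronglyMeasurable.mul (Real.smoothTransition.continuous.measurable.comp
        ((hu.sub_const t).const_mul _)).aestronglyMeasurable
    · rw [norm_mul, Real.norm_eq_abs, Real.norm_eq_abs,
        abs_of_nonneg (Real.smoothTransition.nonneg _)]
      exact mul_le_of_le_one_right (abs_nonneg _) (Real.smoothTransition.le_one _)
    · by_cases hx : t < u x
      · have h1 : Tendsto (fun n : ℕ ↦ (n : ℝ) * (u x - t)) atTop atTop :=
          tendsto_natCast_atTop_atTop.atTop_mul_const (sub_pos.2 hx)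
        refine tendsto_const_nhds.congr' ?_
        filter_upwards [h1.eventually_ge_atTop 1] with n hn
        rw [Real.smoothTransition.one_of_one_le hn, mul_one]
        exact indicator_of_mem (s := {x | t < u x}) hx a
      · refine tendsto_const_nhds.congr fun n ↦ ?_
        rw [Real.smoothTransition.zero_of_nonpos (mul_nonpos_of_nonneg_of_nonpos n.cast_nonneg
          (sub_nonpos.2 (not_lt.1 hx))), mul_zero]
        exact indicator_of_notMem (s := {x | t < u x}) hx a
  rw [← integral_indicator (measurableSet_lt measurable_const hu)]
  refine ge_of_tendsto' hlim fun n ↦ ?_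
  refine h.integral_mul_nonneg hD (ψ := fun s ↦ Real.smoothTransition (n * (s - t)))
    (Real.smoothTransition.contDiff.comp (by fun_prop))
    (fun r s hrs ↦ Real.smoothTransition.monotone (by gcongr)) ht fun s hs ↦ ?_
  exact Real.smoothTransition.zero_of_nonpos
    (mul_nonpos_of_nonneg_of_nonpos n.cast_nonneg (sub_nonpos.2 hs))

lemma WeakEquation.setIntegral_ge_nonneg {u a D : X → ℝ} (h : WeakEquation μ u a D)
    (hu : Measurable u) (hD : ∀ x, 0 ≤ D x) (ha : Integrable a μ) {t : ℝ} (ht : 0 < t) :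
    0 ≤ ∫ x in {x | t ≤ u x}, a x ∂μ := by
  -- Approach `{t ≤ u}` by strict superlevel sets from below. The shift by `2` keeps the levels `t(1
  -- - 1/(n+2))` positive.
  have hlim : Tendsto (fun n : ℕ ↦ ∫ x in {x | t * (1 - 1 / ((n : ℝ) + 2)) < u x}, a x ∂μ) atTop
      (𝓝 (∫ x in {x | t ≤ u x}, a x ∂μ)) := by
    have hi : {x | t ≤ u x} = ⋂ n : ℕ, {x | t * (1 - 1 / ((n : ℝ) + 2)) < u x} := by
      ext x
      simp only [mem_ofPred_eq, mem_iInter]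
      constructor
      · intro hx n
        refine lt_of_lt_of_le ?_ hx
        have : 0 < 1 / ((n : ℝ) + 2) := by positivity
        nlinarith
      · intro hx
        have hl : Tendsto (fun n : ℕ ↦ t * (1 - 1 / ((n : ℝ) + 2))) atTop (𝓝 (t * (1 - 0))) :=
          (tendsto_const_nhds.sub (tendsto_const_nhds.div_atTop
            (tendsto_atTop_add_const_right _ _ tendsto_natCast_atTop_atTop))).const_mul t
        rw [sub_zero, mul_one] at hl
        exact le_of_tendsto' hl fun n ↦ (hx n).le
    rw [hi]
    refine tendsto_setIntegral_of_antitone (fun n ↦ measurableSet_lt measurable_const hu)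
      (fun n k hnk x hx ↦ ?_) ⟨0, ha.integrableOn⟩
    rw [mem_ofPred_eq] at hx ⊢
    refine lt_of_le_of_lt ?_ hx
    have : ((n : ℝ)) ≤ k := by exact_mod_cast hnk
    gcongr
  refine ge_of_tendsto' hlim fun n ↦ h.setIntegral_gt_nonneg hu hD ha (mul_pos ht ?_)
  rw [sub_pos, div_lt_one (by positivity)]
  have := n.cast_nonneg (α := ℝ)
  linarith

end Weak

/-! ### Energy, flux and the density of the law of `u`. -/

section Distribution

variable {X : Type*} [MeasurableSpace X] {μ : Measure X}

/-- The distributional form of `∫_{u = t} |∇u| = G(t)`. Testing with primitives of `g·w` for all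
bounded continuous `g` and applying the layer cake formula identifies the two finite measures. The
weight `w(t) = (t - ε)⁺` makes these primitives `C¹` and zero below `ε`, as the weak equation
requires. -/
lemma WeakEquation.map_withDensity_eq [SFinite μ] {u a D : X → ℝ} {K : ℝ}
    (h : WeakEquation μ u a D) (hu : Measurable u) (h0 : ∀ x, 0 ≤ u x) (hK : ∀ x, u x ≤ K)
    (ha : Integrable a μ) (ham : Measurable a) (hD : ∀ x, 0 ≤ D x) (hDm : Measurable D) {ε : ℝ}
    (hε : 0 < ε) (hDi : IntegrableOn D {x | ε ≤ u x} μ) :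
    (μ.withDensity fun x ↦ ENNReal.ofReal (max (u x - ε) 0 * D x)).map u =
      (volume.restrict (Ioc 0 K)).withDensity
        fun t ↦ ENNReal.ofReal (max (t - ε) 0 * ∫ x in {x | t ≤ u x}, a x ∂μ) := by
  set w : ℝ → ℝ := fun t ↦ max (t - ε) 0 with hw
  have hwc : Continuous w := by fun_prop
  have hw0 : ∀ t, 0 ≤ w t := fun t ↦ le_max_right _ _
  have hwε : ∀ t ≤ ε, w t = 0 := fun t ht ↦ max_eq_right (sub_nonpos.2 ht)
  set G : ℝ → ℝ := fun t ↦ ∫ x in {x | t ≤ u x}, a x ∂μ with hG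
  have hGm : Measurable G := measurable_setIntegral_ge hu ham
  have hGb : ∀ t, ‖G t‖ ≤ ∫ x, ‖a x‖ ∂μ := fun t ↦
    (norm_integral_le_integral_norm _).trans
      (setIntegral_le_integral ha.norm (Eventually.of_forall fun x ↦ norm_nonneg _))
  have hi1 : Integrable (fun x ↦ w (u x) * D x) μ := by
    have hset : MeasurableSet {x | ε ≤ u x} := measurableSet_le measurable_const hu
    have : (fun x ↦ w (u x) * D x) = fun x ↦ w (u x) * {x | ε ≤ u x}.indicator D x := by
      funext x
      by_cases hx : ε ≤ u x
      · rw [indicator_of_mem (s := {x | ε ≤ u x}) hx]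
      · rw [hwε _ (not_le.1 hx).le, zero_mul, zero_mul]
    rw [this]
    refine (hDi.integrable_indicator hset).bdd_mul (c := K)
      (hwc.measurable.comp hu).aestronglyMeasurable (Eventually.of_forall fun x ↦ ?_)
    rw [Real.norm_eq_abs, abs_of_nonneg (hw0 _)]
    exact max_le (by linarith [hK x]) ((h0 x).trans (hK x))
  have hi2 : Integrable (fun t ↦ w t * G t) (volume.restrict (Ioc 0 K)) :=
    ((hwc.integrableOn_Icc (a := 0) (b := K)).mono_set Ioc_subset_Icc_self).mul_bdd
      hGm.aestronglyMeasurable (Eventually.of_forall hGb)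
  have hf1 : IsFiniteMeasure ((μ.withDensity fun x ↦ ENNReal.ofReal (w (u x) * D x)).map u) := by
    have := isFiniteMeasure_withDensity_ofReal hi1.2
    infer_instance
  have hf2 := isFiniteMeasure_withDensity_ofReal hi2.2
  refine ext_of_forall_integral_eq_of_IsFiniteMeasure fun g ↦ ?_
  have hm1 : Measurable fun x ↦ ENNReal.ofReal (w (u x) * D x) :=
    ((hwc.measurable.comp hu).mul hDm).ennreal_ofReal
  have hm2 : Measurable fun t ↦ ENNReal.ofReal (w t * G t) :=
    (hwc.measurable.mul hGm).ennreal_ofReal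
  rw [integral_map hu.aemeasurable g.continuous.measurable.aestronglyMeasurable,
    integral_withDensity_eq_integral_toReal_smul hm1 (by simp),
    integral_withDensity_eq_integral_toReal_smul hm2 (by simp)]
  set ψ : ℝ → ℝ := fun t ↦ ∫ s in (0 : ℝ)..t, g s * w s with hψ
  have hcont : Continuous fun s ↦ g s * w s := g.continuous.mul hwc
  have hderiv : ∀ t, HasDerivAt ψ (g t * w t) t := fun t ↦
    intervalIntegral.integral_hasDerivAt_right (hcont.intervalIntegrable _ _)
      (hcont.stronglyMeasurableAtFilter _ _) hcont.continuousAt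
  have hzero : ∀ t ≤ ε, ψ t = 0 := fun t ht ↦ by
    refine intervalIntegral.integral_zero_ae (Eventually.of_forall fun s hs ↦ ?_)
    rw [hwε s (hs.2.trans (max_le hε.le ht)), mul_zero]
  have key := h ψ (fun t ↦ g t * w t) ε hε hderiv hcont hzero
  rw [hψ, integral_mul_intervalIntegral hu h0 hK ha hcont] at key
  calc ∫ x, (ENNReal.ofReal (w (u x) * D x)).toReal • g (u x) ∂μ
      = ∫ x, g (u x) * w (u x) * D x ∂μ := by
        refine integral_congr_ae (Eventually.of_forall fun x ↦ ?_)
        simp only [ENNReal.toReal_ofReal (mul_nonneg (hw0 _) (hD x)), smul_eq_mul]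
        ring
    _ = ∫ t in Ioc 0 K, g t * w t * G t := key
    _ = ∫ t in Ioc 0 K, (ENNReal.ofReal (w t * G t)).toReal • g t := by
        refine setIntegral_congr_fun measurableSet_Ioc fun t ht ↦ ?_
        have hGt : 0 ≤ G t := h.setIntegral_ge_nonneg hu hD ha ht.1
        simp only [ENNReal.toReal_ofReal (mul_nonneg (hw0 t) hGt), smul_eq_mul]
        ring

/-- The Dirichlet energy between two levels is at most the integral of the flux through the
levels. -/
lemma WeakEquation.lintegral_preimage_le [SFinite μ] {u a D : X → ℝ} {K : ℝ}
    (h : WeakEquation μ u a D) (hu : Measurable u) (h0 : ∀ x, 0 ≤ u x) (hK : ∀ x, u x ≤ K)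
    (ha : Integrable a μ) (ham : Measurable a) (hD : ∀ x, 0 ≤ D x) (hDm : Measurable D) {ε : ℝ}
    (hε : 0 < ε) (hDi : IntegrableOn D {x | ε ≤ u x} μ) {B : Set ℝ} (hB : MeasurableSet B)
    (hBε : B ⊆ Ioi ε) :
    ∫⁻ x in u ⁻¹' B, ENNReal.ofReal (D x) ∂μ ≤
      ∫⁻ t in B, ENNReal.ofReal (∫ x in {x | t ≤ u x}, a x ∂μ) := by
  have heq := h.map_withDensity_eq hu h0 hK ha ham hD hDm hε hDi
  -- The weight `(t - ε)⁺` is positive on `B ⊆ (ε, ∞)` and can be divided out.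
  have hwm : Measurable fun t : ℝ ↦ (ENNReal.ofReal (max (t - ε) 0))⁻¹ := by fun_prop
  have hGm : Measurable fun t ↦ ∫ x in {x | t ≤ u x}, a x ∂μ := measurable_setIntegral_ge hu ham
  have hcancel : ∀ t ∈ B, ∀ d : ℝ, ENNReal.ofReal (max (t - ε) 0 * d) *
      (ENNReal.ofReal (max (t - ε) 0))⁻¹ = ENNReal.ofReal d := fun t ht d ↦ by
    have hpos : 0 < max (t - ε) 0 := lt_max_of_lt_left (sub_pos.2 (hBε ht))
    rw [ENNReal.ofReal_mul hpos.le, mul_right_comm, ENNReal.mul_inv_cancel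
      (ENNReal.ofReal_pos.2 hpos).ne' ENNReal.ofReal_ne_top, one_mul]
  have h1 : ∫⁻ x in u ⁻¹' B, ENNReal.ofReal (D x) ∂μ =
      ∫⁻ t in B, (ENNReal.ofReal (max (t - ε) 0))⁻¹
        ∂((μ.withDensity fun x ↦ ENNReal.ofReal (max (u x - ε) 0 * D x)).map u) := by
    rw [setLIntegral_map hB hwm hu, restrict_withDensity (hu hB),
      lintegral_withDensity_eq_lintegral_mul _ (by fun_prop)
        (g := fun x ↦ (ENNReal.ofReal (max (u x - ε) 0))⁻¹) (by fun_prop)]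
    exact setLIntegral_congr_fun (hu hB) fun x hx ↦ (hcancel (u x) hx (D x)).symm
  rw [h1, heq, restrict_withDensity hB, lintegral_withDensity_eq_lintegral_mul _ (by fun_prop) hwm,
    Measure.restrict_restrict hB]
  refine (setLIntegral_congr_fun (hB.inter measurableSet_Ioc) fun t ht ↦
    hcancel t ht.1 _).le.trans (lintegral_mono_set inter_subset_left)

/-- After multiplication by `q` the hypothesis says that a quadratic polynomial is nonnegative at
positive rationals; it is trivially so at `q ≤ 0`, hence on `ℝ` by density, and its discriminant is
nonpositive. Rational `q` allow a single null set for all of them. -/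
lemma sq_le_mul_of_forall_rat {L c G r : ℝ} (hL : 0 ≤ L) (hc : 0 ≤ c) (hG : 0 ≤ G) (hr : 0 ≤ r)
    (h : ∀ q : ℚ, 0 < q → 2 * L ≤ c * (q * G + (q : ℝ)⁻¹ * r)) : L ^ 2 ≤ c ^ 2 * (G * r) := by
  have hcl : IsClosed {x : ℝ | 0 ≤ (c * G) * (x * x) + (-2 * L) * x + c * r} :=
    isClosed_le continuous_const (by fun_prop)
  have hall : ∀ x : ℝ, 0 ≤ (c * G) * (x * x) + (-2 * L) * x + c * r := by
    refine fun x ↦ isClosed_property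
      (p := fun x ↦ 0 ≤ (c * G) * (x * x) + (-2 * L) * x + c * r) Rat.denseRange_cast hcl ?_ x
    intro q
    have hcG := mul_nonneg hc hG
    have hcr := mul_nonneg hc hr
    rcases lt_or_ge 0 q with hq | hq
    · have hq' : (0 : ℝ) < q := by exact_mod_cast hq
      have := mul_le_mul_of_nonneg_left (h q hq) hq'.le
      have hinv : (q : ℝ) * (q : ℝ)⁻¹ = 1 := mul_inv_cancel₀ hq'.ne'
      have e : (q : ℝ) * (c * (q * G + (q : ℝ)⁻¹ * r)) =
        c * G * (q * q) + (q * (q : ℝ)⁻¹) * (c * r) := by ring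
      rw [e, hinv] at this
      linarith
    · have hq' : (q : ℝ) ≤ 0 := by exact_mod_cast hq
      have h1 := mul_nonneg hL (neg_nonneg.2 hq')
      have h2 := mul_nonneg hcG (mul_self_nonneg (q : ℝ))
      linarith
  have := discrim_le_zero hall
  rw [discrim] at this
  nlinarith

/-- If `L` is the length of the levels of `u` up to a factor `c`, then `L²` is bounded by the flux
through the level times the density of the distribution of `u`. -/
lemma WeakEquation.ae_sq_le [IsFiniteMeasure μ] {u a D : X → ℝ} {K : ℝ}
    (h : WeakEquation μ u a D) (hu : Measurable u) (h0 : ∀ x, 0 ≤ u x) (hK : ∀ x, u x ≤ K)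
    (ha : Integrable a μ) (ham : Measurable a) (hD : ∀ x, 0 ≤ D x) (hDm : Measurable D) {ε : ℝ}
    (hε : 0 < ε) (hDi : IntegrableOn D {x | ε ≤ u x} μ) {L : ℝ → ℝ≥0∞} (hL : Measurable L) {c : ℝ}
    (hc : 0 ≤ c) (hcoarea : ∀ B, MeasurableSet B → ∫⁻ t in B, L t ≤
      ENNReal.ofReal c * ∫⁻ x in u ⁻¹' B, ENNReal.ofReal √(D x) ∂μ) :
    ∀ᵐ t, ε < t → L t ≠ ⊤ ∧
      (L t).toReal ^ 2 ≤ c ^ 2 * ((∫ x in {x | t ≤ u x}, a x ∂μ) *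
        ((μ.map u).rnDeriv volume t).toReal) := by
  set G : ℝ → ℝ := fun t ↦ ∫ x in {x | t ≤ u x}, a x ∂μ with hG
  have hGm : Measurable G := measurable_setIntegral_ge hu ham
  set ρ := (μ.map u).rnDeriv volume with hρ
  have hρm : Measurable ρ := Measure.measurable_rnDeriv _ _
  -- `S` has full Lebesgue measure and is null for the singular part of the law of `u`, so on `S`
  -- the law is exactly `ρ dt`.
  obtain ⟨S, hS, hS1, hS2⟩ := Measure.mutuallySingular_singularPart (μ.map u) volume
  have hν : ∀ B, MeasurableSet B → B ⊆ S → (μ.map u) B = ∫⁻ t in B, ρ t := by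
    intro B hB hBS
    conv_lhs => rw [Measure.haveLebesgueDecomposition_add (μ.map u) volume]
    rw [Measure.add_apply, withDensity_apply _ hB, measure_mono_null hBS hS1, zero_add]
  -- Cauchy-Schwarz in the form `2√D ≤ qD + 1/q`, integrated over `u ⁻¹' B'`: the energy becomes `∫
  -- G` and the area becomes `∫ ρ`. As `B` is arbitrary, the inequality holds pointwise almost
  -- everywhere.
  have hmain : ∀ q : ℚ, 0 < q → ∀ᵐ t ∂(volume.restrict (Ioi ε ∩ S)),
      2 * L t ≤ ENNReal.ofReal c * (ENNReal.ofReal q * ENNReal.ofReal (G t) +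
        ENNReal.ofReal (q : ℝ)⁻¹ * ρ t) := by
    intro q hq
    have hq' : (0 : ℝ) < q := by exact_mod_cast hq
    refine ae_le_of_forall_setLIntegral_le_of_sigmaFinite (hL.const_mul 2) fun B hB _ ↦ ?_
    rw [Measure.restrict_restrict hB]
    set B' := B ∩ (Ioi ε ∩ S) with hB'
    have hB'm : MeasurableSet B' := hB.inter (measurableSet_Ioi.inter hS)
    have hE := h.lintegral_preimage_le hu h0 hK ha ham hD hDm hε hDi hB'm fun t ht ↦ ht.2.1
    have hN : μ (u ⁻¹' B') = ∫⁻ t in B', ρ t := by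
      rw [← hν B' hB'm fun t ht ↦ ht.2.2, Measure.map_apply hu hB'm]
    calc ∫⁻ t in B', 2 * L t = 2 * ∫⁻ t in B', L t := lintegral_const_mul _ hL
      _ ≤ 2 * (ENNReal.ofReal c * ∫⁻ x in u ⁻¹' B', ENNReal.ofReal √(D x) ∂μ) := by
          gcongr; exact hcoarea B' hB'm
      _ = ENNReal.ofReal c * ∫⁻ x in u ⁻¹' B', 2 * ENNReal.ofReal √(D x) ∂μ := by
          rw [lintegral_const_mul _ (by fun_prop)]; ring
      _ ≤ ENNReal.ofReal c * ∫⁻ x in u ⁻¹' B', (ENNReal.ofReal q * ENNReal.ofReal (D x) +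
            ENNReal.ofReal (q : ℝ)⁻¹) ∂μ := by
          gcongr with x
          rw [← ENNReal.ofReal_mul hq'.le, ← ENNReal.ofReal_add (mul_nonneg hq'.le (hD x))
            (inv_nonneg.2 hq'.le), ← ENNReal.ofReal_ofNat 2, ← ENNReal.ofReal_mul (by norm_num)]
          refine ENNReal.ofReal_le_ofReal ?_
          have h1 := Real.sq_sqrt (hD x)
          have h2 : (q : ℝ) * (q : ℝ)⁻¹ = 1 := mul_inv_cancel₀ hq'.ne'
          have h3 : 0 ≤ (q : ℝ)⁻¹ * (q * √(D x) - 1) ^ 2 :=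
            mul_nonneg (inv_nonneg.2 hq'.le) (sq_nonneg _)
          have h4 : (q : ℝ)⁻¹ * (q * √(D x) - 1) ^ 2 = (q * (q : ℝ)⁻¹) * (q * √(D x) ^ 2) -
            2 * (q * (q : ℝ)⁻¹) * √(D x) + (q : ℝ)⁻¹ := by ring
          rw [h4, h2, h1] at h3
          linarith
      _ = ENNReal.ofReal c * (ENNReal.ofReal q * ∫⁻ x in u ⁻¹' B', ENNReal.ofReal (D x) ∂μ +
            ENNReal.ofReal (q : ℝ)⁻¹ * μ (u ⁻¹' B')) := by
          rw [lintegral_add_right _ measurable_const, lintegral_const_mul _ (by fun_prop),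
            lintegral_const, Measure.restrict_apply_univ]
      _ ≤ ENNReal.ofReal c * (ENNReal.ofReal q * (∫⁻ t in B', ENNReal.ofReal (G t)) +
            ENNReal.ofReal (q : ℝ)⁻¹ * ∫⁻ t in B', ρ t) := by
          rw [hN]; gcongr
      _ = _ := by
          rw [lintegral_const_mul _ (by fun_prop),
            lintegral_add_right _ (hρm.const_mul _), lintegral_const_mul _ hGm.ennreal_ofReal,
            lintegral_const_mul _ hρm]
  have hall := ae_all_iff.2 fun q : ℚ ↦ ae_all_iff.2 fun hq : 0 < q ↦ hmain q hq
  rw [ae_restrict_iff' (measurableSet_Ioi.inter hS)] at hall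
  have hSae : ∀ᵐ t, t ∈ S := hS2
  filter_upwards [hall, hSae, Measure.rnDeriv_lt_top (μ.map u) volume] with t ht htS hρt hεt
  have htt := ht ⟨hεt, htS⟩
  have hG0 : 0 ≤ G t := h.setIntegral_ge_nonneg hu hD ha (hε.trans hεt)
  obtain ⟨r, hr⟩ : ∃ r : ℝ≥0, ρ t = r := ⟨_, (ENNReal.coe_toNNReal hρt.ne).symm⟩
  have hLt : L t ≠ ⊤ := by
    intro htop
    have := htt 1 one_pos
    rw [htop, hr, ENNReal.mul_top two_ne_zero, top_le_iff] at this
    exact absurd this (by finiteness)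
  refine ⟨hLt, sq_le_mul_of_forall_rat ENNReal.toReal_nonneg hc hG0 ENNReal.toReal_nonneg
    fun q hq ↦ ?_⟩
  have hq' : (0 : ℝ) < q := by exact_mod_cast hq
  have h1 := ENNReal.toReal_mono (by rw [hr]; finiteness) (htt q hq)
  rwa [ENNReal.toReal_mul, ENNReal.toReal_mul, ENNReal.toReal_add (by finiteness)
    (by rw [hr]; finiteness), ENNReal.toReal_mul, ENNReal.toReal_mul, ENNReal.toReal_ofReal hc,
    ENNReal.toReal_ofReal hq'.le, ENNReal.toReal_ofReal hG0,
    ENNReal.toReal_ofReal (inv_nonneg.2 hq'.le), ENNReal.toReal_ofNat] at h1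

end Distribution

/-! ### Integration of the differential inequality against `e^{2t}`. -/

section Comparison

variable {X : Type*} [MeasurableSpace X] {μ : Measure X}

/-- The weight of a pair of points which counts a pair of increasing values twice and a pair of
equal values once. -/
def orderWeight (u : X → ℝ) (p : X × X) : ℝ :=
  {p : X × X | u p.1 ≤ u p.2}.indicator (fun _ ↦ 1) p +
    {p : X × X | u p.1 < u p.2}.indicator (fun _ ↦ 1) p

lemma measurable_orderWeight {u : X → ℝ} (hu : Measurable u) : Measurable (orderWeight u) :=
  (measurable_const.indicator (measurableSet_le (hu.comp measurable_fst)
    (hu.comp measurable_snd))).add (measurable_const.indicator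
      (measurableSet_lt (hu.comp measurable_fst) (hu.comp measurable_snd)))

lemma orderWeight_cases (u : X → ℝ) (p : X × X) :
    (u p.1 < u p.2 ∧ orderWeight u p = 2 ∧ orderWeight u p.swap = 0) ∨
    (u p.1 = u p.2 ∧ orderWeight u p = 1 ∧ orderWeight u p.swap = 1) ∨
    (u p.2 < u p.1 ∧ orderWeight u p = 0 ∧ orderWeight u p.swap = 2) := by
  simp only [orderWeight, indicator, mem_ofPred_eq, Prod.fst_swap, Prod.snd_swap]
  rcases lt_trichotomy (u p.1) (u p.2) with h | h | h
  · exact Or.inl ⟨h, by simp [h, h.le]; norm_num, by simp [h.not_ge, h.not_gt]⟩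
  · exact Or.inr (Or.inl ⟨h, by simp [h], by simp [h]⟩)
  · exact Or.inr (Or.inr ⟨h, by simp [h.not_ge, h.not_gt], by simp [h, h.le]; norm_num⟩)

lemma integrable_of_measurable_of_bound {Y : Type*} [MeasurableSpace Y] {η : Measure Y}
    [IsFiniteMeasure η] {F : Y → ℝ} (hF : Measurable F) (C : ℝ) (h : ∀ y, |F y| ≤ C) :
    Integrable F η :=
  Integrable.of_bound hF.aestronglyMeasurable C (Eventually.of_forall h)

/-- Average over the exchange of the two points. The weights of a pair and of its swap sum to `2`,
which settles the symmetric kernel; for the other one, what remains is `e^{2u}` at the point with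
the smaller value, counted twice. -/
lemma integral_exp_mul_orderWeight [IsFiniteMeasure μ] {u : X → ℝ} {K : ℝ} (hu : Measurable u)
    (hK : ∀ x, u x ≤ K) :
    Integrable (fun p ↦ Real.exp (2 * u p.1) * Real.exp (2 * u p.2) * orderWeight u p) (μ.prod μ) ∧
    Integrable (fun p ↦ Real.exp (2 * u p.1) * orderWeight u p) (μ.prod μ) ∧
    ∫ p, Real.exp (2 * u p.1) * Real.exp (2 * u p.2) * orderWeight u p ∂(μ.prod μ) =
      (∫ x, Real.exp (2 * u x) ∂μ) ^ 2 ∧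
    ∫ p, Real.exp (2 * u p.1) * orderWeight u p ∂(μ.prod μ) =
      ∫ p, Real.exp (2 * min (u p.1) (u p.2)) ∂(μ.prod μ) := by
  have hPm := measurable_orderWeight hu
  have hP : ∀ p, 0 ≤ orderWeight u p ∧ orderWeight u p ≤ 2 := fun p ↦ by
    rcases orderWeight_cases u p with ⟨-, h, -⟩ | ⟨-, h, -⟩ | ⟨-, h, -⟩ <;> rw [h] <;> norm_num
  have hexp : ∀ x, Real.exp (2 * u x) ≤ Real.exp (2 * K) := fun x ↦
    Real.exp_le_exp.2 (by linarith [hK x])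
  have hi1 : Integrable (fun p ↦ Real.exp (2 * u p.1) * Real.exp (2 * u p.2) * orderWeight u p)
      (μ.prod μ) := by
    refine integrable_of_measurable_of_bound (by fun_prop)
      (Real.exp (2 * K) * Real.exp (2 * K) * 2) fun p ↦ ?_
    rw [abs_of_nonneg (mul_nonneg (by positivity) (hP p).1)]
    exact mul_le_mul (mul_le_mul (hexp _) (hexp _) (by positivity) (by positivity)) (hP p).2
      (hP p).1 (by positivity)
  have hi2 : Integrable (fun p ↦ Real.exp (2 * u p.1) * orderWeight u p) (μ.prod μ) := by
    refine integrable_of_measurable_of_bound (by fun_prop) (Real.exp (2 * K) * 2) fun p ↦ ?_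
    rw [abs_of_nonneg (mul_nonneg (by positivity) (hP p).1)]
    exact mul_le_mul (hexp _) (hP p).2 (hP p).1 (by positivity)
  refine ⟨hi1, hi2, ?_, ?_⟩
  · have h1 := integral_prod_swap (μ := μ) (ν := μ)
      (fun p ↦ Real.exp (2 * u p.1) * Real.exp (2 * u p.2) * orderWeight u p)
    have h2 := integral_add hi1 hi1.swap
    simp only [Function.comp_apply] at h2
    have h3 : ∀ p : X × X, Real.exp (2 * u p.1) * Real.exp (2 * u p.2) * orderWeight u p +
        Real.exp (2 * u p.swap.1) * Real.exp (2 * u p.swap.2) * orderWeight u p.swap =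
        2 * (Real.exp (2 * u p.1) * Real.exp (2 * u p.2)) := fun p ↦ by
      rcases orderWeight_cases u p with ⟨-, h, h'⟩ | ⟨-, h, h'⟩ | ⟨-, h, h'⟩ <;>
        rw [h, h', Prod.fst_swap, Prod.snd_swap] <;> ring
    simp_rw [h3] at h2
    rw [integral_const_mul, integral_prod_mul (fun x ↦ Real.exp (2 * u x))
      (fun x ↦ Real.exp (2 * u x)), h1] at h2
    linarith
  · have h1 := integral_prod_swap (μ := μ) (ν := μ)
      (fun p ↦ Real.exp (2 * u p.1) * orderWeight u p)
    have h2 := integral_add hi2 hi2.swap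
    simp only [Function.comp_apply] at h2
    have h3 : ∀ p : X × X, Real.exp (2 * u p.1) * orderWeight u p +
        Real.exp (2 * u p.swap.1) * orderWeight u p.swap =
        2 * Real.exp (2 * min (u p.1) (u p.2)) := fun p ↦ by
      rcases orderWeight_cases u p with ⟨hu, h, h'⟩ | ⟨hu, h, h'⟩ | ⟨hu, h, h'⟩ <;>
        rw [h, h', Prod.fst_swap]
      · rw [min_eq_left hu.le]; ring
      · rw [hu, min_self]; ring
      · rw [min_eq_right hu.le]; ring
    simp_rw [h3] at h2
    rw [integral_const_mul, h1] at h2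
    linarith

/-- The mean of the right and left values at `t` of `β + ∫_{u > t} (λ e^{2u} - κ)`. -/
def meanFlux (μ : Measure X) (u : X → ℝ) (κ lam β t : ℝ) : ℝ :=
  β + ((∫ x in {x | t ≤ u x}, (lam * Real.exp (2 * u x) - κ) ∂μ) +
    ∫ x in {x | t < u x}, (lam * Real.exp (2 * u x) - κ) ∂μ) / 2

lemma measurable_meanFlux [SFinite μ] {u : X → ℝ} (hu : Measurable u) (κ lam β : ℝ) :
    Measurable (meanFlux μ u κ lam β) := by
  have hb : Measurable fun x ↦ lam * Real.exp (2 * u x) - κ := by fun_prop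
  exact measurable_const.add (((measurable_setIntegral_ge hu hb).add
    (measurable_setIntegral_gt hu hb)).div_const 2)

lemma integrable_exp [IsFiniteMeasure μ] {u : X → ℝ} {K : ℝ} (hu : Measurable u)
    (hK : ∀ x, u x ≤ K) : Integrable (fun x ↦ Real.exp (2 * u x)) μ :=
  integrable_of_measurable_of_bound (by fun_prop) (Real.exp (2 * K)) fun x ↦ by
    rw [Real.abs_exp]; exact Real.exp_le_exp.2 (by linarith [hK x])

lemma exists_bound_meanFlux [IsFiniteMeasure μ] {u : X → ℝ} {K : ℝ} (hu : Measurable u)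
    (hK : ∀ x, u x ≤ K) (κ lam β : ℝ) : ∃ C, ∀ t, |meanFlux μ u κ lam β t| ≤ C := by
  have hb : Integrable (fun x ↦ lam * Real.exp (2 * u x) - κ) μ :=
    ((integrable_exp hu hK).const_mul lam).sub (integrable_const κ)
  have hset : ∀ s : Set X, |∫ x in s, (lam * Real.exp (2 * u x) - κ) ∂μ| ≤
      ∫ x, |lam * Real.exp (2 * u x) - κ| ∂μ := fun s ↦
    (abs_integral_le_integral_abs).trans
      (setIntegral_le_integral hb.abs (Eventually.of_forall fun x ↦ abs_nonneg _))
  refine ⟨|β| + (∫ x, |lam * Real.exp (2 * u x) - κ| ∂μ), fun t ↦ ?_⟩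
  have h1 := abs_le.1 (hset {x | t ≤ u x})
  have h2 := abs_le.1 (hset {x | t < u x})
  have h3 := neg_abs_le β
  have h4 := le_abs_self β
  rw [abs_le, meanFlux]
  constructor <;> linarith [h1.1, h1.2, h2.1, h2.2]

/-- By Fubini the two set integrals in the mean flux combine into a double integral with weight
`orderWeight`. Thanks to the mean, this is exact even if `u` has level sets of positive area. -/
lemma integral_exp_mul_meanFlux [IsFiniteMeasure μ] {u : X → ℝ} {K : ℝ} (hu : Measurable u)
    (hK : ∀ x, u x ≤ K) (κ lam β : ℝ) :
    ∫ x, Real.exp (2 * u x) * meanFlux μ u κ lam β (u x) ∂μ =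
      β * (∫ x, Real.exp (2 * u x) ∂μ) + (lam * (∫ x, Real.exp (2 * u x) ∂μ) ^ 2 -
        κ * ∫ p, Real.exp (2 * min (u p.1) (u p.2)) ∂(μ.prod μ)) / 2 := by
  obtain ⟨hi1, hi2, h1, h2⟩ := integral_exp_mul_orderWeight (μ := μ) hu hK
  have hb : Integrable (fun x ↦ lam * Real.exp (2 * u x) - κ) μ :=
    ((integrable_exp hu hK).const_mul lam).sub (integrable_const κ)
  have hi : Integrable (fun p ↦ lam * (Real.exp (2 * u p.1) * Real.exp (2 * u p.2) *
      orderWeight u p) - κ * (Real.exp (2 * u p.1) * orderWeight u p)) (μ.prod μ) :=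
    (hi1.const_mul lam).sub (hi2.const_mul κ)
  have hJ := integral_sub (hi1.const_mul lam) (hi2.const_mul κ)
  rw [integral_const_mul, integral_const_mul, h1, h2, integral_prod _ hi] at hJ
  have hx : ∀ x, Real.exp (2 * u x) * meanFlux μ u κ lam β (u x) =
      β * Real.exp (2 * u x) + (∫ y, (lam * (Real.exp (2 * u x) * Real.exp (2 * u y) *
        orderWeight u (x, y)) - κ * (Real.exp (2 * u x) * orderWeight u (x, y))) ∂μ) / 2 := by
    intro x
    have hge : MeasurableSet {y | u x ≤ u y} := measurableSet_le measurable_const hu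
    have hgt : MeasurableSet {y | u x < u y} := measurableSet_lt measurable_const hu
    rw [meanFlux, ← integral_indicator hge, ← integral_indicator hgt,
      ← integral_add (hb.indicator hge) (hb.indicator hgt), mul_add, mul_comm, mul_div_assoc',
      ← integral_const_mul]
    congr 2
    refine integral_congr_ae (Eventually.of_forall fun y ↦ ?_)
    simp only [orderWeight, indicator, mem_ofPred_eq]
    split_ifs <;> ring
  simp_rw [hx]
  rw [integral_add ((integrable_exp hu hK).const_mul β) (hi.integral_prod_left.div_const 2),
    integral_const_mul, integral_div, hJ]

lemma ae_measure_level_eq_zero [SFinite μ] {u : X → ℝ} (hu : Measurable u) :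
    ∀ᵐ t : ℝ, μ {x | u x = t} = 0 := by
  refine measure_mono_null (fun t ht ↦ ?_)
    ((Measure.countable_meas_level_set_pos (μ := μ) hu).measure_zero _)
  exact pos_iff_ne_zero.2 ht

/-- Only countably many levels have positive measure, so against Lebesgue measure the mean and the
one-sided flux coincide. -/
lemma ae_meanFlux_eq [SFinite μ] {u : X → ℝ} (hu : Measurable u) (κ lam β : ℝ) :
    ∀ᵐ t : ℝ, meanFlux μ u κ lam β t =
      β + ∫ x in {x | t ≤ u x}, (lam * Real.exp (2 * u x) - κ) ∂μ := by
  filter_upwards [ae_measure_level_eq_zero (μ := μ) hu] with t ht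
  have : ({x | t < u x} : Set X) =ᵐ[μ] {x | t ≤ u x} := by
    have hne : ∀ᵐ x ∂μ, u x ≠ t := by
      rw [ae_iff]; simpa using ht
    filter_upwards [hne] with x hx
    exact propext ⟨le_of_lt, fun h ↦ lt_of_le_of_ne h (Ne.symm hx)⟩
  rw [meanFlux, setIntegral_congr_set this]
  ring

/-- The comparison inequality obtained by integrating a differential inequality for the
distribution function of `u` against `e^{2t}`. -/
theorem exp_comparison [IsFiniteMeasure μ] {u : X → ℝ} {K T κ lam β : ℝ} (hu : Measurable u)
    (h0 : ∀ x, 0 ≤ u x) (hpos : ∀ᵐ x ∂μ, 0 < u x) (hK : ∀ x, u x ≤ K)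
    (hge : ∀ t > 0, 0 ≤ β + ∫ x in {x | t ≤ u x}, (lam * Real.exp (2 * u x) - κ) ∂μ)
    (hgt : ∀ t > 0, 0 ≤ β + ∫ x in {x | t < u x}, (lam * Real.exp (2 * u x) - κ) ∂μ)
    (hiso : ∀ᵐ t, 0 < t → T * μ.real {x | t ≤ u x} - κ * μ.real {x | t ≤ u x} ^ 2 ≤
      (β + ∫ x in {x | t ≤ u x}, (lam * Real.exp (2 * u x) - κ) ∂μ) *
        ((μ.map u).rnDeriv volume t).toReal) :
    T * ((∫ x, Real.exp (2 * u x) ∂μ) - μ.real univ) + κ * μ.real univ ^ 2 ≤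
      2 * β * (∫ x, Real.exp (2 * u x) ∂μ) + lam * (∫ x, Real.exp (2 * u x) ∂μ) ^ 2 := by
  set ρ := (μ.map u).rnDeriv volume with hρ
  set H := meanFlux μ u κ lam β with hH
  have hHm : Measurable H := measurable_meanFlux hu κ lam β
  obtain ⟨C, hC⟩ := exists_bound_meanFlux (μ := μ) hu hK κ lam β
  have hH0 : ∀ t > 0, 0 ≤ H t := fun t ht ↦ by
    have h1 := hge t ht
    have h2 := hgt t ht
    rw [hH, meanFlux]
    linarith
  set g : ℝ → ℝ := (Ioc 0 K).indicator fun t ↦ Real.exp (2 * t) * H t with hg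
  have hgm : Measurable g :=
    Measurable.indicator (by fun_prop) measurableSet_Ioc
  have hg0 : ∀ t, 0 ≤ g t := fun t ↦ indicator_nonneg
    (fun t ht ↦ mul_nonneg (Real.exp_pos _).le (hH0 t ht.1)) t
  have hgb : ∀ t, |g t| ≤ Real.exp (2 * K) * C := fun t ↦ by
    by_cases ht : t ∈ Ioc 0 K
    · rw [hg, indicator_of_mem ht, abs_mul, Real.abs_exp]
      exact mul_le_mul (Real.exp_le_exp.2 (by linarith [ht.2])) (hC t) (abs_nonneg _)
        (Real.exp_pos _).le
    · rw [hg, indicator_of_notMem ht, abs_zero]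
      exact mul_nonneg (Real.exp_pos _).le ((abs_nonneg _).trans (hC 0))
  have hρi : Integrable (fun t ↦ (ρ t).toReal) volume := Measure.integrable_toReal_rnDeriv
  have hgρ : Integrable (fun t ↦ (ρ t).toReal * g t) volume :=
    hρi.mul_bdd (c := Real.exp (2 * K) * C) hgm.aestronglyMeasurable (Eventually.of_forall hgb)
  -- `ρ dt` is dominated by the law of `u` and `g ≥ 0`, so the singular part can only increase the
  -- right side.
  have hupper : ∫ t, (ρ t).toReal * g t ≤
      ∫ x, Real.exp (2 * u x) * H (u x) ∂μ := by
    calc ∫ t, (ρ t).toReal * g t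
        = ∫ t, g t ∂(volume.withDensity ρ) :=
          (integral_withDensity_eq_integral_toReal_smul (Measure.measurable_rnDeriv _ _)
            (Measure.rnDeriv_lt_top _ _) g).symm
      _ ≤ ∫ t, g t ∂(μ.map u) := integral_mono_measure (Measure.withDensity_rnDeriv_le _ _)
          (Eventually.of_forall hg0) (integrable_of_measurable_of_bound hgm _ hgb)
      _ = ∫ x, g (u x) ∂μ := integral_map hu.aemeasurable hgm.aestronglyMeasurable
      _ = ∫ x, Real.exp (2 * u x) * H (u x) ∂μ := by
          refine integral_congr_ae ?_
          filter_upwards [hpos] with x hx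
          exact indicator_of_mem (s := Ioc 0 K) ⟨hx, hK x⟩ _
  have hmm : Measurable fun t ↦ μ.real {x | t ≤ u x} := by
    simpa using measurable_setIntegral_ge (μ := μ) hu (b := fun _ ↦ (1 : ℝ)) measurable_const
  have hmi : ∀ k : ℕ, Integrable (fun t ↦ Real.exp (2 * t) * μ.real {x | t ≤ u x} ^ k)
      (volume.restrict (Ioc 0 K)) := fun k ↦ by
    have hcont : Continuous fun t : ℝ ↦ Real.exp (2 * t) := by fun_prop
    refine ((hcont.integrableOn_Icc (a := 0) (b := K)).mono_set Ioc_subset_Icc_self).mul_bdd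
      (c := μ.real univ ^ k) (hmm.pow_const k).aestronglyMeasurable (Eventually.of_forall fun t ↦ ?_)
    rw [Real.norm_eq_abs, abs_of_nonneg (by positivity)]
    exact pow_le_pow_left₀ measureReal_nonneg (measureReal_mono (subset_univ _)) k
  have hlower : ∫ t in Ioc 0 K, (T * (Real.exp (2 * t) * μ.real {x | t ≤ u x} ^ 1) -
      κ * (Real.exp (2 * t) * μ.real {x | t ≤ u x} ^ 2)) ≤ ∫ t, (ρ t).toReal * g t := by
    have hsupp : ∫ t, (ρ t).toReal * g t = ∫ t in Ioc 0 K, (ρ t).toReal * g t := by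
      refine (setIntegral_eq_integral_of_forall_compl_eq_zero fun t ht ↦ ?_).symm
      rw [hg, indicator_of_notMem ht, mul_zero]
    rw [hsupp]
    refine integral_mono_ae (((hmi 1).const_mul T).sub ((hmi 2).const_mul κ)) hgρ.integrableOn ?_
    filter_upwards [ae_restrict_mem measurableSet_Ioc, ae_restrict_of_ae hiso,
      ae_restrict_of_ae (ae_meanFlux_eq (μ := μ) hu κ lam β)] with t ht hit hHt
    rw [hg, indicator_of_mem ht, hH, hHt]
    have := mul_le_mul_of_nonneg_left (hit ht.1) (Real.exp_pos (2 * t)).le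
    linarith
  rw [integral_sub ((hmi 1).const_mul T) ((hmi 2).const_mul κ), integral_const_mul,
    integral_const_mul] at hlower
  simp_rw [pow_one] at hlower
  rw [integral_exp_mul_measureReal hu h0 hK] at hlower
  -- `m(t)²` is the product measure of the pairs whose minimum is at least `t`, so the layer cake
  -- formula on the product yields `∬ e^{2 min}`.
  have hsq : ∀ t, μ.real {x | t ≤ u x} ^ 2 =
      (μ.prod μ).real {p : X × X | t ≤ min (u p.1) (u p.2)} := fun t ↦ by
    have : {p : X × X | t ≤ min (u p.1) (u p.2)} = {x | t ≤ u x} ×ˢ {x | t ≤ u x} := by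
      ext p; simp
    rw [this, measureReal_prod_prod, sq]
  simp_rw [hsq] at hlower
  rw [integral_exp_mul_measureReal (μ := μ.prod μ) (u := fun p ↦ min (u p.1) (u p.2))
    (by fun_prop) (fun p ↦ le_min (h0 _) (h0 _)) (fun p ↦ (min_le_left _ _).trans (hK _)),
    ← univ_prod_univ, measureReal_prod_prod] at hlower
  rw [hH, integral_exp_mul_meanFlux hu hK κ lam β] at hupper
  -- The term `κ ∬ e^{2 min}` occurs on both sides with the same coefficient and cancels, whatever
  -- the sign of `κ`.
  nlinarith [hlower.trans hupper]

end Comparison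

/-! ### The weak equation for functions of `u`. -/

section WeakEquation

variable {M : Type*} [TopologicalSpace M] [T2Space M] [SecondCountableTopology M]
  [ChartedSpace Plane M] [IsManifold (𝓡 2) ∞ M]
  [RiemannianBundle (fun x : M ↦ TangentSpace (𝓡 2) x)]

lemma gradInner_congr {u φ φ' : M → ℝ} {p : M} (h : φ =ᶠ[𝓝 p] φ') :
    gradInner u φ p = gradInner u φ' p := by
  have h' : φ ∘ (extChartAt (𝓡 2) p).symm =ᶠ[𝓝 (extChartAt (𝓡 2) p p)]
      φ' ∘ (extChartAt (𝓡 2) p).symm := by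
    have hc := continuousAt_extChartAt_symm (I := 𝓡 2) p
    rw [ContinuousAt, extChartAt_to_inv] at hc
    exact hc.eventually h
  simp only [gradInner, chartGradInner, partialDeriv, h'.fderiv_eq]

variable [IsContMDiffRiemannianBundle (𝓡 2) ∞ Plane (fun x : M ↦ TangentSpace (𝓡 2) x)]
  [MeasurableSpace M] [BorelSpace M]

/-- The weak form of `-Δu = a` for test functions of the form `ψ ∘ u`, with `ψ` vanishing below a
level whose superlevel set is compact. -/
lemma integral_deriv_comp_mul_gradInner {u : M → ℝ} {Ω : Set M} (hΩ : IsOpen Ω)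
    (hu : ContMDiffOn (𝓡 2) 𝓘(ℝ, ℝ) ∞ u Ω) {ε : ℝ} (hE : IsCompact {q ∈ Ω | ε ≤ u q})
    {ψ ψ' : ℝ → ℝ} (hψ : ∀ t, HasDerivAt ψ (ψ' t) t) (hψ' : Continuous ψ')
    (h0 : ∀ t ≤ ε, ψ t = 0) :
    ∫ p in Ω, ψ' (u p) * gradInner u u p ∂(area M) =
      ∫ p in Ω, -laplacian u p * ψ (u p) ∂(area M) := by
  set φ : M → ℝ := Ω.indicator (ψ ∘ u) with hφ
  have hts : tsupport φ ⊆ {q ∈ Ω | ε ≤ u q} := by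
    refine closure_minimal (fun q hq ↦ ?_) hE.isClosed
    have hqΩ : q ∈ Ω := by
      by_contra h
      exact hq (indicator_of_notMem h _)
    refine ⟨hqΩ, ?_⟩
    by_contra h
    refine hq ?_
    rw [hφ, indicator_of_mem hqΩ]
    exact h0 _ (not_le.1 h).le
  have hsub : tsupport φ ⊆ Ω := fun q hq ↦ (hts hq).1
  have heq : ∀ p ∈ Ω, φ =ᶠ[𝓝 p] ψ ∘ u := fun p hp ↦ by
    filter_upwards [hΩ.mem_nhds hp] with q hq
    exact indicator_of_mem hq _
  have hψc : ContDiff ℝ 1 ψ := by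
    rw [contDiff_one_iff_deriv]
    refine ⟨fun t ↦ (hψ t).differentiableAt, ?_⟩
    rwa [show deriv ψ = ψ' from funext fun t ↦ (hψ t).deriv]
  have hu1 : ∀ p ∈ Ω, ContMDiffAt (𝓡 2) 𝓘(ℝ, ℝ) 1 u p := fun p hp ↦
    (hu.contMDiffAt (hΩ.mem_nhds hp)).of_le (by norm_cast)
  have hφ1 : ContMDiff (𝓡 2) 𝓘(ℝ, ℝ) 1 φ := by
    intro p
    by_cases hp : p ∈ Ω
    · exact ((hψc.contMDiff.contMDiffAt).comp p (hu1 p hp)).congr_of_eventuallyEq (heq p hp)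
    · exact contMDiffAt_const.congr_of_eventuallyEq
        (notMem_tsupport_iff_eventuallyEq.1 fun h ↦ hp (hsub h))
  have hcs : HasCompactSupport φ := hE.of_isClosed_subset (isClosed_tsupport _) hts
  have key := integral_gradInner hΩ hu hφ1 hcs hsub
  have e1 : (fun p ↦ gradInner u φ p) = Ω.indicator fun p ↦ ψ' (u p) * gradInner u u p := by
    funext p
    by_cases hp : p ∈ Ω
    · rw [indicator_of_mem hp, gradInner_congr (heq p hp), gradInner_comp (hu1 p hp) (hψ _)]
    · rw [indicator_of_notMem hp, gradInner_eq_zero fun h ↦ hp (hsub h)]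
  have e2 : (fun p ↦ laplacian u p * φ p) = Ω.indicator fun p ↦ laplacian u p * ψ (u p) := by
    funext p
    by_cases hp : p ∈ Ω
    · rw [indicator_of_mem hp, hφ, indicator_of_mem hp]; rfl
    · rw [indicator_of_notMem hp, hφ, indicator_of_notMem hp, mul_zero]
  rw [e1, e2, integral_indicator hΩ.measurableSet, integral_indicator hΩ.measurableSet] at key
  rw [key, ← integral_neg]
  simp only [neg_mul]

end WeakEquation

/-! ### Length of almost every level line. -/

section Length

variable {M : Type*} [EMetricSpace M] [SecondCountableTopology M] [ChartedSpace Plane M]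
  [IsManifold (𝓡 2) ∞ M] [RiemannianBundle (fun x : M ↦ TangentSpace (𝓡 2) x)]
  [IsContMDiffRiemannianBundle (𝓡 2) ∞ Plane (fun x : M ↦ TangentSpace (𝓡 2) x)]
  [MeasurableSpace M] [BorelSpace M]

lemma measurable_indicator_of_continuousOn {X : Type*} [TopologicalSpace X] [MeasurableSpace X]
    [BorelSpace X] {Ω : Set X} (hΩ : IsOpen Ω) {F : X → ℝ} (hF : ContinuousOn F Ω) :
    Measurable (Ω.indicator F) := by
  classical
  rw [← piecewise_eq_indicator]
  exact hF.measurable_piecewise continuousOn_const hΩ.measurableSet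

lemma gradNorm_sq {u : M → ℝ} {Ω : Set M} {p : M} (hp : p ∈ Ω) :
    gradNorm Ω u p ^ 2 = gradInner u u p := by
  rw [gradNorm, indicator_of_mem hp, Real.sq_sqrt (gradInner_self_nonneg u p)]

lemma weakEquation {u : M → ℝ} {Ω : Set M} (hΩ : IsOpen Ω)
    (hu : ContMDiffOn (𝓡 2) 𝓘(ℝ, ℝ) ∞ u Ω) (hE : ∀ t > 0, IsCompact {q ∈ Ω | t ≤ u q}) :
    WeakEquation ((area M).restrict Ω) (Ω.indicator u) (Ω.indicator fun p ↦ -laplacian u p)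
      fun p ↦ gradNorm Ω u p ^ 2 := by
  intro ψ ψ' ε hε hψ hψ' h0
  calc ∫ p in Ω, ψ' (Ω.indicator u p) * gradNorm Ω u p ^ 2 ∂(area M)
      = ∫ p in Ω, ψ' (u p) * gradInner u u p ∂(area M) :=
        setIntegral_congr_fun hΩ.measurableSet fun p hp ↦ by
          simp only [indicator_of_mem hp, gradNorm_sq hp]
    _ = ∫ p in Ω, -laplacian u p * ψ (u p) ∂(area M) :=
        integral_deriv_comp_mul_gradInner hΩ hu (hE ε hε) hψ hψ' h0
    _ = _ := setIntegral_congr_fun hΩ.measurableSet fun p hp ↦ by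
          simp only [indicator_of_mem hp]

/-- Continuity of `|∇u|²` in `Ω` suffices on a compact superlevel set; this is why the arguments on
the law of `u` stay above a level `ε > 0`. -/
lemma integrableOn_gradNorm_sq {u : M → ℝ} {Ω : Set M} (hΩ : IsOpen Ω)
    (hu : ContMDiffOn (𝓡 2) 𝓘(ℝ, ℝ) ∞ u Ω) {ε : ℝ} (hε : 0 < ε)
    (hE : IsCompact {q ∈ Ω | ε ≤ u q}) :
    IntegrableOn (fun p ↦ gradNorm Ω u p ^ 2) {p | ε ≤ Ω.indicator u p}
      ((area M).restrict Ω) := by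
  have hset : {p | ε ≤ Ω.indicator u p} = {q ∈ Ω | ε ≤ u q} := by
    ext p
    by_cases hp : p ∈ Ω
    · simp [hp]
    · simp [hp, hε]
  have hu1 : ContMDiffOn (𝓡 2) 𝓘(ℝ, ℝ) 1 u Ω := hu.of_le (by norm_cast)
  have hc : ContinuousOn (fun p ↦ gradNorm Ω u p ^ 2) {q ∈ Ω | ε ≤ u q} :=
    ((continuousOn_gradInner hΩ hu1 hu1).mono fun p hp ↦ hp.1).congr fun p hp ↦ gradNorm_sq hp.1
  rw [hset]
  exact IntegrableOn.mono_measure (hc.integrableOn_compact hE) Measure.restrict_le_self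

variable [IsRiemannianManifold (𝓡 2) M]

/-- The squared length of almost every level line of `u` is bounded by the flux of the gradient
through it times the density of the distribution of `u`. -/
theorem ae_length_sq_le {u : M → ℝ} {Ω : Set M} {K : ℝ} (hΩ : IsOpen Ω)
    [IsFiniteMeasure ((area M).restrict Ω)] (hu : ContMDiffOn (𝓡 2) 𝓘(ℝ, ℝ) ∞ u Ω)
    (hpos : ∀ p ∈ Ω, 0 < u p) (hK : ∀ p, Ω.indicator u p ≤ K)
    (hE : ∀ t > 0, IsCompact {q ∈ Ω | t ≤ u q})
    (ha : Integrable (Ω.indicator fun p ↦ -laplacian u p) ((area M).restrict Ω)) :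
    ∀ᵐ t, 0 < t → (∀ p ∈ Ω, u p = t → derivAt u p ≠ 0) ∧ μH[1] (Ω ∩ u ⁻¹' {t}) ≠ ⊤ ∧
      (μH[1] : Measure M).real (Ω ∩ u ⁻¹' {t}) ^ 2 ≤
        (∫ p in {p | t ≤ Ω.indicator u p}, Ω.indicator (fun p ↦ -laplacian u p) p
          ∂((area M).restrict Ω)) *
        ((((area M).restrict Ω).map (Ω.indicator u)).rnDeriv volume t).toReal := by
  set μ := (area M).restrict Ω with hμ
  set v := Ω.indicator u with hv
  have hvm : Measurable v := measurable_indicator_of_continuousOn hΩ hu.continuousOn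
  have hv0 : ∀ p, 0 ≤ v p := fun p ↦ indicator_nonneg (fun p hp ↦ (hpos p hp).le) p
  have ham : Measurable (Ω.indicator fun p ↦ -laplacian u p) :=
    measurable_indicator_of_continuousOn hΩ (continuousOn_laplacian hΩ hu).neg
  have hgm : Measurable (gradNorm Ω u) := measurable_gradNorm hΩ (hu.of_le (by norm_cast))
  have hg0 : ∀ p, 0 ≤ gradNorm Ω u p := fun p ↦ indicator_nonneg (fun p _ ↦ Real.sqrt_nonneg _) p
  have hw := weakEquation hΩ hu hE
  -- Countably many parameters, coarea factor `c = 1 + 1/(n+1)` and lower level `ε = 1/(k+1)`, so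
  -- that one null set of `t` serves for all. For a given `t > 0`, fix `k` with `1/(k+1) < t` and
  -- let `n → ∞`.
  have hstep : ∀ n k : ℕ, ∃ L : ℝ → ℝ≥0∞,
      (∀ t, μH[1] ({p ∈ Ω | derivAt u p ≠ 0} ∩ u ⁻¹' {t}) ≤ L t) ∧
      ∀ᵐ t, 1 / ((k : ℝ) + 1) < t → L t ≠ ⊤ ∧ (L t).toReal ^ 2 ≤ (1 + 1 / ((n : ℝ) + 1)) ^ 2 *
        ((∫ p in {p | t ≤ v p}, Ω.indicator (fun p ↦ -laplacian u p) p ∂μ) *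
          ((μ.map v).rnDeriv volume t).toReal) := by
    intro n k
    have hn : (0 : ℝ) < 1 / ((n : ℝ) + 1) := by positivity
    have hk : (0 : ℝ) < 1 / ((k : ℝ) + 1) := by positivity
    obtain ⟨L, hLm, hL, hcoarea⟩ := exists_coarea_le hΩ hu (c := 1 + 1 / ((n : ℝ) + 1))
      (by linarith)
    refine ⟨L, hL, hw.ae_sq_le hvm hv0 hK ha ham (fun p ↦ sq_nonneg _) (hgm.pow_const 2) hk
      (integrableOn_gradNorm_sq hΩ hu hk (hE _ hk)) hLm (by linarith) fun B hB ↦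
        (hcoarea B hB).trans_eq ?_⟩
    have hset : v ⁻¹' B ∩ Ω = Ω ∩ u ⁻¹' B := by
      ext p
      by_cases hp : p ∈ Ω
      · simp [hv, hp]
      · simp [hp]
    rw [← hv, Measure.restrict_restrict (hvm hB), hset]
    simp only [Real.sqrt_sq (hg0 _)]
  choose L hL hLae using hstep
  have hcrit : ∀ᵐ t, t ∉ u '' {p ∈ Ω | derivAt u p = 0} :=
    measure_eq_zero_iff_ae_notMem.1 (volume_image_derivAt_eq_zero hΩ hu)
  filter_upwards [ae_all_iff.2 fun n ↦ ae_all_iff.2 fun k ↦ hLae n k, hcrit] with t ht htc ht0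
  have hreg : ∀ p ∈ Ω, u p = t → derivAt u p ≠ 0 := fun p hp hpt h ↦ htc ⟨p, ⟨hp, h⟩, hpt⟩
  have hset : Ω ∩ u ⁻¹' {t} = {p ∈ Ω | derivAt u p ≠ 0} ∩ u ⁻¹' {t} := by
    ext p
    exact ⟨fun h ↦ ⟨⟨h.1, hreg p h.1 h.2⟩, h.2⟩, fun h ↦ ⟨h.1.1, h.2⟩⟩
  obtain ⟨k, hk⟩ := exists_nat_one_div_lt ht0
  refine ⟨hreg, ?_, ?_⟩
  · rw [hset]
    exact ne_top_of_le_ne_top (ht 0 k hk).1 (hL 0 k t)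
  · have hlim : Tendsto (fun n : ℕ ↦ (1 + 1 / ((n : ℝ) + 1)) ^ 2 *
        ((∫ p in {p | t ≤ v p}, Ω.indicator (fun p ↦ -laplacian u p) p ∂μ) *
          ((μ.map v).rnDeriv volume t).toReal)) atTop (𝓝 ((1 + 0) ^ 2 *
        ((∫ p in {p | t ≤ v p}, Ω.indicator (fun p ↦ -laplacian u p) p ∂μ) *
          ((μ.map v).rnDeriv volume t).toReal))) :=
      ((tendsto_one_div_add_atTop_nhds_zero_nat.const_add 1).pow 2).mul_const _
    rw [add_zero, one_pow, one_mul] at hlim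
    refine ge_of_tendsto' hlim fun n ↦ le_trans ?_ (ht n k hk).2
    rw [hset]
    exact pow_le_pow_left₀ measureReal_nonneg (ENNReal.toReal_mono (ht n k hk).1 (hL n k t)) 2

end Length

/-! ### The comparison inequality on the surface. -/

section Main

variable {M : Type*} [EMetricSpace M] [SecondCountableTopology M] [ChartedSpace Plane M]
  [IsManifold (𝓡 2) ∞ M] [RiemannianBundle (fun x : M ↦ TangentSpace (𝓡 2) x)]
  [IsContMDiffRiemannianBundle (𝓡 2) ∞ Plane (fun x : M ↦ TangentSpace (𝓡 2) x)]
  [IsRiemannianManifold (𝓡 2) M] [MeasurableSpace M] [BorelSpace M]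

lemma isFiniteMeasure_area_restrict {Ω : Set M} (hc : IsCompact (closure Ω)) :
    IsFiniteMeasure ((area M).restrict Ω) :=
  ⟨by
    rw [Measure.restrict_apply_univ]
    exact (measure_mono subset_closure).trans_lt hc.measure_lt_top⟩

lemma exists_indicator_le {Ω : Set M} (hc : IsCompact (closure Ω)) {u : M → ℝ}
    (hu : ContinuousOn u (closure Ω)) : ∃ K, ∀ p, Ω.indicator u p ≤ K := by
  obtain ⟨K, hK⟩ := (hc.image_of_continuousOn hu).bddAbove
  refine ⟨max K 0, fun p ↦ ?_⟩
  by_cases hp : p ∈ Ω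
  · rw [indicator_of_mem hp]
    exact (hK (mem_image_of_mem u (subset_closure hp))).trans (le_max_left _ _)
  · rw [indicator_of_notMem hp]
    exact le_max_right _ _

/-- The comparison inequality between the area of `Ω` and its area for the conformal metric
`e^{2u} g`. -/
theorem liouville_comparison {θ κ lam : ℝ} (hθ : 0 ≤ θ) (hiso : IsoperimetricInequality M θ κ)
    {Ω : Set M} (hΩ : IsOpen Ω) (hc : IsCompact (closure Ω)) {u f : M → ℝ}
    (hu : SmoothOnClosure Ω u)
    (heq : ∀ x ∈ Ω, -laplacian u x + κ = lam * Real.exp (2 * u x) + f x)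
    (hbd : ∀ x ∈ frontier Ω, u x = 0) (hpos : ∀ x ∈ Ω, 0 < u x) :
    4 * Real.pi * θ * ((∫ x in Ω, Real.exp (2 * u x) ∂(area M)) - (area M).real Ω) +
        κ * (area M).real Ω ^ 2 ≤
      2 * (∫ x in Ω, max (f x) 0 ∂(area M)) * (∫ x in Ω, Real.exp (2 * u x) ∂(area M)) +
        lam * (∫ x in Ω, Real.exp (2 * u x) ∂(area M)) ^ 2 := by
  have hfin := isFiniteMeasure_area_restrict hc
  obtain ⟨K, hK⟩ := exists_indicator_le hc hu.continuousOn
  obtain ⟨C, hC⟩ := exists_bound_laplacian hΩ hc hu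
  have hE : ∀ t > 0, IsCompact {q ∈ Ω | t ≤ u q} := fun t ht ↦
    isCompact_superlevel hΩ hc hu.continuousOn hbd ht
  set μ := (area M).restrict Ω with hμ
  set v := Ω.indicator u with hv
  set a := Ω.indicator fun p ↦ -laplacian u p with ha
  have hvm : Measurable v := measurable_indicator_of_continuousOn hΩ hu.contMDiffOn.continuousOn
  have hv0 : ∀ p, 0 ≤ v p := fun p ↦ indicator_nonneg (fun p hp ↦ (hpos p hp).le) p
  have ham : Measurable a := measurable_indicator_of_continuousOn hΩ
    (continuousOn_laplacian hΩ hu.contMDiffOn).neg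
  have hai : Integrable a μ := by
    refine integrable_of_measurable_of_bound ham (max C 0) fun p ↦ ?_
    by_cases hp : p ∈ Ω
    · rw [ha, indicator_of_mem hp, abs_neg]
      exact (hC p hp).trans (le_max_left _ _)
    · rw [ha, indicator_of_notMem hp, abs_zero]
      exact le_max_right _ _
  have hbi : Integrable (fun p ↦ lam * Real.exp (2 * v p) - κ) μ :=
    ((integrable_exp hvm hK).const_mul lam).sub (integrable_const κ)
  -- On `Ω` this is `f⁺`, written through `-Δu` and `e^{2u}`, so that its measurability and
  -- integrability follow from those of `u` and `Δu`.
  set F : M → ℝ := fun p ↦ max (a p - (lam * Real.exp (2 * v p) - κ)) 0 with hF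
  have hFi : Integrable F μ := (hai.sub hbi).pos_part
  have hF0 : ∀ p, 0 ≤ F p := fun p ↦ le_max_right _ _
  have hvΩ : ∀ p ∈ Ω, v p = u p := fun p hp ↦ indicator_of_mem hp _
  have hA : ∫ x in Ω, Real.exp (2 * u x) ∂(area M) = ∫ p, Real.exp (2 * v p) ∂μ :=
    setIntegral_congr_fun hΩ.measurableSet fun p hp ↦ by simp only [hvΩ p hp]
  have hΘ : ∫ x in Ω, max (f x) 0 ∂(area M) = ∫ p, F p ∂μ :=
    setIntegral_congr_fun hΩ.measurableSet fun p hp ↦ by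
      have : a p = -laplacian u p := indicator_of_mem hp _
      simp only [hF, hvΩ p hp, this]
      congr 1
      linarith [heq p hp]
  have hm : (area M).real Ω = μ.real univ := by
    rw [hμ, measureReal_restrict_apply_univ]
  -- From `-Δu ≤ f⁺ + λ e^{2u} - κ`, enlarging the integral of `f⁺ ≥ 0` from `s` to all of `Ω`; its
  -- total plays the role of `β`.
  have hcmp : ∀ s : Set M, ∫ p in s, a p ∂μ ≤
      (∫ p, F p ∂μ) + ∫ p in s, (lam * Real.exp (2 * v p) - κ) ∂μ := fun s ↦ by
    calc ∫ p in s, a p ∂μ ≤ ∫ p in s, (F p + (lam * Real.exp (2 * v p) - κ)) ∂μ := by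
          refine integral_mono hai.integrableOn (hFi.integrableOn.add hbi.integrableOn) fun p ↦ ?_
          have : a p - (lam * Real.exp (2 * v p) - κ) ≤ F p := le_max_left _ _
          linarith
      _ = (∫ p in s, F p ∂μ) + ∫ p in s, (lam * Real.exp (2 * v p) - κ) ∂μ :=
          integral_add hFi.integrableOn hbi.integrableOn
      _ ≤ _ := add_le_add (setIntegral_le_integral hFi (Eventually.of_forall hF0)) le_rfl
  have hw := weakEquation hΩ hu.contMDiffOn hE
  rw [hA, hΘ, hm]
  refine exp_comparison hvm hv0 ?_ hK
    (fun t ht ↦ (hw.setIntegral_ge_nonneg hvm (fun p ↦ sq_nonneg _) hai ht).trans (hcmp _))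
    (fun t ht ↦ (hw.setIntegral_gt_nonneg hvm (fun p ↦ sq_nonneg _) hai ht).trans (hcmp _)) ?_
  · filter_upwards [ae_restrict_mem hΩ.measurableSet] with p hp
    rw [hvΩ p hp]
    exact hpos p hp
  · filter_upwards [ae_length_sq_le hΩ hu.contMDiffOn hpos hK hE hai] with t ht ht0
    obtain ⟨hreg, htop, hle⟩ := ht ht0
    have hset : {p | t ≤ v p} ∩ Ω = {q ∈ Ω | t ≤ u q} := by
      ext p
      by_cases hp : p ∈ Ω
      · simp [hvΩ p hp, hp]
      · simp [hp]
    have hmt : μ.real {p | t ≤ v p} = (area M).real {q ∈ Ω | t ≤ u q} := by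
      rw [hμ, measureReal_restrict_apply (measurableSet_le measurable_const hvm), hset]
    rw [hmt]
    exact (isoperimetric_superlevel hθ hiso hΩ hu.contMDiffOn (hE t ht0) hreg htop).trans
      (hle.trans (mul_le_mul_of_nonneg_right (hcmp _) ENNReal.toReal_nonneg))

/-- The conformal factor `e^{2u}` of a positive function `u` increases the area. -/
lemma area_lt_integral_exp {Ω : Set M} (hΩ : IsOpen Ω) (hΩne : Ω.Nonempty)
    (hc : IsCompact (closure Ω)) {u : M → ℝ} (hu : ContinuousOn u (closure Ω))
    (hpos : ∀ x ∈ Ω, 0 < u x) :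
    (area M).real Ω < ∫ x in Ω, Real.exp (2 * u x) ∂(area M) := by
  have hfin := isFiniteMeasure_area_restrict hc
  have hi : IntegrableOn (fun x ↦ Real.exp (2 * u x) - 1) Ω (area M) :=
    ContinuousOn.integrableOn_compact hc (by fun_prop) |>.mono_set subset_closure
  have hi' : IntegrableOn (fun x ↦ Real.exp (2 * u x)) Ω (area M) :=
    ContinuousOn.integrableOn_compact hc (by fun_prop) |>.mono_set subset_closure
  have hp : ∀ x ∈ Ω, 0 < Real.exp (2 * u x) - 1 := fun x hx ↦
    sub_pos.2 (Real.one_lt_exp_iff.2 (mul_pos two_pos (hpos x hx)))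
  have h : 0 < ∫ x in Ω, (Real.exp (2 * u x) - 1) ∂(area M) := by
    rw [setIntegral_pos_iff_support_of_nonneg_ae _ hi]
    · have : Function.support (fun x ↦ Real.exp (2 * u x) - 1) ∩ Ω = Ω :=
        inter_eq_right.2 fun x hx ↦ (hp x hx).ne'
      rw [this]
      exact area_pos_of_isOpen hΩ hΩne
    · filter_upwards [ae_restrict_mem hΩ.measurableSet] with x hx using (hp x hx).le
  rw [integral_sub hi' (integrable_const _)] at h
  simpa using h

end Main

end SphereCovering

end

/-! ### The theorem. -/

theorem theorem3p1 {M : Type*} [EMetricSpace M] [SecondCountableTopology M]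
    [ChartedSpace SphereCovering.Plane M] [IsManifold (𝓡 2) ∞ M]
    [RiemannianBundle (fun x : M ↦ TangentSpace (𝓡 2) x)]
    [IsContMDiffRiemannianBundle (𝓡 2) ∞ SphereCovering.Plane
      (fun x : M ↦ TangentSpace (𝓡 2) x)]
    [IsRiemannianManifold (𝓡 2) M] [MeasurableSpace M] [BorelSpace M]
    (θ κ lam : ℝ) (hθ0 : 0 < θ) (hθ1 : θ ≤ 1)
    (hiso : SphereCovering.IsoperimetricInequality M θ κ)
    (Ω : Set M) (hΩ : IsOpen Ω) (hΩne : Ω.Nonempty) (hΩc : IsCompact (closure Ω))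
    (u f : M → ℝ) (hu : SphereCovering.SmoothOnClosure Ω u)
    (heq : ∀ x ∈ Ω, -SphereCovering.laplacian u x + κ = lam * Real.exp (2 * u x) + f x)
    (hbd : ∀ x ∈ frontier Ω, u x = 0) (hpos : ∀ x ∈ Ω, 0 < u x)
    (Θ : ℝ) (hΘ : Θ = 1 / (2 * Real.pi) * ∫ x in Ω, max (f x) 0 ∂(SphereCovering.area M)) :
    (4 * Real.pi * (θ - Θ) * (∫ x in Ω, Real.exp (2 * u x) ∂(SphereCovering.area M))
        - lam * (∫ x in Ω, Real.exp (2 * u x) ∂(SphereCovering.area M)) ^ 2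
      ≤ 4 * Real.pi * θ * (SphereCovering.area M).real Ω
        - κ * (SphereCovering.area M).real Ω ^ 2) ∧
    (Θ = 0 → 0 < lam → lam ≤ κ →
      4 * Real.pi * θ / lam
        ≤ (∫ x in Ω, Real.exp (2 * u x) ∂(SphereCovering.area M))
          + (SphereCovering.area M).real Ω) := by
  have hpi := Real.pi_pos
  have h := SphereCovering.liouville_comparison hθ0.le hiso hΩ hΩc hu heq hbd hpos
  have hlt := SphereCovering.area_lt_integral_exp hΩ hΩne hΩc hu.continuousOn hpos
  have hΘ' : ∫ x in Ω, max (f x) 0 ∂(SphereCovering.area M) = 2 * Real.pi * Θ := by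
    rw [hΘ]; field_simp
  rw [hΘ'] at h
  set A := ∫ x in Ω, Real.exp (2 * u x) ∂(SphereCovering.area M)
  set m := (SphereCovering.area M).real Ω
  refine ⟨by linarith, fun hΘ0 hlam hκ ↦ ?_⟩
  rw [hΘ0, mul_zero, mul_zero, zero_mul, zero_add] at h
  have h1 : lam * m ^ 2 ≤ κ * m ^ 2 := mul_le_mul_of_nonneg_right hκ (sq_nonneg m)
  -- With `Θ = 0` and `λ ≤ κ` the comparison reads `4πθ(A - m) ≤ λ(A² - m²)`; it remains to divide
  -- by `A - m`, which is positive because `u > 0` on a nonempty open set.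
  have h2 : (A - m) * (4 * Real.pi * θ) ≤ (A - m) * ((A + m) * lam) := by linarith
  rw [div_le_iff₀ hlam]
  exact le_of_mul_le_mul_left h2 (sub_pos.2 hlt)
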